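/- Work on $\mathbb{R}^3$ with $\hat f(\xi)=\int e^{-2\pi i x\cdot\xi}f(x)\,dx$. Let $\dot H^1$ be the space of real vector fields (tempered distributions) $u$ whose Fourier transform is a function with $\|u\|_{\dot H^1}^2=\int(2\pi|\xi|)^2|\hat u(\xi)|^2d\xi<\infty$, let $(\nabla_{sym}u)_{ij}=\frac12(\partial_iu_j+\partial_ju_i)$, and let $$L^2_{st}=\{\nabla_{sym}u: u\in\dot H^1,\ \nabla\cdot u=0\}\subset L^2(\mathbb{R}^3;\mathbb{R}^{3\times3}),$$ where $L^2$ norms of matrix fields are taken with the Frobenius norm. Let $P_{st}$ be the orthogonal projection of $L^2$ onto the closed subspace $L^2_{st}$, and let $e^{t\Delta}f=G(\cdot,t)*f$ with $G(x,t)=(4\pi t)^{-3/2}e^{-|x|^2/(4t)}$. For $0<T\le\infty$, a function $S\in C([0,T);L^2_{st})$ is called a mild solution on $[0,T)$ of the strain self-amplification model equation $$\partial_tS-\Delta S+\tfrac23P_{st}(S^2)=0$$ with initial data $S^0=S(0)$ if for all $0<t<T$ $$S(t)=e^{t\Delta}S^0-\frac23\int_0^te^{\tau\Delta}P_{st}\big(S^2(t-\tau)\big)\,d\tau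 ,$$ where $S^2$ is the matrix square (an element of $L^1$), $e^{\tau\Delta}P_{st}(S^2)$ means $P_{st}(e^{\tau\Delta}S^2)$, and the integral is an $L^2$-valued Bochner integral. The time $T$ is called maximal if no mild solution with the same initial data exists on any $[0,T')$ with $T'>T$. Let $\lambda_1(x,t)\le\lambda_2(x,t)\le\lambda_3(x,t)$ be the eigenvalues of $S(x,t)$ and $\lambda_2^+=\max\{0,\lambda_2\}$. **Theorem.** Let $\frac32<q\le\infty$ and let $p$ be given by $\frac2p+\frac3q=2$. There is a constant $C_q>0$, depending only on $q$, such that for every $0<T_{max}\le\infty$ and every mild solution $S\in C([0,T_{max});L^2_{st})$ of the strain self-amplification model equation: 1. for all $0<t<T_{max}$, $$\|S(t)\|_{L^2}^2\le\|S^0\|_{L^2}^2\exp\left(C_q\int_0^t\|\lambda_2^+(\tau)\|_{L^q}^p\,d\tau\right),$$ where norms and integrals of nonnegative functions may be $+\infty$, $\exp(+\infty)=+\infty$, and $0\cdot\infty=0$; 2. if $T_{max}$ is maximal and $T_{max}<\infty$, then $$\int_0^{T_{max}}\|\lambda_2^+(t)\|_{L^q}^p\,dt=+\infty .$$ -/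

import Mathlib

open MeasureTheory Filter Topology
open scoped ENNReal FourierTransform

noncomputable section

/-- Physical (and frequency) space `ℝ³` with its Euclidean norm. -/
abbrev R3 : Type := EuclideanSpace ℝ (Fin 3)

/-- Real `3 × 3` matrices with the Frobenius inner product. -/
abbrev Mat3 : Type := EuclideanSpace ℝ (Fin 3 × Fin 3)

/-- Complex `3 × 3` matrices with the Frobenius inner product. -/
abbrev CMat3 : Type := EuclideanSpace ℂ (Fin 3 × Fin 3)

/-- `L²(ℝ³; ℝ^{3×3})`. -/
abbrev L2Mat : Type := Lp Mat3 2 (volume : Measure R3)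

/-- An element of `Mat3` as a matrix. -/
def Mat3.toMatrix (M : Mat3) : Matrix (Fin 3) (Fin 3) ℝ :=
  Matrix.of fun i j => M (i, j)

/-- The matrix square `M ↦ M²` on `Mat3`. -/
def matSq (M : Mat3) : Mat3 :=
  WithLp.toLp 2 fun ij => (Mat3.toMatrix M * Mat3.toMatrix M) ij.1 ij.2

/-- Entrywise inclusion of real matrices into complex matrices. -/
def complexify : Mat3 →L[ℝ] CMat3 :=
  LinearMap.toContinuousLinearMap
    { toFun := fun M => WithLp.toLp 2 fun ij => ((M ij : ℝ) : ℂ)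
      map_add' := fun M N => by ext ij; simp
      map_smul' := fun c M => by ext ij; simp }

/-- The Fourier transform `f̂(ξ) = ∫ exp(-2πi x·ξ) f(x) dx` of a matrix field in `L²`. -/
def fourierL2 (S : L2Mat) : Lp CMat3 2 (volume : Measure R3) :=
  𝓕 (complexify.compLp S)

/-- `v` is the Fourier transform of a real divergence free vector field in the homogeneous Sobolev
space `Ḣ¹(ℝ³; ℝ³)`. As `1 < 3/2`, elements of `Ḣ¹` are exactly the tempered distributions whose
Fourier transform is a function `v` with `∫ (2π|ξ|)² |v(ξ)|² dξ < ∞`. -/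
structure IsFourierOfH1df (v : R3 → EuclideanSpace ℂ (Fin 3)) : Prop where
  measurable : AEStronglyMeasurable v volume
  finite_norm : MemLp (fun ξ => (2 * Real.pi * ‖ξ‖) • v ξ) 2 volume
  real : ∀ᵐ ξ : R3, ∀ i, v (-ξ) i = (starRingEnd ℂ) (v ξ i)
  div_free : ∀ᵐ ξ : R3, ∑ i, (ξ i : ℂ) * v ξ i = 0

/-- `Ŝ = (∇_sym u)^`, where `v = û`: on the Fourier side `∂_i` is multiplication by `2πi ξ_i`. -/
def IsSymGradient (S : L2Mat) (v : R3 → EuclideanSpace ℂ (Fin 3)) : Prop :=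
  ∀ᵐ ξ : R3, ∀ i j, fourierL2 S ξ (i, j) =
    (1 / 2 : ℂ) * ((2 * Real.pi * Complex.I * ξ i) * v ξ j
      + (2 * Real.pi * Complex.I * ξ j) * v ξ i)

theorem fourierL2_add (S T : L2Mat) : fourierL2 (S + T) = fourierL2 S + fourierL2 T := by
  have h : complexify.compLp (S + T) = complexify.compLp S + complexify.compLp T :=
    (complexify.compLpL 2 (volume : Measure R3)).map_add S T
  unfold fourierL2
  rw [h]
  exact FourierTransform.fourier_add _ _

theorem fourierL2_smul (c : ℝ) (S : L2Mat) : fourierL2 (c • S) = (c : ℂ) • fourierL2 S := by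
  have h : complexify.compLp (c • S) = (c : ℂ) • complexify.compLp S := by
    have h1 : complexify.compLp (c • S) = c • complexify.compLp S :=
      (complexify.compLpL 2 (volume : Measure R3)).map_smul c S
    rw [h1]
    ext1
    filter_upwards [Lp.coeFn_smul c (complexify.compLp S),
      Lp.coeFn_smul (c : ℂ) (complexify.compLp S)] with x h1 h2
    rw [h1, h2]
    ext i
    simp
  unfold fourierL2
  rw [h]
  exact FourierTransform.fourier_smul _ _

theorem continuous_fourierL2 : Continuous fourierL2 := by
  have h : Continuous fun S : L2Mat => complexify.compLp S :=
    (complexify.compLpL 2 (volume : Measure R3)).continuous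
  exact (FourierTransform.continuous_fourier).comp h

/-- The space of strain matrices `L²_st = {∇_sym u : u ∈ Ḣ¹, ∇·u = 0}`. -/
def L2st : Submodule ℝ L2Mat where
  carrier := {S | ∃ v, IsFourierOfH1df v ∧ IsSymGradient S v}
  zero_mem' := by
    refine ⟨0, ⟨aestronglyMeasurable_zero, ?_, ?_, ?_⟩, ?_⟩
    · simp
    · simp
    · simp
    · have h0 : fourierL2 0 = 0 := by simpa using fourierL2_smul 0 0
      unfold IsSymGradient
      rw [h0]
      filter_upwards [Lp.coeFn_zero CMat3 2 (volume : Measure R3)] with ξ hξ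
      simp
  add_mem' := by
    rintro S T ⟨v, hv, hS⟩ ⟨w, hw, hT⟩
    refine ⟨v + w, ⟨hv.1.add hw.1, ?_, ?_, ?_⟩, ?_⟩
    · simpa [smul_add] using! hv.2.add hw.2
    · filter_upwards [hv.3, hw.3] with ξ h1 h2 i
      simp [h1, h2]
    · filter_upwards [hv.4, hw.4] with ξ h1 h2
      simp only [Pi.add_apply, PiLp.add_apply, mul_add, Finset.sum_add_distrib, h1, h2, add_zero]
    · unfold IsSymGradient
      rw [fourierL2_add]
      filter_upwards [hS, hT, Lp.coeFn_add (fourierL2 S) (fourierL2 T)] with ξ h1 h2 h3 i j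
      rw [h3]
      simp only [Pi.add_apply, PiLp.add_apply, h1, h2]
      ring
  smul_mem' := by
    rintro c S ⟨v, hv, hS⟩
    refine ⟨fun ξ => (c : ℂ) • v ξ, ⟨hv.1.const_smul (c : ℂ), ?_, ?_, ?_⟩, ?_⟩
    · convert! hv.2.const_smul (c : ℂ) using 2 with ξ
      ext i
      simp
      ring
    · filter_upwards [hv.3] with ξ h1 i
      simp [h1]
    · filter_upwards [hv.4] with ξ h1
      have : ∑ i, (ξ i : ℂ) * ((c : ℂ) • v ξ) i = c * ∑ i, (ξ i : ℂ) * v ξ i := by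
        rw [Finset.mul_sum]
        refine Finset.sum_congr rfl fun i _ => ?_
        simp
        ring
      rw [this, h1, mul_zero]
    · unfold IsSymGradient
      rw [fourierL2_smul]
      filter_upwards [hS, Lp.coeFn_smul (c : ℂ) (fourierL2 S)] with ξ h1 h3 i j
      rw [h3]
      simp only [Pi.smul_apply, PiLp.smul_apply, h1, smul_eq_mul]
      ring

/-- The pointwise linear equations in frequency that characterise `L²_st`. -/
def StrainSymbol (F : R3 → CMat3) (ξ : R3) : Prop :=
  (∀ i j, F (-ξ) (i, j) = (starRingEnd ℂ) (F ξ (i, j))) ∧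
  (∑ j, (ξ j : ℂ) * ∑ k, F ξ (j, k) * ξ k = 0) ∧
  ∀ i j, (‖ξ‖ ^ 2 : ℝ) * F ξ (i, j) =
    ξ i * ∑ k, F ξ (j, k) * ξ k + ξ j * ∑ k, F ξ (i, k) * ξ k

theorem norm_sq_R3 (ξ : R3) :
    (((‖ξ‖ ^ 2 : ℝ)) : ℂ) = (ξ 0 : ℂ) ^ 2 + (ξ 1 : ℂ) ^ 2 + (ξ 2 : ℂ) ^ 2 := by
  rw [EuclideanSpace.real_norm_sq_eq, Fin.sum_univ_three]
  push_cast
  ring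

theorem strainSymbol_of_mem {S : L2Mat} (hS : S ∈ L2st) :
    ∀ᵐ ξ : R3, StrainSymbol (fourierL2 S) ξ := by
  obtain ⟨v, hv, hS⟩ := hS
  have hneg : Tendsto (fun ξ : R3 => -ξ) (ae volume) (ae volume) :=
    (Measure.measurePreserving_neg (volume : Measure R3)).quasiMeasurePreserving.tendsto_ae
  filter_upwards [hS, hneg.eventually hS, hv.3, hv.4] with ξ h1 h2 h3 h4
  rw [Fin.sum_univ_three] at h4
  refine ⟨fun i j => ?_, ?_, fun i j => ?_⟩
  · have h5 : (starRingEnd ℂ) 2 = 2 := Complex.conj_ofNat 2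
    rw [h1, h2, h3, h3]
    simp [h5]
  · simp only [h1, Fin.sum_univ_three]
    linear_combination (2 * Real.pi * Complex.I * ((ξ 0 : ℂ) ^ 2 + (ξ 1 : ℂ) ^ 2 + (ξ 2 : ℂ) ^ 2)) * h4
  · rw [norm_sq_R3]
    simp only [h1, Fin.sum_univ_three]
    linear_combination (-(2 * Real.pi * Complex.I * ξ i * ξ j)) * h4

theorem mem_of_strainSymbol {S : L2Mat} (hS : ∀ᵐ ξ : R3, StrainSymbol (fourierL2 S) ξ) :
    S ∈ L2st := by
  set F := fourierL2 S with hF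
  have hne : ∀ᵐ ξ : R3, ξ ≠ 0 := by simp [ae_iff]
  have hFm : AEStronglyMeasurable F volume := Lp.aestronglyMeasurable F
  have hpi : (Real.pi : ℂ) ≠ 0 := by exact_mod_cast Real.pi_ne_zero
  have hn : ∀ ξ : R3, ξ ≠ 0 → (((‖ξ‖ ^ 2 : ℝ)) : ℂ) ≠ 0 := by
    intro ξ h
    exact_mod_cast (pow_pos (norm_pos_iff.2 h) 2).ne'
  let w : R3 → Fin 3 → ℂ := fun ξ j => ∑ k, F ξ (j, k) * ξ k
  let v : R3 → EuclideanSpace ℂ (Fin 3) := fun ξ =>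
    WithLp.toLp 2 fun j => w ξ j / (Real.pi * Complex.I * ((‖ξ‖ ^ 2 : ℝ)))
  have hv : ∀ ξ j, v ξ j = w ξ j / (Real.pi * Complex.I * ((‖ξ‖ ^ 2 : ℝ))) := fun _ _ => rfl
  have hvm : AEStronglyMeasurable v volume := by
    have hFjk : ∀ jk, AEMeasurable (fun ξ => F ξ jk) volume := by
      intro jk
      exact ((EuclideanSpace.proj jk : CMat3 →L[ℂ] ℂ).continuous.comp_aestronglyMeasurable
        hFm).aemeasurable
    have hξ : ∀ k : Fin 3, Measurable fun ξ : R3 => ((ξ k : ℝ) : ℂ) := by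
      intro k
      exact Complex.measurable_ofReal.comp
        (EuclideanSpace.proj k : R3 →L[ℝ] ℝ).continuous.measurable
    have h1 : AEMeasurable (fun ξ => fun j => w ξ j / (Real.pi * Complex.I * ((‖ξ‖ ^ 2 : ℝ))))
        (volume : Measure R3) := by
      refine aemeasurable_pi_lambda _ fun j => ?_
      refine AEMeasurable.div ?_ ?_
      · exact Finset.aemeasurable_fun_sum _ fun k _ => (hFjk (j, k)).mul (hξ k).aemeasurable
      · fun_prop
    exact (PiLp.continuous_toLp 2 (fun _ : Fin 3 => ℂ)).comp_aestronglyMeasurable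
      h1.aestronglyMeasurable
  refine ⟨v, ⟨hvm, ?_, ?_, ?_⟩, ?_⟩
  · refine MemLp.of_le_mul (c := 18) (Lp.memLp F) ?_ ?_
    · have : Continuous fun ξ : R3 => 2 * Real.pi * ‖ξ‖ := by fun_prop
      exact this.aestronglyMeasurable.smul hvm
    · filter_upwards [hne] with ξ h0
      have hp : 0 < ‖ξ‖ := norm_pos_iff.2 h0
      have hw : ∀ j, ‖w ξ j‖ ≤ 3 * (‖F ξ‖ * ‖ξ‖) := by
        intro j
        refine (norm_sum_le _ _).trans ?_
        have : ∀ k ∈ (Finset.univ : Finset (Fin 3)), ‖F ξ (j, k) * ξ k‖ ≤ ‖F ξ‖ * ‖ξ‖ := by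
          intro k _
          rw [norm_mul]
          refine mul_le_mul (PiLp.norm_apply_le _ _) ?_ (norm_nonneg _) (norm_nonneg _)
          rw [Complex.norm_real]
          exact PiLp.norm_apply_le _ _
        refine (Finset.sum_le_sum this).trans ?_
        simp
      have hvj : ∀ j, ‖v ξ j‖ ≤ 3 * ‖F ξ‖ / (Real.pi * ‖ξ‖) := by
        intro j
        rw [hv, norm_div, norm_mul, norm_mul, Complex.norm_I, Complex.norm_real,
          Complex.norm_real, Real.norm_of_nonneg Real.pi_pos.le,
          Real.norm_of_nonneg (by positivity)]
        rw [div_le_div_iff₀ (by positivity) (by positivity)]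
        have := hw j
        calc ‖w ξ j‖ * (Real.pi * ‖ξ‖) ≤ 3 * (‖F ξ‖ * ‖ξ‖) * (Real.pi * ‖ξ‖) := by gcongr
          _ = _ := by ring
      have hvn : ‖v ξ‖ ≤ 9 * ‖F ξ‖ / (Real.pi * ‖ξ‖) := by
        rw [EuclideanSpace.norm_eq]
        refine Real.sqrt_le_iff.2 ⟨by positivity, ?_⟩
        set a := 3 * ‖F ξ‖ / (Real.pi * ‖ξ‖) with ha
        have ha0 : 0 ≤ a := by positivity
        have h9 : 9 * ‖F ξ‖ / (Real.pi * ‖ξ‖) = 3 * a := by rw [ha]; ring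
        rw [h9]
        calc ∑ j, ‖v ξ j‖ ^ 2 ≤ ∑ _j : Fin 3, a ^ 2 :=
              Finset.sum_le_sum fun j _ => pow_le_pow_left₀ (norm_nonneg _) (hvj j) 2
          _ ≤ (3 * a) ^ 2 := by simp; nlinarith
      rw [norm_smul, Real.norm_of_nonneg (by positivity)]
      calc 2 * Real.pi * ‖ξ‖ * ‖v ξ‖
          ≤ 2 * Real.pi * ‖ξ‖ * (9 * ‖F ξ‖ / (Real.pi * ‖ξ‖)) := by gcongr
        _ = 18 * ‖F ξ‖ := by
          have := Real.pi_ne_zero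
          field_simp
          ring
  · filter_upwards [hS] with ξ h i
    rw [hv, hv]
    have hw : w (-ξ) i = -(starRingEnd ℂ) (w ξ i) := by
      simp only [w, h.1, map_sum, map_mul, Complex.conj_ofReal]
      simp
    rw [hw]
    simp [div_neg, neg_div]
  · filter_upwards [hS, hne] with ξ h h0
    have h1 : ∑ i, (ξ i : ℂ) * v ξ i
        = (∑ i, (ξ i : ℂ) * w ξ i) / (Real.pi * Complex.I * ((‖ξ‖ ^ 2 : ℝ))) := by
      rw [Finset.sum_div]
      refine Finset.sum_congr rfl fun i _ => ?_
      rw [hv]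
      ring
    rw [h1]
    have h2 : ∑ i, (ξ i : ℂ) * w ξ i = 0 := h.2.1
    rw [h2, zero_div]
  · unfold IsSymGradient
    filter_upwards [hS, hne] with ξ h h0 i j
    have h1 : (((‖ξ‖ ^ 2 : ℝ)) : ℂ) * F ξ (i, j) = ξ i * w ξ j + ξ j * w ξ i := h.2.2 i j
    have h2 := hn ξ h0
    rw [hv, hv]
    have h3 := Complex.I_ne_zero
    rw [← hF]
    apply mul_left_cancel₀ h2
    rw [h1]
    generalize (((‖ξ‖ ^ 2 : ℝ)) : ℂ) = n at h2
    field_simp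

theorem mem_L2st_iff (S : L2Mat) :
    S ∈ L2st ↔ ∀ᵐ ξ : R3, StrainSymbol (fourierL2 S) ξ :=
  ⟨strainSymbol_of_mem, mem_of_strainSymbol⟩

theorem isClosed_L2st : IsClosed (L2st : Set L2Mat) := by
  refine IsSeqClosed.isClosed fun S S₀ hS hlim => ?_
  have hF : Tendsto (fun n => fourierL2 (S n)) atTop (𝓝 (fourierL2 S₀)) :=
    (continuous_fourierL2.tendsto S₀).comp hlim
  obtain ⟨ns, -, hns⟩ := (tendstoInMeasure_of_tendsto_Lp hF).exists_seq_tendsto_ae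
  have hneg : Tendsto (fun ξ : R3 => -ξ) (ae volume) (ae volume) :=
    (Measure.measurePreserving_neg (volume : Measure R3)).quasiMeasurePreserving.tendsto_ae
  have hall : ∀ᵐ ξ : R3, ∀ n, StrainSymbol (fourierL2 (S n)) ξ :=
    ae_all_iff.2 fun n => strainSymbol_of_mem (hS n)
  refine mem_of_strainSymbol ?_
  filter_upwards [hns, hneg.eventually hns, hall] with ξ h1 h2 h3
  have key : ∀ {x : R3}, Tendsto (fun n => fourierL2 (S (ns n)) x) atTop (𝓝 (fourierL2 S₀ x)) →
      ∀ ij, Tendsto (fun n => fourierL2 (S (ns n)) x ij) atTop (𝓝 (fourierL2 S₀ x ij)) :=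
    fun h ij => ((EuclideanSpace.proj ij : CMat3 →L[ℂ] ℂ).continuous.tendsto _).comp h
  have k1 := key h1
  have k2 := key h2
  have kw : ∀ j, Tendsto (fun n => ∑ k, fourierL2 (S (ns n)) ξ (j, k) * ξ k) atTop
      (𝓝 (∑ k, fourierL2 S₀ ξ (j, k) * ξ k)) :=
    fun j => tendsto_finsetSum _ fun k _ => (k1 (j, k)).mul_const _
  refine ⟨fun i j => ?_, ?_, fun i j => ?_⟩
  · refine tendsto_nhds_unique (k2 (i, j)) ?_
    refine (((Complex.continuous_conj.tendsto _).comp (k1 (i, j))).congr fun n => ?_)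
    exact ((h3 (ns n)).1 i j).symm
  · refine tendsto_nhds_unique
      (tendsto_finsetSum Finset.univ fun j _ => (kw j).const_mul (ξ j : ℂ)) ?_
    refine tendsto_const_nhds.congr fun n => ?_
    exact ((h3 (ns n)).2.1).symm
  · refine tendsto_nhds_unique ((k1 (i, j)).const_mul _) ?_
    refine Tendsto.congr (fun n => ?_)
      (((kw j).const_mul (ξ i : ℂ)).add ((kw i).const_mul (ξ j : ℂ)))
    exact ((h3 (ns n)).2.2 i j).symm

instance instCompleteSpaceL2st : CompleteSpace L2st := isClosed_L2st.completeSpace_coe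

/-- The orthogonal projection `P_st` of `L²` onto `L²_st`. -/
def Pst : L2Mat →L[ℝ] L2Mat := L2st.starProjection

/-- The heat kernel `G(x,t) = (4πt)^{-3/2} exp(-|x|²/(4t))`. -/
def heatKernel (t : ℝ) (x : R3) : ℝ :=
  1 / (4 * Real.pi * t) ^ (3 / 2 : ℝ) * Real.exp (-‖x‖ ^ 2 / (4 * t))

/-- `e^{tΔ} f = G(·,t) * f`. -/
def heatConv (t : ℝ) (f : R3 → Mat3) : R3 → Mat3 :=
  convolution (heatKernel t) f (ContinuousLinearMap.lsmul ℝ ℝ) volume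

theorem integrable_gaussian {b : ℝ} (hb : 0 < b) :
    Integrable fun x : R3 => Real.exp (-b * ‖x‖ ^ 2) := by
  have h := (GaussianFourier.integrable_cexp_neg_mul_sq_norm_add (V := R3) (b := (b : ℂ))
    (by simpa using hb) 0 0).norm
  refine h.congr (Eventually.of_forall fun x => ?_)
  simp only [Complex.norm_exp]
  congr 1
  have : (-(b : ℂ) * (‖x‖ : ℂ) ^ 2 + 0 * ((inner ℝ (0 : R3) x : ℝ) : ℂ))
      = ((-b * ‖x‖ ^ 2 : ℝ) : ℂ) := by push_cast; ring
  rw [this, Complex.ofReal_re]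

theorem heatKernel_nonneg {t : ℝ} (ht : 0 < t) (x : R3) : 0 ≤ heatKernel t x := by
  unfold heatKernel
  positivity

theorem continuous_heatKernel (t : ℝ) : Continuous (heatKernel t) := by
  unfold heatKernel
  fun_prop

theorem integrable_heatKernel {t : ℝ} (ht : 0 < t) : Integrable (heatKernel t) := by
  refine ((integrable_gaussian (b := 1 / (4 * t)) (by positivity)).const_mul
    (1 / (4 * Real.pi * t) ^ (3 / 2 : ℝ))).congr (Eventually.of_forall fun x => ?_)
  unfold heatKernel
  dsimp only
  congr 2
  ring

theorem integrable_heatKernel_sq {t : ℝ} (ht : 0 < t) :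
    Integrable fun x => heatKernel t x ^ 2 := by
  refine ((integrable_gaussian (b := 1 / (2 * t)) (by positivity)).const_mul
    ((1 / (4 * Real.pi * t) ^ (3 / 2 : ℝ)) ^ 2)).congr (Eventually.of_forall fun x => ?_)
  unfold heatKernel
  dsimp only
  rw [mul_pow, ← Real.exp_nat_mul]
  congr 2
  push_cast
  field_simp
  ring

theorem measurePreserving_sub_left' (x : R3) :
    MeasurePreserving (fun y : R3 => x - y) volume volume :=
  Measure.measurePreserving_sub_left volume x

theorem lintegral_conv {A B : R3 → ℝ≥0∞} (hA : AEMeasurable A volume)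
    (hB : AEMeasurable B volume) :
    ∫⁻ x, ∫⁻ y, A y * B (x - y) = (∫⁻ y, A y) * ∫⁻ y, B y := by
  have hq : Measure.QuasiMeasurePreserving (fun p : R3 × R3 => p.1 - p.2)
      ((volume : Measure R3).prod volume) volume :=
    quasiMeasurePreserving_sub_of_right_invariant _ _
  rw [lintegral_lintegral_swap (hA.comp_snd.mul (hB.comp_quasiMeasurePreserving hq))]
  rw [← lintegral_mul_const'' _ hA]
  refine lintegral_congr fun y => ?_
  have hy : AEMeasurable (fun x => B (x - y)) volume :=
    hB.comp_quasiMeasurePreserving (measurePreserving_sub_right volume y).quasiMeasurePreserving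
  rw [lintegral_const_mul'' _ hy, lintegral_sub_right_eq_self]

theorem cauchy_schwarz {a b : R3 → ℝ≥0∞} (ha : AEMeasurable a volume)
    (hb : AEMeasurable b volume) :
    (∫⁻ y, a y * b y) ^ 2 ≤ (∫⁻ y, a y ^ 2) * ∫⁻ y, b y ^ 2 := by
  have h := ENNReal.lintegral_mul_le_Lp_mul_Lq (volume : Measure R3)
    Real.HolderConjugate.two_two ha hb
  have h' := ENNReal.rpow_le_rpow h (z := 2) (by norm_num)
  rw [ENNReal.mul_rpow_of_nonneg _ _ (by norm_num), ← ENNReal.rpow_mul, ← ENNReal.rpow_mul] at h'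
  norm_num at h'
  simpa using h'

theorem memLp_heatConv {t : ℝ} (ht : 0 < t) {f : R3 → Mat3}
    (hf : MemLp f 1 volume ∨ MemLp f 2 volume) : MemLp (heatConv t f) 2 volume := by
  have hfm : AEStronglyMeasurable f volume := hf.elim (fun h => h.1) fun h => h.1
  set K : R3 → ℝ≥0∞ := fun x => ‖heatKernel t x‖ₑ with hK
  set g : R3 → ℝ≥0∞ := fun x => ‖f x‖ₑ with hg
  have hKm : AEMeasurable K volume := (continuous_heatKernel t).measurable.enorm.aemeasurable
  have hgm : AEMeasurable g volume := hfm.enorm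
  have hK1 : ∫⁻ y, K y < ∞ := (integrable_heatKernel ht).2
  have hK2 : ∫⁻ y, K y ^ 2 < ∞ := by
    have := (integrable_heatKernel_sq ht).2
    simpa [HasFiniteIntegral, hK, enorm_pow] using! this
  have hgx : ∀ x, AEMeasurable (fun y => g (x - y)) volume := fun x =>
    hgm.comp_quasiMeasurePreserving (measurePreserving_sub_left' x).quasiMeasurePreserving
  have hgi : ∀ x, ∫⁻ y, g (x - y) = ∫⁻ y, g y := fun x => lintegral_sub_left_eq_self g x
  have hbound : ∀ x, ‖heatConv t f x‖ₑ ≤ ∫⁻ y, K y * g (x - y) := by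
    intro x
    refine (enorm_integral_le_lintegral_enorm _).trans (lintegral_mono fun y => ?_)
    simp [hK, hg, enorm_smul]
  refine ⟨?_, ?_⟩
  · exact (AEStronglyMeasurable.convolution_integrand (ContinuousLinearMap.lsmul ℝ ℝ)
      (continuous_heatKernel t).aestronglyMeasurable hfm).integral_prod_right'
  rw [eLpNorm_lt_top_iff_lintegral_rpow_enorm_lt_top (by norm_num) (by norm_num)]
  have hgoal : ∫⁻ x, (∫⁻ y, K y * g (x - y)) ^ 2 < ∞ := by
    rcases hf with hf | hf
    · have hg1 : ∫⁻ y, g y < ∞ := (memLp_one_iff_integrable.1 hf).2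
      have hCS : ∀ x, (∫⁻ y, K y * g (x - y)) ^ 2
          ≤ (∫⁻ y, K y ^ 2 * g (x - y)) * ∫⁻ y, g y := by
        intro x
        have h := cauchy_schwarz (hKm.mul ((hgx x).pow_const (1 / 2 : ℝ)))
          ((hgx x).pow_const (1 / 2 : ℝ))
        have e : ∀ z : ℝ≥0∞, z ^ (1 / 2 : ℝ) * z ^ (1 / 2 : ℝ) = z := by
          intro z
          rw [← ENNReal.rpow_add_of_nonneg _ _ (by norm_num) (by norm_num)]
          norm_num
        have e2 : ∀ z : ℝ≥0∞, (z ^ (1 / 2 : ℝ)) ^ 2 = z := fun z => by rw [sq, e]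
        simp only [Pi.mul_apply, mul_assoc, e, mul_pow, e2] at h
        rwa [hgi] at h
      refine (lintegral_mono hCS).trans_lt ?_
      rw [lintegral_mul_const' _ _ hg1.ne, lintegral_conv (hKm.pow_const 2) hgm]
      exact ENNReal.mul_lt_top (ENNReal.mul_lt_top hK2 hg1) hg1
    · have hg2 : ∫⁻ y, g y ^ 2 < ∞ := by
        have := hf.2
        rw [eLpNorm_lt_top_iff_lintegral_rpow_enorm_lt_top (by norm_num) (by norm_num)] at this
        simpa using this
      have hCS : ∀ x, (∫⁻ y, K y * g (x - y)) ^ 2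
          ≤ (∫⁻ y, K y * g (x - y) ^ 2) * ∫⁻ y, K y := by
        intro x
        have h := cauchy_schwarz ((hKm.pow_const (1 / 2 : ℝ)).mul (hgx x))
          (hKm.pow_const (1 / 2 : ℝ))
        have e : ∀ z : ℝ≥0∞, z ^ (1 / 2 : ℝ) * z ^ (1 / 2 : ℝ) = z := by
          intro z
          rw [← ENNReal.rpow_add_of_nonneg _ _ (by norm_num) (by norm_num)]
          norm_num
        have e2 : ∀ z : ℝ≥0∞, (z ^ (1 / 2 : ℝ)) ^ 2 = z := fun z => by rw [sq, e]
        have e3 : ∀ z u : ℝ≥0∞, z ^ (1 / 2 : ℝ) * u * z ^ (1 / 2 : ℝ) = z * u := by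
          intro z u
          rw [mul_right_comm, e]
        simpa only [Pi.mul_apply, e3, mul_pow, e2] using h
      refine (lintegral_mono hCS).trans_lt ?_
      rw [lintegral_mul_const' _ _ hK1.ne,
        lintegral_conv (B := fun z => g z ^ 2) hKm (hgm.pow_const 2)]
      exact ENNReal.mul_lt_top (ENNReal.mul_lt_top hK1 hg2) hK1
  refine lt_of_le_of_lt (lintegral_mono fun x => ?_) hgoal
  simpa using pow_le_pow_left' (hbound x) 2

theorem continuous_matSq : Continuous matSq := by
  unfold matSq
  refine (PiLp.continuous_toLp 2 (fun _ : Fin 3 × Fin 3 => ℝ)).comp ?_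
  refine continuous_pi fun ij => ?_
  simp only [Mat3.toMatrix, Matrix.mul_apply, Matrix.of_apply]
  fun_prop

theorem norm_matSq_le (M : Mat3) : ‖matSq M‖ ≤ 9 * ‖M‖ ^ 2 := by
  have hij : ∀ ij, ‖matSq M ij‖ ≤ 3 * ‖M‖ ^ 2 := by
    intro ij
    have h1 : matSq M ij = ∑ k, M (ij.1, k) * M (k, ij.2) := by
      simp [matSq, Mat3.toMatrix, Matrix.mul_apply]
    rw [h1]
    refine (norm_sum_le _ _).trans ?_
    have : ∀ k ∈ (Finset.univ : Finset (Fin 3)), ‖M (ij.1, k) * M (k, ij.2)‖ ≤ ‖M‖ ^ 2 := by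
      intro k _
      rw [norm_mul, sq]
      exact mul_le_mul (PiLp.norm_apply_le _ _) (PiLp.norm_apply_le _ _) (norm_nonneg _)
        (norm_nonneg _)
    refine (Finset.sum_le_sum this).trans ?_
    simp
  rw [EuclideanSpace.norm_eq]
  refine Real.sqrt_le_iff.2 ⟨by positivity, ?_⟩
  calc ∑ ij, ‖matSq M ij‖ ^ 2 ≤ ∑ _ij : Fin 3 × Fin 3, (3 * ‖M‖ ^ 2) ^ 2 :=
        Finset.sum_le_sum fun ij _ => pow_le_pow_left₀ (norm_nonneg _) (hij ij) 2
    _ = (9 * ‖M‖ ^ 2) ^ 2 := by simp; ring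

theorem memLp_matSq (S : L2Mat) : MemLp (fun x => matSq (S x)) 1 volume := by
  have h : MemLp (fun x => ‖S x‖ ^ 2) 1 (volume : Measure R3) :=
    memLp_one_iff_integrable.2 ((memLp_two_iff_integrable_sq_norm (Lp.memLp S).1).1 (Lp.memLp S))
  refine MemLp.of_le_mul (c := 9) h
    (continuous_matSq.comp_aestronglyMeasurable (Lp.memLp S).1) ?_
  refine Eventually.of_forall fun x => ?_
  simpa using norm_matSq_le (S x)

open Classical in
/-- `e^{tΔ} f` as an element of `L²`. For `t > 0` and `f` in `L¹` or in `L²` the second case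
does not occur, by `memLp_heatConv`. -/
def heat (t : ℝ) (f : R3 → Mat3) : L2Mat :=
  if h : MemLp (heatConv t f) 2 volume then h.toLp (heatConv t f) else 0

/-- `S ∈ C([0,T); L²_st)` is a mild solution of `∂ₜS - ΔS + (2/3) P_st(S²) = 0`, where
`0 < T ≤ ∞`: for all `0 < t < T`,
`S(t) = e^{tΔ} S(0) - (2/3) ∫₀ᵗ e^{τΔ} P_st(S²(t-τ)) dτ`.
Since `S²` is only in `L¹`, `e^{τΔ} P_st(S²)` is understood as `P_st(e^{τΔ} S²)` with
`e^{τΔ} S² ∈ L²` (both are Fourier multipliers). -/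
structure IsMildSolution (T : EReal) (S : ℝ → L2Mat) : Prop where
  pos : 0 < T
  mem : ∀ t : ℝ, 0 ≤ t → (t : EReal) < T → S t ∈ L2st
  cont : ContinuousOn S {t : ℝ | 0 ≤ t ∧ (t : EReal) < T}
  duhamel : ∀ t : ℝ, 0 < t → (t : EReal) < T →
    S t = heat t (S 0)
      - (2 / 3 : ℝ) • ∫ τ in (0 : ℝ)..t, Pst (heat τ fun x => matSq (S (t - τ) x))

/-- `T` is the maximal time of existence of the mild solution `S` on `[0,T)`: no mild solution
with the same initial data exists on a longer time interval. -/
def IsMaximalTime (T : EReal) (S : ℝ → L2Mat) : Prop :=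
  ∀ (T' : EReal) (S' : ℝ → L2Mat), IsMildSolution T' S' → S' 0 = S 0 → T' ≤ T

open Classical in
/-- The middle eigenvalue of a symmetric `3 × 3` matrix (the eigenvalues `eigenvalues₀` are listed
in decreasing order, with multiplicity); elements of `L²_st` are symmetric almost everywhere. -/
def midEigenvalue (M : Mat3) : ℝ :=
  if h : (Mat3.toMatrix M).IsHermitian then h.eigenvalues₀ ⟨1, by simp⟩ else 0

/-- `λ₂⁺ = max {0, λ₂}`. -/
def midEigenvaluePos (M : Mat3) : ℝ := max 0 (midEigenvalue M)

/-- `‖λ₂⁺‖_{L^q(ℝ³)}`, possibly infinite. -/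
def lamNorm (q : ℝ≥0∞) (S : L2Mat) : ℝ≥0∞ :=
  eLpNorm (fun x => midEigenvaluePos (S x)) q volume

end

/-! The theorem is a conditional energy estimate. Formally, pairing the equation with `S` removes
the projection, because `S` lies in `L2st`, and gives d/dt ‖S‖² = -2‖∇S‖² - (4/3)∫ tr S³. As `S` is
symmetric and trace free, tr S³ = 3λ₁λ₂λ₃ with λ₁ ≤ 0 ≤ λ₃, so -(4/3) tr S³ = 4λ₂(-λ₁λ₃) ≤ 2λ₂⁺|S|²
(`neg_inner_matSq_le`): only λ₂⁺ can make the energy grow. Hölder, interpolation between L² and L⁶,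
and Sobolev bound ∫ V|S|² by a multiple of ‖V‖_q ‖S‖^{2(1-θ)} ‖∇S‖^{2θ} with θ = 3/(2q). Young's
inequality absorbs the gradient into the dissipation and leaves ‖V‖_q^p ‖S‖² with p = 1/(1-θ), which
is the scaling relation (`exists_potential_bound`). Grönwall's inequality then gives the first
assertion.

For the second, the existence time found by contraction depends only on the L² size of the data
(`exists_isLocalSolution`). A solution bounded in L² up to a finite time can therefore be continued
(`IsMildSolution.not_isMaximalTime`), and a finite integral of ‖λ₂⁺‖_q^p would give such a bound.

The energy computation has to be justified for mild solutions, where S² is only in L¹. Duhamel's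
formula and the smoothing of the heat flow gain a quarter of a derivative at a time; iteration gives
H² at positive times (`IsMildSolution.regularity`), so that `S` is bounded and S² is in L².
Duhamel's formula restarted at time t then yields the right derivative of the energy
(`IsMildSolution.hasDerivWithinAt_energy`).

Measurability is arranged rather than proved: in space λ₂⁺ is replaced by the smaller, visibly
measurable `strainRate`, and in time Grönwall's inequality integrates the right derivative of the
logarithm of the energy. If the integral is infinite and S⁰ = 0, the claim is that the solution
vanishes; this is `IsMildSolution.eq_zero`. -/

noncomputable section

/-! ### The L² Fourier transform and the Fourier integral. -/

section FourierLp

variable {F : Type*} [NormedAddCommGroup F] [InnerProductSpace ℂ F] [CompleteSpace F]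

/-- A simple function in L² is supported on a set of finite measure, hence integrable. Identities
for the L² transform are proved on this dense class, where the transform is an integral, and extend
by continuity. -/
theorem dense_integrable_Lp {E : Type*} [NormedAddCommGroup E] :
    Dense {f : Lp E 2 (volume : Measure R3) | Integrable f volume} := by
  refine (Lp.simpleFunc.dense (E := E) (μ := (volume : Measure R3))
    (p := 2) (by norm_num)).mono ?_
  intro f hf
  have hm : MemLp (Lp.simpleFunc.toSimpleFunc ⟨f, hf⟩) 2 (volume : Measure R3) :=
    Lp.simpleFunc.memLp _
  have h1 := (SimpleFunc.memLp_iff_integrable (by norm_num) (by norm_num)).1 hm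
  exact h1.congr (Lp.simpleFunc.toSimpleFunc_eq_toFun ⟨f, hf⟩)

/-- The `L²` Fourier transform agrees with the Fourier integral on integrable functions. -/
theorem fourier_Lp_ae_eq (f : Lp F 2 (volume : Measure R3)) (hf : Integrable f volume) :
    ((𝓕 f : Lp F 2 (volume : Measure R3)) : R3 → F) =ᵐ[volume] 𝓕 (f : R3 → F) := by
  refine ae_eq_of_integral_contDiff_smul_eq
    ((Lp.memLp (𝓕 f : Lp F 2 (volume : Measure R3))).locallyIntegrable (by norm_num)) ?_ ?_
  · exact (VectorFourier.fourierIntegral_continuous Real.continuous_fourierChar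
      (by exact continuous_inner) hf).locallyIntegrable
  · intro g g_smooth g_cpt
    have hg₁ : HasCompactSupport (Complex.ofRealCLM ∘ g) := g_cpt.comp_left rfl
    have hg₂ : ContDiff ℝ ((⊤ : ℕ∞) : WithTop ℕ∞) (Complex.ofRealCLM ∘ g) :=
      Complex.ofRealCLM.contDiff.comp g_smooth
    set G : SchwartzMap R3 ℂ := hg₁.toSchwartzMap hg₂ with hG
    -- The L² transform is the distributional one, so pairing it with `G` moves the transform onto
    -- `G`. The multiplication formula does the same for the Fourier integral.
    have h1 := congrArg (fun T => T G) (Lp.fourier_toTemperedDistribution_eq f)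
    simp only [TemperedDistribution.fourier_apply, Lp.toTemperedDistribution_apply] at h1
    have h2 : ∫ x, (𝓕 G) x • f x = ∫ ξ, G ξ • 𝓕 (f : R3 → F) ξ :=
      VectorFourier.integral_fourierIntegral_smul_eq_flip (L := innerₗ R3)
        Real.continuous_fourierChar (by exact continuous_inner) G.integrable hf |>.trans (by
          simp only [flip_innerₗ]; rfl)
    rw [h1] at h2
    simpa [hG] using h2

theorem fourierInv_Lp_ae_eq (f : Lp F 2 (volume : Measure R3)) (hf : Integrable f volume) :
    ((𝓕⁻ f : Lp F 2 (volume : Measure R3)) : R3 → F) =ᵐ[volume] 𝓕⁻ (f : R3 → F) := by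
  have hneg : MeasurePreserving (fun x : R3 => -x) volume volume :=
    Measure.measurePreserving_neg volume
  have hc : Continuous (𝓕⁻ (f : R3 → F)) := by
    rw [Real.fourierInv_eq_fourier_comp_neg]
    exact VectorFourier.fourierIntegral_continuous Real.continuous_fourierChar
      (by exact continuous_inner) (hf.comp_neg)
  refine ae_eq_of_integral_contDiff_smul_eq
    ((Lp.memLp (𝓕⁻ f : Lp F 2 (volume : Measure R3))).locallyIntegrable (by norm_num))
    hc.locallyIntegrable ?_
  · intro g g_smooth g_cpt
    have hg₁ : HasCompactSupport (Complex.ofRealCLM ∘ g) := g_cpt.comp_left rfl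
    have hg₂ : ContDiff ℝ ((⊤ : ℕ∞) : WithTop ℕ∞) (Complex.ofRealCLM ∘ g) :=
      Complex.ofRealCLM.contDiff.comp g_smooth
    set G : SchwartzMap R3 ℂ := hg₁.toSchwartzMap hg₂ with hG
    have h1 := congrArg (fun T => T G) (Lp.fourierInv_toTemperedDistribution_eq f)
    simp only [TemperedDistribution.fourierInv_apply, Lp.toTemperedDistribution_apply] at h1
    have h2 : ∫ x, (𝓕⁻ G) x • f x = ∫ ξ, G ξ • 𝓕⁻ (f : R3 → F) ξ := by
      -- The multiplication formula for the inverse transform is the forward one applied to the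
      -- reflection of `f`.
      have h3 : ∫ x, (𝓕 G) x • f (-x) = ∫ ξ, G ξ • 𝓕 (fun x => f (-x)) ξ :=
        VectorFourier.integral_fourierIntegral_smul_eq_flip (L := innerₗ R3)
        Real.continuous_fourierChar (by exact continuous_inner) G.integrable hf.comp_neg |>.trans (by
          simp only [flip_innerₗ]; rfl)
      rw [Real.fourierInv_eq_fourier_comp_neg, ← h3]
      refine (integral_neg_eq_self _ volume).symm.trans ?_
      congr 1
      ext x
      rw [SchwartzMap.fourierInv_coe, SchwartzMap.fourier_coe, Real.fourierInv_eq_fourier_neg,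
        neg_neg]
    rw [h1] at h2
    simpa [hG] using h2

end FourierLp

/-! ### Real fields and Hermitian symmetry in frequency. -/

/-- Entrywise complex conjugation. -/
def conjMat : CMat3 →L[ℝ] CMat3 :=
  LinearMap.toContinuousLinearMap
    { toFun := fun M => WithLp.toLp 2 fun ij => (starRingEnd ℂ) (M ij)
      map_add' := fun M N => by ext ij; simp
      map_smul' := fun c M => by ext ij; simp }

/-- Entrywise real part. -/
def reMat : CMat3 →L[ℝ] Mat3 :=
  LinearMap.toContinuousLinearMap
    { toFun := fun M => WithLp.toLp 2 fun ij => (M ij).re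
      map_add' := fun M N => by ext ij; simp
      map_smul' := fun c M => by ext ij; simp }

/-- Entrywise imaginary part. -/
def imMat : CMat3 →L[ℝ] Mat3 :=
  LinearMap.toContinuousLinearMap
    { toFun := fun M => WithLp.toLp 2 fun ij => (M ij).im
      map_add' := fun M N => by ext ij; simp
      map_smul' := fun c M => by ext ij; simp }

@[simp] theorem conjMat_apply (M : CMat3) (ij) : conjMat M ij = (starRingEnd ℂ) (M ij) := rfl
@[simp] theorem reMat_apply (M : CMat3) (ij) : reMat M ij = (M ij).re := rfl
@[simp] theorem imMat_apply (M : CMat3) (ij) : imMat M ij = (M ij).im := rfl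
@[simp] theorem complexify_apply (M : Mat3) (ij) : complexify M ij = (M ij : ℂ) := rfl

@[simp] theorem norm_complexify (M : Mat3) : ‖complexify M‖ = ‖M‖ := by
  simp [EuclideanSpace.norm_eq]

theorem inner_complexify (M N : Mat3) : inner ℂ (complexify M) (complexify N) = (inner ℝ M N : ℝ) := by
  simp [PiLp.inner_apply]

theorem complexify_smul (c : ℝ) (M : Mat3) : complexify (c • M) = (c : ℂ) • complexify M := by
  ext ij; simp

theorem complexify_re_add_im (M : CMat3) :
    complexify (reMat M) + Complex.I • complexify (imMat M) = M := by
  ext ij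
  simp [mul_comm Complex.I, Complex.re_add_im]

/-- `fourierL2` as a continuous linear map. -/
def fourierL2L : L2Mat →L[ℝ] Lp CMat3 2 (volume : Measure R3) where
  toFun := fourierL2
  map_add' := fourierL2_add
  map_smul' c S := by
    rw [fourierL2_smul]
    ext1
    filter_upwards [Lp.coeFn_smul (c : ℂ) (fourierL2 S), Lp.coeFn_smul c (fourierL2 S)]
      with ξ h1 h2
    simp only [RingHom.id_apply]
    rw [h1, h2]
    ext i
    simp
  cont := continuous_fourierL2

@[simp] theorem fourierL2L_apply (S : L2Mat) : fourierL2L S = fourierL2 S := rfl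

theorem norm_fourierL2 (S : L2Mat) : ‖fourierL2 S‖ = ‖S‖ := by
  unfold fourierL2
  rw [Lp.norm_fourier_eq]
  refine le_antisymm (Lp.norm_le_norm_of_ae_le ?_) (Lp.norm_le_norm_of_ae_le ?_) <;>
  · filter_upwards [ContinuousLinearMap.coeFn_compLp complexify S] with x hx
    rw [hx, norm_complexify]

theorem fourierL2_injective : Function.Injective fourierL2 := by
  intro S T h
  have h1 : fourierL2L (S - T) = 0 := by
    rw [map_sub, fourierL2L_apply, fourierL2L_apply, h, sub_self]
  have h2 : ‖S - T‖ = 0 := by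
    rw [← norm_fourierL2, ← fourierL2L_apply, h1, norm_zero]
  exact sub_eq_zero.1 (norm_eq_zero.1 h2)

theorem fourierL2_ae_eq {S : L2Mat} (hS : Integrable S volume) :
    fourierL2 S =ᵐ[volume] 𝓕 (fun x => complexify (S x)) := by
  have h := ContinuousLinearMap.coeFn_compLp complexify S
  have h2 : Integrable (complexify.compLp S) volume :=
    (complexify.integrable_comp hS).congr (EventuallyEq.symm h)
  refine (fourier_Lp_ae_eq (complexify.compLp S) h2).trans (Eventually.of_forall fun ξ => ?_)
  exact Real.fourier_congr_ae h ξ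

theorem fourier_complexify_neg (f : R3 → Mat3) (ξ : R3) :
    𝓕 (fun x => complexify (f x)) (-ξ) = conjMat (𝓕 (fun x => complexify (f x)) ξ) := by
  -- An antilipschitz real-linear map commutes with the Bochner integral even when the integral
  -- diverges, so no integrability of `f` is needed.
  have hanti : AntilipschitzWith 1 conjMat := by
    refine AntilipschitzWith.of_le_mul_dist fun M N => ?_
    rw [dist_eq_norm, dist_eq_norm, ← map_sub]
    have h : ∀ z w : ℂ, ‖(starRingEnd ℂ) z - (starRingEnd ℂ) w‖ = ‖z - w‖ := fun z w => by
      rw [← map_sub, RCLike.norm_conj]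
    simp [EuclideanSpace.norm_eq, h]
  rw [Real.fourier_eq, Real.fourier_eq, ← conjMat.integral_comp_comm' hanti]
  refine integral_congr_ae (Eventually.of_forall fun x => ?_)
  ext ij
  simp only [inner_neg_right, neg_neg, conjMat_apply, Circle.smul_def, PiLp.smul_apply,
    smul_eq_mul, map_mul, complexify_apply, Complex.conj_ofReal]
  congr 1
  rw [← Circle.coe_inv_eq_conj, ← AddChar.map_neg_eq_inv, neg_neg]

/-- Reflection `f ↦ f(-·)`. -/
def reflectLp : Lp CMat3 2 (volume : Measure R3) →ₗᵢ[ℂ] Lp CMat3 2 (volume : Measure R3) :=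
  Lp.compMeasurePreservingₗᵢ ℂ (fun x : R3 => -x) (Measure.measurePreserving_neg volume)

theorem coeFn_reflectLp (f : Lp CMat3 2 (volume : Measure R3)) :
    reflectLp f =ᵐ[volume] fun x => f (-x) :=
  Lp.coeFn_compMeasurePreserving f (Measure.measurePreserving_neg volume)

/-- A matrix field with `G(-ξ) = conj G(ξ)`. -/
def IsHermitianField (G : Lp CMat3 2 (volume : Measure R3)) : Prop :=
  reflectLp G = conjMat.compLp G

theorem isHermitianField_iff (G : Lp CMat3 2 (volume : Measure R3)) :
    IsHermitianField G ↔ ∀ᵐ ξ : R3, G (-ξ) = conjMat (G ξ) := by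
  unfold IsHermitianField
  constructor
  · intro h
    filter_upwards [coeFn_reflectLp G, ContinuousLinearMap.coeFn_compLp conjMat G] with ξ h1 h2
    rw [← h1, h, h2]
  · intro h
    ext1
    filter_upwards [coeFn_reflectLp G, ContinuousLinearMap.coeFn_compLp conjMat G, h]
      with ξ h1 h2 h3
    rw [h1, h2, h3]

theorem isHermitianField_fourierL2 (S : L2Mat) : IsHermitianField (fourierL2 S) := by
  unfold IsHermitianField
  have hcl : IsClosed {S : L2Mat | reflectLp (fourierL2 S) = conjMat.compLp (fourierL2 S)} :=
    isClosed_eq (reflectLp.continuous.comp continuous_fourierL2)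
      ((conjMat.compLpL 2 (volume : Measure R3)).continuous.comp continuous_fourierL2)
  refine hcl.closure_subset_iff.2 (?_ : {f : L2Mat | Integrable f volume} ⊆ _)
    (dense_integrable_Lp S)
  intro T hT
  have h := fourierL2_ae_eq hT
  refine (isHermitianField_iff _).2 ?_
  have hneg : Tendsto (fun ξ : R3 => -ξ) (ae volume) (ae volume) :=
    (Measure.measurePreserving_neg (volume : Measure R3)).quasiMeasurePreserving.tendsto_ae
  filter_upwards [h, hneg.eventually h] with ξ h1 h2
  rw [h1, h2, fourier_complexify_neg]

/-- Write the inverse transform as a + ib with a, b real. Both transforms are Hermitian fields, so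
if `G` is Hermitian then i times the transform of b is Hermitian and anti-Hermitian at once, hence
zero. This is what lets even real symbols act on real fields. -/
theorem fourierL2_reMat_fourierInv {G : Lp CMat3 2 (volume : Measure R3)}
    (hG : IsHermitianField G) : fourierL2 (reMat.compLp (𝓕⁻ G)) = G := by
  set f : Lp CMat3 2 (volume : Measure R3) := 𝓕⁻ G with hf
  set a : L2Mat := reMat.compLp f with ha
  set b : L2Mat := imMat.compLp f with hb
  have hfab : f = complexify.compLp a + Complex.I • complexify.compLp b := by
    ext1
    filter_upwards [Lp.coeFn_add (complexify.compLp a) (Complex.I • complexify.compLp b),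
      Lp.coeFn_smul Complex.I (complexify.compLp b), ContinuousLinearMap.coeFn_compLp complexify a,
      ContinuousLinearMap.coeFn_compLp complexify b, ContinuousLinearMap.coeFn_compLp reMat f,
      ContinuousLinearMap.coeFn_compLp imMat f] with x h1 h2 h3 h4 h5 h6
    rw [h1, Pi.add_apply, h2, Pi.smul_apply, h3, h4, h5, h6, complexify_re_add_im]
  have hGab : G = fourierL2 a + Complex.I • fourierL2 b := by
    have : 𝓕 f = G := FourierTransform.fourier_fourierInv_eq G
    rw [← this, hfab]
    unfold fourierL2
    rw [FourierTransform.fourier_add, FourierTransform.fourier_smul]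
  have hneg : Tendsto (fun ξ : R3 => -ξ) (ae volume) (ae volume) :=
    (Measure.measurePreserving_neg (volume : Measure R3)).quasiMeasurePreserving.tendsto_ae
  have hpt : ∀ᵐ ξ, G ξ = fourierL2 a ξ + Complex.I • fourierL2 b ξ := by
    filter_upwards [Lp.coeFn_add (fourierL2 a) (Complex.I • fourierL2 b),
      Lp.coeFn_smul Complex.I (fourierL2 b)] with ξ h1 h2
    rw [hGab, h1, Pi.add_apply, h2, Pi.smul_apply]
  symm
  ext1
  filter_upwards [hpt, hneg.eventually hpt, (isHermitianField_iff _).1 hG,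
    (isHermitianField_iff _).1 (isHermitianField_fourierL2 a),
    (isHermitianField_iff _).1 (isHermitianField_fourierL2 b)] with ξ h1 h2 h3 h4 h5
  rw [h1]
  have h6 : fourierL2 b ξ = 0 := by
    rw [h2, h1, h4, h5, map_add] at h3
    ext ij
    have h7 := congrArg (fun M : CMat3 => M ij) h3
    simp only [PiLp.add_apply, PiLp.smul_apply, smul_eq_mul, conjMat_apply, map_mul,
      Complex.conj_I, add_right_inj, neg_mul] at h7
    have h8 : Complex.I * (starRingEnd ℂ) (fourierL2 b ξ ij) = 0 := by linear_combination h7 / 2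
    simpa using h8
  rw [h6, smul_zero, add_zero]

/-! ### Fourier multipliers on real L² fields and their commutation with `Pst`. -/

open Classical in
/-- Multiplication by a bounded measurable function, on `L²`. -/
def multL2 (m : R3 → ℂ) :
    Lp CMat3 2 (volume : Measure R3) →L[ℂ] Lp CMat3 2 (volume : Measure R3) :=
  if h : MemLp m ∞ (volume : Measure R3) then
    (ContinuousLinearMap.lsmul ℂ ℂ : ℂ →L[ℂ] CMat3 →L[ℂ] CMat3).holderL volume ∞ 2 2 (h.toLp m)
  else 0

theorem memLp_top_of_bounded {m : R3 → ℂ} (hm : Measurable m) {C : ℝ} (hC : ∀ ξ, ‖m ξ‖ ≤ C) :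
    MemLp m ∞ (volume : Measure R3) :=
  memLp_top_of_bound hm.aestronglyMeasurable C (Eventually.of_forall hC)

theorem coeFn_multL2 {m : R3 → ℂ} (hm : Measurable m) {C : ℝ} (hC : ∀ ξ, ‖m ξ‖ ≤ C)
    (f : Lp CMat3 2 (volume : Measure R3)) : multL2 m f =ᵐ[volume] fun ξ => m ξ • f ξ := by
  have h := memLp_top_of_bounded hm hC
  unfold multL2
  rw [dif_pos h]
  filter_upwards [(ContinuousLinearMap.lsmul ℂ ℂ : ℂ →L[ℂ] CMat3 →L[ℂ] CMat3).coeFn_holder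
    (r := 2) (h.toLp m) f, h.coeFn_toLp] with ξ h1 h2
  refine h1.trans ?_
  rw [h2]
  rfl

/-- Real, even, bounded, measurable Fourier multipliers. -/
structure IsSymbol (m : R3 → ℝ) : Prop where
  measurable : Measurable m
  even : ∀ ξ, m (-ξ) = m ξ
  bounded : ∃ C, ∀ ξ, |m ξ| ≤ C

/-- The Fourier multiplier operator with symbol `m`. -/
def multiplier (m : R3 → ℝ) : L2Mat →L[ℝ] L2Mat :=
  (reMat.compLpL 2 (volume : Measure R3)).comp
    ((((Lp.fourierTransformₗᵢ R3 CMat3).symm.toContinuousLinearEquiv :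
      Lp CMat3 2 (volume : Measure R3) →L[ℂ] Lp CMat3 2 (volume : Measure R3)).comp
      (multL2 fun ξ => (m ξ : ℂ))).restrictScalars ℝ |>.comp fourierL2L)

theorem fourierL2_multiplier {m : R3 → ℝ} (hm : IsSymbol m) (S : L2Mat) :
    fourierL2 (multiplier m S) =ᵐ[volume] fun ξ => (m ξ : ℂ) • fourierL2 S ξ := by
  obtain ⟨C, hC⟩ := hm.bounded
  have hmul := coeFn_multL2 (m := fun ξ => (m ξ : ℂ)) (Complex.measurable_ofReal.comp hm.measurable)
    (C := C) (fun ξ => by simpa using hC ξ) (fourierL2 S)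
  have hH : IsHermitianField (multL2 (fun ξ => (m ξ : ℂ)) (fourierL2 S)) := by
    rw [isHermitianField_iff]
    have hneg : Tendsto (fun ξ : R3 => -ξ) (ae volume) (ae volume) :=
      (Measure.measurePreserving_neg (volume : Measure R3)).quasiMeasurePreserving.tendsto_ae
    filter_upwards [hmul, hneg.eventually hmul,
      (isHermitianField_iff _).1 (isHermitianField_fourierL2 S)] with ξ h1 h2 h3
    rw [h1, h2, h3, hm.even]
    ext ij
    simp
  have h : fourierL2 (multiplier m S) = multL2 (fun ξ => (m ξ : ℂ)) (fourierL2 S) :=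
    fourierL2_reMat_fourierInv hH
  rw [h]
  exact hmul

theorem multiplier_comp {m n : R3 → ℝ} (hm : IsSymbol m) (hn : IsSymbol n)
    (hmn : IsSymbol fun ξ => m ξ * n ξ) (S : L2Mat) :
    multiplier m (multiplier n S) = multiplier (fun ξ => m ξ * n ξ) S := by
  apply fourierL2_injective
  ext1
  filter_upwards [fourierL2_multiplier hm (multiplier n S), fourierL2_multiplier hn S,
    fourierL2_multiplier hmn S] with ξ h1 h2 h3
  rw [h1, h2, h3, smul_smul, Complex.ofReal_mul]

theorem multiplier_one (S : L2Mat) : multiplier (fun _ => 1) S = S := by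
  apply fourierL2_injective
  ext1
  filter_upwards [fourierL2_multiplier (m := fun _ => 1)
    ⟨measurable_const, fun _ => rfl, 1, fun _ => by simp⟩ S] with ξ h1
  rw [h1]
  simp

theorem enorm_sq_eq_lintegral {E : Type*} [NormedAddCommGroup E]
    (f : Lp E 2 (volume : Measure R3)) : ‖f‖ₑ ^ 2 = ∫⁻ ξ, ‖f ξ‖ₑ ^ 2 := by
  rw [Lp.enorm_def, eLpNorm_eq_lintegral_rpow_enorm_toReal (by norm_num) (by norm_num)]
  rw [← ENNReal.rpow_natCast, ← ENNReal.rpow_mul]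
  norm_num

theorem enorm_sq_fourierL2 (S : L2Mat) : ‖S‖ₑ ^ 2 = ∫⁻ ξ, ‖fourierL2 S ξ‖ₑ ^ 2 := by
  rw [← enorm_sq_eq_lintegral, ← ofReal_norm, ← ofReal_norm, norm_fourierL2]

theorem enorm_multiplier_sq {m : R3 → ℝ} (hm : IsSymbol m) (S : L2Mat) :
    ‖multiplier m S‖ₑ ^ 2 = ∫⁻ ξ, (‖m ξ‖ₑ * ‖fourierL2 S ξ‖ₑ) ^ 2 := by
  rw [enorm_sq_fourierL2]
  refine lintegral_congr_ae ?_
  filter_upwards [fourierL2_multiplier hm S] with ξ h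
  rw [h, enorm_smul]
  congr 2
  rw [← ofReal_norm, ← ofReal_norm, Complex.norm_real]

theorem norm_multiplier_le {m : R3 → ℝ} (hm : IsSymbol m) {C : ℝ}
    (hC : ∀ ξ, |m ξ| ≤ C) (S : L2Mat) : ‖multiplier m S‖ ≤ C * ‖S‖ := by
  rw [← norm_fourierL2, ← norm_fourierL2 S]
  refine Lp.norm_le_mul_norm_of_ae_le_mul ?_
  filter_upwards [fourierL2_multiplier hm S] with ξ h
  rw [h, norm_smul, Complex.norm_real]
  exact mul_le_mul_of_nonneg_right (hC ξ) (norm_nonneg _)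

theorem inner_fourierL2 (S T : L2Mat) :
    inner ℝ S T = (inner ℂ (fourierL2 S) (fourierL2 T)).re := by
  unfold fourierL2
  rw [Lp.inner_fourier_eq, L2.inner_def, L2.inner_def]
  have h : ∀ᵐ x, inner ℂ (complexify.compLp S x) (complexify.compLp T x)
      = ((inner ℝ (S x) (T x) : ℝ) : ℂ) := by
    filter_upwards [ContinuousLinearMap.coeFn_compLp complexify S,
      ContinuousLinearMap.coeFn_compLp complexify T] with x h1 h2
    rw [h1, h2, inner_complexify]
  rw [integral_congr_ae h]
  exact (congrArg Complex.re (integral_ofReal (𝕜 := ℂ) (μ := (volume : Measure R3))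
    (f := fun x => inner ℝ (S x) (T x)))).symm

theorem inner_multiplier {m : R3 → ℝ} (hm : IsSymbol m) (S T : L2Mat) :
    inner ℝ (multiplier m S) T = inner ℝ S (multiplier m T) := by
  rw [inner_fourierL2, inner_fourierL2, L2.inner_def, L2.inner_def]
  congr 1
  refine integral_congr_ae ?_
  filter_upwards [fourierL2_multiplier hm S, fourierL2_multiplier hm T] with ξ h1 h2
  rw [h1, h2, inner_smul_left, inner_smul_right, Complex.conj_ofReal]

/-- The equations in `StrainSymbol` are linear at each frequency, and an even real symbol preserves
the reality condition. -/
theorem multiplier_mem_L2st {m : R3 → ℝ} (hm : IsSymbol m) {S : L2Mat} (hS : S ∈ L2st) :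
    multiplier m S ∈ L2st := by
  rw [mem_L2st_iff] at hS ⊢
  have hneg : Tendsto (fun ξ : R3 => -ξ) (ae volume) (ae volume) :=
    (Measure.measurePreserving_neg (volume : Measure R3)).quasiMeasurePreserving.tendsto_ae
  have h := fourierL2_multiplier hm S
  filter_upwards [hS, h, hneg.eventually h] with ξ h1 h2 h3
  obtain ⟨a, b, c⟩ := h1
  have e : ∀ j, ∑ k, fourierL2 (multiplier m S) ξ (j, k) * (ξ k : ℂ)
      = (m ξ : ℂ) * ∑ k, fourierL2 S ξ (j, k) * (ξ k : ℂ) := by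
    intro j
    rw [Finset.mul_sum]
    refine Finset.sum_congr rfl fun k _ => ?_
    rw [h2]
    simp [mul_assoc]
  refine ⟨fun i j => ?_, ?_, fun i j => ?_⟩
  · rw [h2, h3, hm.even]
    simp [a]
  · simp only [e]
    have e2 : ∑ j, (ξ j : ℂ) * ((m ξ : ℂ) * ∑ k, fourierL2 S ξ (j, k) * (ξ k : ℂ))
      = (m ξ : ℂ) * ∑ j, (ξ j : ℂ) * ∑ k, fourierL2 S ξ (j, k) * (ξ k : ℂ) := by
      rw [Finset.mul_sum]
      exact Finset.sum_congr rfl fun j _ => by ring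
    rw [e2, b, mul_zero]
  · simp only [e]
    rw [h2]
    have := c i j
    simp only [PiLp.smul_apply, smul_eq_mul]
    linear_combination (m ξ : ℂ) * this

theorem Pst_mem (S : L2Mat) : Pst S ∈ L2st := L2st.starProjection_apply_mem S

theorem Pst_eq_self {S : L2Mat} (hS : S ∈ L2st) : Pst S = S :=
  Submodule.starProjection_eq_self_iff.2 hS

theorem norm_Pst_le (S : L2Mat) : ‖Pst S‖ ≤ ‖S‖ := L2st.norm_starProjection_apply_le S

theorem inner_Pst (S T : L2Mat) : inner ℝ (Pst S) T = inner ℝ S (Pst T) :=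
  L2st.inner_starProjection_left_eq_right S T

/-- A self-adjoint operator that preserves a closed subspace also preserves its orthogonal
complement, and so commutes with the projection. -/
theorem multiplier_Pst {m : R3 → ℝ} (hm : IsSymbol m) (S : L2Mat) :
    multiplier m (Pst S) = Pst (multiplier m S) := by
  symm
  refine Submodule.eq_starProjection_of_mem_of_inner_eq_zero
    (multiplier_mem_L2st hm (Pst_mem S)) fun T hT => ?_
  rw [← map_sub, inner_multiplier hm]
  have := L2st.starProjection_inner_eq_zero S (multiplier m T) (multiplier_mem_L2st hm hT)
  exact this

/-! ### The heat flow as a Fourier multiplier. -/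

/-- The symbol `exp(-4π²t|ξ|²)` of `e^{tΔ}`. -/
def gaussSymbol (t : ℝ) (ξ : R3) : ℝ := Real.exp (-(4 * Real.pi ^ 2 * t * ‖ξ‖ ^ 2))

theorem gaussSymbol_pos (t : ℝ) (ξ : R3) : 0 < gaussSymbol t ξ := Real.exp_pos _

theorem gaussSymbol_le_one {t : ℝ} (ht : 0 ≤ t) (ξ : R3) : gaussSymbol t ξ ≤ 1 := by
  unfold gaussSymbol
  rw [Real.exp_le_one_iff]
  have : 0 ≤ 4 * Real.pi ^ 2 * t * ‖ξ‖ ^ 2 := by positivity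
  linarith

theorem abs_gaussSymbol_le_one {t : ℝ} (ht : 0 ≤ t) (ξ : R3) : |gaussSymbol t ξ| ≤ 1 := by
  rw [abs_of_pos (gaussSymbol_pos t ξ)]
  exact gaussSymbol_le_one ht ξ

theorem gaussSymbol_add (s t : ℝ) (ξ : R3) :
    gaussSymbol (s + t) ξ = gaussSymbol s ξ * gaussSymbol t ξ := by
  unfold gaussSymbol
  rw [← Real.exp_add]
  congr 1
  ring

theorem gaussSymbol_zero (ξ : R3) : gaussSymbol 0 ξ = 1 := by simp [gaussSymbol]

theorem continuous_gaussSymbol (t : ℝ) : Continuous (gaussSymbol t) := by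
  unfold gaussSymbol
  fun_prop

theorem isSymbol_gaussSymbol {t : ℝ} (ht : 0 ≤ t) : IsSymbol (gaussSymbol t) :=
  ⟨(continuous_gaussSymbol t).measurable, fun ξ => by simp [gaussSymbol],
    1, abs_gaussSymbol_le_one ht⟩

theorem fourier_heatKernel {t : ℝ} (ht : 0 < t) (ξ : R3) :
    𝓕 (fun x : R3 => (heatKernel t x : ℂ)) ξ = gaussSymbol t ξ := by
  have hb : 0 < ((1 / (4 * t) : ℝ) : ℂ).re := by
    rw [Complex.ofReal_re]
    positivity
  have h := fourier_gaussian_innerProductSpace (V := R3) hb ξ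
  have hpos : 0 < 4 * Real.pi * t := by positivity
  have e1 : (fun x : R3 => (heatKernel t x : ℂ)) =
      fun x => ((1 / (4 * Real.pi * t) ^ (3 / 2 : ℝ) : ℝ) : ℂ) •
        Complex.exp (-((1 / (4 * t) : ℝ) : ℂ) * (‖x‖ : ℂ) ^ 2) := by
    ext x
    unfold heatKernel
    rw [smul_eq_mul, Complex.ofReal_mul, Complex.ofReal_exp]
    congr 2
    push_cast
    ring
  have e2 : 𝓕 (fun x : R3 => (heatKernel t x : ℂ)) ξ =
      ((1 / (4 * Real.pi * t) ^ (3 / 2 : ℝ) : ℝ) : ℂ) •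
        𝓕 (fun x : R3 => Complex.exp (-((1 / (4 * t) : ℝ) : ℂ) * (‖x‖ : ℂ) ^ 2)) ξ := by
    rw [e1, Real.fourier_eq, Real.fourier_eq, ← integral_smul]
    refine integral_congr_ae (Eventually.of_forall fun x => ?_)
    simp only [Circle.smul_def, smul_eq_mul]
    ring
  rw [e2, h]
  have e3 : ((Real.pi : ℂ) / ((1 / (4 * t) : ℝ) : ℂ)) ^ ((Module.finrank ℝ R3 : ℂ) / 2)
      = (((4 * Real.pi * t) ^ (3 / 2 : ℝ) : ℝ) : ℂ) := by
    rw [Complex.ofReal_cpow hpos.le]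
    congr 1
    · push_cast
      field_simp
    · simp
  have e4 : Complex.exp (-(Real.pi : ℂ) ^ 2 * (‖ξ‖ : ℂ) ^ 2 / ((1 / (4 * t) : ℝ) : ℂ))
      = (gaussSymbol t ξ : ℂ) := by
    unfold gaussSymbol
    rw [Complex.ofReal_exp]
    congr 1
    push_cast
    field_simp
  rw [e3, e4, smul_eq_mul, ← mul_assoc, ← Complex.ofReal_mul,
    one_div_mul_cancel (Real.rpow_pos_of_pos hpos _).ne', Complex.ofReal_one, one_mul]

theorem complexify_antilipschitz : AntilipschitzWith 1 complexify := by
  refine AntilipschitzWith.of_le_mul_dist fun M N => ?_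
  rw [dist_eq_norm, dist_eq_norm, ← map_sub, norm_complexify]
  simp

theorem complexify_heatConv (t : ℝ) (f : R3 → Mat3) (x : R3) :
    complexify (heatConv t f x) = convolution (fun x => (heatKernel t x : ℂ))
      (fun x => complexify (f x)) (ContinuousLinearMap.lsmul ℂ ℂ) volume x := by
  unfold heatConv convolution
  rw [← complexify.integral_comp_comm' complexify_antilipschitz]
  refine integral_congr_ae (Eventually.of_forall fun y => ?_)
  simp only [ContinuousLinearMap.lsmul_apply, complexify_smul]

theorem integrable_heatConv {t : ℝ} (ht : 0 < t) {f : R3 → Mat3} (hf : Integrable f volume) :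
    Integrable (heatConv t f) volume :=
  (integrable_heatKernel ht).integrable_convolution _ hf

theorem fourier_heatConv {t : ℝ} (ht : 0 < t) {f : R3 → Mat3} (hf : Integrable f volume) (ξ : R3) :
    𝓕 (fun x => complexify (heatConv t f x)) ξ
      = (gaussSymbol t ξ : ℂ) • 𝓕 (fun x => complexify (f x)) ξ := by
  have h := Real.fourier_smul_convolution_eq (f₁ := fun x : R3 => (heatKernel t x : ℂ))
    (f₂ := fun x => complexify (f x)) (integrable_heatKernel ht).ofReal
    (complexify.integrable_comp hf) ξ
  rw [fourier_heatKernel ht] at h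
  rw [← h]
  exact congrArg (fun g : R3 → CMat3 => 𝓕 g ξ) (funext fun x => complexify_heatConv t f x)

theorem heat_eq_toLp {t : ℝ} (ht : 0 < t) {f : R3 → Mat3}
    (hf : MemLp f 1 volume ∨ MemLp f 2 volume) :
    heat t f = (memLp_heatConv ht hf).toLp (heatConv t f) := by
  unfold heat
  rw [dif_pos]

theorem coeFn_heat {t : ℝ} (ht : 0 < t) {f : R3 → Mat3}
    (hf : MemLp f 1 volume ∨ MemLp f 2 volume) : heat t f =ᵐ[volume] heatConv t f := by
  rw [heat_eq_toLp ht hf]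
  exact MemLp.coeFn_toLp _

open Classical in
theorem heat_congr {t : ℝ} {f g : R3 → Mat3} (h : f =ᵐ[volume] g) : heat t f = heat t g := by
  have : heatConv t f = heatConv t g := convolution_congr _ (EventuallyEq.refl _ _) h
  exact congrArg (fun g : R3 → Mat3 => if h : MemLp g 2 volume then h.toLp g else 0) this

theorem fourierL2_heat {t : ℝ} (ht : 0 < t) {f : R3 → Mat3} (hf : Integrable f volume) :
    fourierL2 (heat t f) =ᵐ[volume]
      fun ξ => (gaussSymbol t ξ : ℂ) • 𝓕 (fun x => complexify (f x)) ξ := by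
  have h1 := coeFn_heat ht (Or.inl (memLp_one_iff_integrable.2 hf))
  refine (fourierL2_ae_eq ((integrable_heatConv ht hf).congr (EventuallyEq.symm h1))).trans ?_
  refine Eventually.of_forall fun ξ => ?_
  dsimp only
  rw [← fourier_heatConv ht hf]
  refine Real.fourier_congr_ae ?_ ξ
  filter_upwards [h1] with x hx
  rw [hx]

theorem heat_eq_multiplier_of_integrable {t : ℝ} (ht : 0 < t) {S : L2Mat}
    (hS : Integrable S volume) : heat t S = multiplier (gaussSymbol t) S := by
  apply fourierL2_injective
  ext1
  filter_upwards [fourierL2_heat ht hS, fourierL2_multiplier (isSymbol_gaussSymbol ht.le) S,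
    fourierL2_ae_eq hS] with ξ h1 h2 h3
  rw [h1, h2, h3]

theorem memLp_two_heatKernel {t : ℝ} (ht : 0 < t) : MemLp (heatKernel t) 2 volume :=
  (memLp_two_iff_integrable_sq (continuous_heatKernel t).aestronglyMeasurable).2
    (integrable_heatKernel_sq ht)

theorem memLp_comp_sub_left {f : R3 → Mat3} (hf : MemLp f 2 volume) (x : R3) :
    MemLp (fun y => f (x - y)) 2 volume :=
  hf.comp_measurePreserving (measurePreserving_sub_left' x)

/-- The kernel is itself in L², so by Cauchy–Schwarz the convolution at each fixed point is
continuous in the L² field. -/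
theorem tendsto_heatConv {t : ℝ} (ht : 0 < t) {S : ℕ → L2Mat} {S₀ : L2Mat}
    (h : Tendsto S atTop (𝓝 S₀)) (x : R3) :
    Tendsto (fun n => heatConv t (S n) x) atTop (𝓝 (heatConv t S₀ x)) := by
  have hint : ∀ T : L2Mat, Integrable (fun y => heatKernel t y • T (x - y)) volume := fun T =>
    memLp_one_iff_integrable.1
      ((memLp_comp_sub_left (Lp.memLp T) x).smul (r := 1) (memLp_two_heatKernel ht))
  have hn : ∀ T : L2Mat, eLpNorm (fun y => T (x - y)) 2 volume = ‖T‖ₑ := fun T => by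
    rw [Lp.enorm_def]
    exact eLpNorm_comp_measurePreserving (Lp.aestronglyMeasurable T)
      (measurePreserving_sub_left' x)
  rw [tendsto_iff_edist_tendsto_0]
  have hbound : ∀ n, edist (heatConv t (S n) x) (heatConv t S₀ x)
      ≤ eLpNorm (heatKernel t) 2 volume * ‖S n - S₀‖ₑ := by
    intro n
    rw [edist_eq_enorm_sub]
    have e : heatConv t (S n) x - heatConv t S₀ x
        = ∫ y, heatKernel t y • (S n - S₀ : L2Mat) (x - y) := by
      unfold heatConv convolution
      simp only [ContinuousLinearMap.lsmul_apply]
      rw [← integral_sub (hint _) (hint _)]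
      refine integral_congr_ae ?_
      filter_upwards [(measurePreserving_sub_left' x).quasiMeasurePreserving.ae
        (Lp.coeFn_sub (S n) S₀)] with y hy
      rw [hy, Pi.sub_apply, smul_sub]
    rw [e]
    refine (enorm_integral_le_lintegral_enorm _).trans ?_
    have h3 := eLpNorm_smul_le_mul_eLpNorm (p := 2) (q := 2) (r := 1)
      (f := fun y => (S n - S₀ : L2Mat) (x - y)) (μ := (volume : Measure R3))
      (memLp_comp_sub_left (Lp.memLp (S n - S₀)) x).1 (memLp_two_heatKernel ht).1
    rw [hn, eLpNorm_one_eq_lintegral_enorm] at h3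
    exact h3
  have h0 : Tendsto (fun n => eLpNorm (heatKernel t) 2 volume * ‖S n - S₀‖ₑ) atTop (𝓝 0) := by
    have h1 : Tendsto (fun n => ‖S n - S₀‖ₑ) atTop (𝓝 0) := by
      have := (tendsto_iff_edist_tendsto_0.1 h)
      simpa [edist_eq_enorm_sub] using this
    have := ENNReal.Tendsto.const_mul (a := eLpNorm (heatKernel t) 2 volume) h1
      (Or.inr (memLp_two_heatKernel ht).2.ne)
    simpa using this
  exact tendsto_of_tendsto_of_tendsto_of_le_of_le tendsto_const_nhds h0 (fun _ => zero_le)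
    hbound

theorem heat_eq_multiplier {t : ℝ} (ht : 0 < t) (S : L2Mat) :
    heat t S = multiplier (gaussSymbol t) S := by
  obtain ⟨T, hT, hlim⟩ := mem_closure_iff_seq_limit.1 (dense_integrable_Lp S)
  have h1 : Tendsto (fun n => multiplier (gaussSymbol t) (T n)) atTop
      (𝓝 (multiplier (gaussSymbol t) S)) := ((multiplier (gaussSymbol t)).continuous.tendsto S).comp hlim
  -- The multiplier side converges only in L², hence a.e. along a subsequence; the convolution side
  -- converges at every point, so the limits can be compared pointwise.
  obtain ⟨ns, hns, hae⟩ := (tendstoInMeasure_of_tendsto_Lp h1).exists_seq_tendsto_ae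
  have h2 : ∀ᵐ x, ∀ n, multiplier (gaussSymbol t) (T n) x = heatConv t (T n) x := by
    refine ae_all_iff.2 fun n => ?_
    rw [← heat_eq_multiplier_of_integrable ht (hT n)]
    exact coeFn_heat ht (Or.inr (Lp.memLp _))
  ext1
  filter_upwards [coeFn_heat ht (Or.inr (Lp.memLp S)), hae, h2] with x h3 h4 h5
  rw [h3]
  refine tendsto_nhds_unique ?_ h4
  simp only [h5]
  exact (tendsto_heatConv ht hlim x).comp hns.tendsto_atTop

/-- The heat semigroup on `L²`. -/
def heatL2 (t : ℝ) : L2Mat →L[ℝ] L2Mat := multiplier (gaussSymbol t)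

theorem heatL2_zero (S : L2Mat) : heatL2 0 S = S := by
  unfold heatL2
  simp only [show gaussSymbol 0 = fun _ => 1 from funext gaussSymbol_zero]
  exact multiplier_one S

theorem norm_heatL2_le {t : ℝ} (ht : 0 ≤ t) (S : L2Mat) : ‖heatL2 t S‖ ≤ ‖S‖ := by
  unfold heatL2
  simpa using norm_multiplier_le (isSymbol_gaussSymbol ht) (abs_gaussSymbol_le_one ht) S

theorem heatL2_add {s t : ℝ} (hs : 0 ≤ s) (ht : 0 ≤ t) (S : L2Mat) :
    heatL2 (s + t) S = heatL2 s (heatL2 t S) := by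
  have e : gaussSymbol (s + t) = fun ξ => gaussSymbol s ξ * gaussSymbol t ξ :=
    funext (gaussSymbol_add s t)
  have h := isSymbol_gaussSymbol (add_nonneg hs ht)
  rw [e] at h
  unfold heatL2
  rw [multiplier_comp (isSymbol_gaussSymbol hs) (isSymbol_gaussSymbol ht) h, e]

theorem heatL2_Pst {t : ℝ} (ht : 0 ≤ t) (S : L2Mat) : heatL2 t (Pst S) = Pst (heatL2 t S) :=
  multiplier_Pst (isSymbol_gaussSymbol ht) S

theorem heatL2_mem_L2st {t : ℝ} (ht : 0 ≤ t) {S : L2Mat} (hS : S ∈ L2st) : heatL2 t S ∈ L2st :=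
  multiplier_mem_L2st (isSymbol_gaussSymbol ht) hS

theorem enorm_heatL2_sub_sq {s t : ℝ} (hs : 0 ≤ s) (ht : 0 ≤ t) (S : L2Mat) :
    ‖heatL2 s S - heatL2 t S‖ₑ ^ 2
      = ∫⁻ ξ, (‖gaussSymbol s ξ - gaussSymbol t ξ‖ₑ * ‖fourierL2 S ξ‖ₑ) ^ 2 := by
  rw [enorm_sq_fourierL2]
  refine lintegral_congr_ae ?_
  have e : fourierL2 (heatL2 s S - heatL2 t S) = fourierL2 (heatL2 s S) - fourierL2 (heatL2 t S) :=
    map_sub fourierL2L _ _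
  rw [e]
  filter_upwards [Lp.coeFn_sub (fourierL2 (heatL2 s S)) (fourierL2 (heatL2 t S)),
    fourierL2_multiplier (isSymbol_gaussSymbol hs) S,
    fourierL2_multiplier (isSymbol_gaussSymbol ht) S] with ξ h1 h2 h3
  rw [h1, Pi.sub_apply]
  unfold heatL2
  rw [h2, h3, ← sub_smul, enorm_smul, ← Complex.ofReal_sub]
  congr 2
  rw [← ofReal_norm, ← ofReal_norm, Complex.norm_real]

theorem continuousOn_heatL2 (S : L2Mat) : ContinuousOn (fun t => heatL2 t S) (Set.Ici 0) := by
  intro t₀ ht₀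
  rw [ContinuousWithinAt, tendsto_iff_edist_tendsto_0]
  have hsq : Tendsto (fun t => ‖heatL2 t S - heatL2 t₀ S‖ₑ ^ 2) (𝓝[Set.Ici 0] t₀) (𝓝 0) := by
    have h1 : Tendsto (fun t => ∫⁻ ξ, (‖gaussSymbol t ξ - gaussSymbol t₀ ξ‖ₑ
        * ‖fourierL2 S ξ‖ₑ) ^ 2) (𝓝[Set.Ici 0] t₀) (𝓝 (∫⁻ _ : R3, 0)) := by
      refine tendsto_lintegral_filter_of_dominated_convergence
        (fun ξ => (2 * ‖fourierL2 S ξ‖ₑ) ^ 2) ?_ ?_ ?_ ?_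
      · filter_upwards [self_mem_nhdsWithin] with t ht
        have h2 : Measurable fun ξ => ‖gaussSymbol t ξ - gaussSymbol t₀ ξ‖ₑ :=
          ((continuous_gaussSymbol t).sub (continuous_gaussSymbol t₀)).measurable.enorm
        have h3 : Measurable fun ξ => ‖fourierL2 S ξ‖ₑ :=
          (Lp.stronglyMeasurable (fourierL2 S)).measurable.enorm
        exact (h2.mul h3).pow_const 2
      · filter_upwards [self_mem_nhdsWithin] with t ht
        refine Eventually.of_forall fun ξ => ?_
        gcongr
        refine (enorm_sub_le).trans ?_
        have h4 : ∀ s : ℝ, 0 ≤ s → ‖gaussSymbol s ξ‖ₑ ≤ 1 := fun s hs => by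
          rw [← ofReal_norm, Real.norm_eq_abs]
          exact ENNReal.ofReal_le_one.2 (abs_gaussSymbol_le_one hs ξ)
        calc _ ≤ (1 : ℝ≥0∞) + 1 := add_le_add (h4 t ht) (h4 t₀ ht₀)
          _ = 2 := one_add_one_eq_two
      · simp only [mul_pow]
        rw [lintegral_const_mul' _ _ (by simp), ← enorm_sq_fourierL2]
        exact ENNReal.mul_ne_top (by simp) (by simp)
      · refine Eventually.of_forall fun ξ => ?_
        have h5 : Tendsto (fun t => ‖gaussSymbol t ξ - gaussSymbol t₀ ξ‖ₑ) (𝓝[Set.Ici 0] t₀)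
            (𝓝 0) := by
          have hc : Continuous fun t => ‖gaussSymbol t ξ - gaussSymbol t₀ ξ‖ₑ := by
            unfold gaussSymbol
            fun_prop
          have := (hc.tendsto t₀).mono_left (nhdsWithin_le_nhds (s := Set.Ici 0))
          simpa using this
        have h6 := ENNReal.Tendsto.mul_const (b := ‖fourierL2 S ξ‖ₑ) h5 (Or.inr (by simp))
        have h7 := ENNReal.Tendsto.pow (n := 2) h6
        simpa using h7
    rw [lintegral_zero] at h1
    refine h1.congr' ?_
    filter_upwards [self_mem_nhdsWithin] with t ht
    rw [enorm_heatL2_sub_sq ht ht₀]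
  have hsqrt := (ENNReal.continuous_rpow_const (y := 1 / 2)).continuousAt.tendsto.comp hsq
  have e : ∀ z : ℝ≥0∞, (z ^ 2) ^ (2⁻¹ : ℝ) = z := fun z => by
    rw [← ENNReal.rpow_natCast, ← ENNReal.rpow_mul]
    norm_num
  simpa [Function.comp_def, e, edist_eq_enorm_sub] using hsqrt

theorem tendsto_heatL2 {ι : Type*} {l : Filter ι} {t : ι → ℝ} {t₀ : ℝ} {X : ι → L2Mat} {X₀ : L2Mat}
    (ht₀ : 0 ≤ t₀) (hpos : ∀ᶠ i in l, 0 ≤ t i) (ht : Tendsto t l (𝓝 t₀))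
    (hX : Tendsto X l (𝓝 X₀)) : Tendsto (fun i => heatL2 (t i) (X i)) l (𝓝 (heatL2 t₀ X₀)) := by
  have h1 : Tendsto (fun i => heatL2 (t i) X₀) l (𝓝 (heatL2 t₀ X₀)) :=
    ((continuousOn_heatL2 X₀) t₀ ht₀).tendsto.comp
      (tendsto_nhdsWithin_iff.2 ⟨ht, hpos⟩)
  have h2 : Tendsto (fun i => heatL2 (t i) (X i) - heatL2 (t i) X₀) l (𝓝 0) := by
    have h3 : Tendsto (fun i => ‖X i - X₀‖) l (𝓝 0) := tendsto_iff_norm_sub_tendsto_zero.1 hX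
    refine squeeze_zero_norm' ?_ h3
    filter_upwards [hpos] with i hi
    rw [← map_sub]
    exact norm_heatL2_le hi _
  simpa using h2.add h1

theorem heat_sub {t : ℝ} (ht : 0 < t) {f g : R3 → Mat3} (hf : Integrable f volume)
    (hg : Integrable g volume) : heat t f - heat t g = heat t (fun x => f x - g x) := by
  apply fourierL2_injective
  have e : fourierL2 (heat t f - heat t g) = fourierL2 (heat t f) - fourierL2 (heat t g) :=
    map_sub fourierL2L _ _
  rw [e]
  ext1
  filter_upwards [Lp.coeFn_sub (fourierL2 (heat t f)) (fourierL2 (heat t g)), fourierL2_heat ht hf,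
    fourierL2_heat ht hg, fourierL2_heat ht (hf.sub hg)] with ξ h1 h2 h3 h4
  have h5 : 𝓕 (fun x => complexify ((f - g) x)) ξ
      = 𝓕 (fun x => complexify (f x)) ξ - 𝓕 (fun x => complexify (g x)) ξ := by
    rw [Real.fourier_eq, Real.fourier_eq, Real.fourier_eq, ← integral_sub]
    · refine integral_congr_ae (Eventually.of_forall fun x => ?_)
      simp only [Pi.sub_apply, map_sub, smul_sub]
    · exact (Real.fourierIntegral_convergent_iff ξ).2 (complexify.integrable_comp hf)
    · exact (Real.fourierIntegral_convergent_iff ξ).2 (complexify.integrable_comp hg)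
  rw [h1, Pi.sub_apply, h2, h3]
  refine Eq.trans ?_ h4.symm
  rw [h5, smul_sub]

theorem heatL2_heat {s t : ℝ} (hs : 0 ≤ s) (ht : 0 < t) {f : R3 → Mat3}
    (hf : Integrable f volume) : heatL2 s (heat t f) = heat (s + t) f := by
  apply fourierL2_injective
  ext1
  unfold heatL2
  filter_upwards [fourierL2_multiplier (isSymbol_gaussSymbol hs) (heat t f), fourierL2_heat ht hf,
    fourierL2_heat (show 0 < s + t by linarith) hf] with ξ h1 h2 h3
  rw [h1, h2, h3, smul_smul, gaussSymbol_add, Complex.ofReal_mul]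

/-! ### Smoothing estimates from L¹ to L². -/

/-- `∫ (1+|ξ|)^{-31/10} dξ`, the constant in the smoothing estimates. -/
def weightConst : ℝ := ∫ ξ : R3, (1 + ‖ξ‖) ^ (-(31 / 10) : ℝ)

theorem integrable_weight : Integrable fun ξ : R3 => (1 + ‖ξ‖) ^ (-(31 / 10) : ℝ) := by
  apply integrable_one_add_norm
  simp
  norm_num

theorem weightConst_nonneg : 0 ≤ weightConst :=
  integral_nonneg fun ξ => by positivity

/-- With x = τ|ξ|² the Gaussian is at most 1/(1+x), while τ(1+|ξ|)² ≤ 2(1+x) because τ ≤ 1. The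
power 9/5 of the latter trades a factor τ^{-9/5} for the decay (1+|ξ|)^{-18/5}. Half a power pays
for the squared weight, and the remaining exponent 31/10 exceeds 3, so it is integrable. The square
root τ^{-9/10} is integrable at 0. -/
theorem gaussSymbol_weight_bound {τ : ℝ} (h0 : 0 < τ) (h1 : τ ≤ 1) (ξ : R3) :
    ((1 + ‖ξ‖) ^ (1 / 4 : ℝ) * gaussSymbol τ ξ) ^ 2
      ≤ 4 * τ ^ (-(9 / 5) : ℝ) * (1 + ‖ξ‖) ^ (-(31 / 10) : ℝ) := by
  set r := ‖ξ‖ with hr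
  have hr0 : 0 ≤ r := norm_nonneg _
  set x := τ * r ^ 2 with hx
  have hx0 : 0 ≤ x := by positivity
  have hg : gaussSymbol τ ξ ^ 2 * (1 + x) ^ 2 ≤ 1 := by
    have h2 : gaussSymbol τ ξ * (1 + x) ≤ 1 := by
      have h3 : 1 + x ≤ Real.exp x := by linarith [Real.add_one_le_exp x]
      have h4 : gaussSymbol τ ξ ≤ Real.exp (-x) := by
        unfold gaussSymbol
        apply Real.exp_le_exp.2
        have hpi : 1 ≤ 4 * Real.pi ^ 2 := by nlinarith [Real.pi_gt_three]
        have : 4 * Real.pi ^ 2 * τ * ‖ξ‖ ^ 2 = 4 * Real.pi ^ 2 * x := by rw [hx, ← hr]; ring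
        rw [this]
        nlinarith
      calc gaussSymbol τ ξ * (1 + x) ≤ Real.exp (-x) * Real.exp x := by gcongr
        _ = 1 := by rw [← Real.exp_add]; simp
    rw [← mul_pow]
    exact pow_le_one₀ (mul_nonneg (gaussSymbol_pos _ _).le (by positivity)) h2
  have hy : τ * (1 + r) ^ 2 ≤ 2 * (1 + x) := by
    rw [hx]
    nlinarith [mul_nonneg h0.le (sq_nonneg (1 - r))]
  have hy2 : (τ * (1 + r) ^ 2) ^ (9 / 5 : ℝ) ≤ 4 * (1 + x) ^ 2 := by
    calc (τ * (1 + r) ^ 2) ^ (9 / 5 : ℝ) ≤ (2 * (1 + x)) ^ (9 / 5 : ℝ) := by gcongr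
      _ ≤ (2 * (1 + x)) ^ (2 : ℝ) :=
        Real.rpow_le_rpow_of_exponent_le (by linarith) (by norm_num)
      _ = 4 * (1 + x) ^ 2 := by rw [Real.rpow_two]; ring
  have e1 : (τ * (1 + r) ^ 2) ^ (9 / 5 : ℝ) = τ ^ (9 / 5 : ℝ) * (1 + r) ^ (18 / 5 : ℝ) := by
    rw [Real.mul_rpow h0.le (by positivity), ← Real.rpow_natCast (1 + r) 2,
      ← Real.rpow_mul (by positivity)]
    norm_num
  have e2 : (1 + r) ^ (-(31 / 10) : ℝ) * (1 + r) ^ (18 / 5 : ℝ) = ((1 + r) ^ (1 / 4 : ℝ)) ^ 2 := by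
    rw [← Real.rpow_natCast _ 2, ← Real.rpow_mul (by positivity), ← Real.rpow_add (by positivity)]
    norm_num
  have e3 : τ ^ (-(9 / 5) : ℝ) * τ ^ (9 / 5 : ℝ) = 1 := by
    rw [← Real.rpow_add h0]
    norm_num
  have hT : 0 < τ ^ (9 / 5 : ℝ) := Real.rpow_pos_of_pos h0 _
  have hT' : 0 < τ ^ (-(9 / 5) : ℝ) := Real.rpow_pos_of_pos h0 _
  have hw : 0 < (1 + r) ^ (-(31 / 10) : ℝ) := Real.rpow_pos_of_pos (by positivity) _
  rw [mul_pow, ← e2]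
  calc (1 + r) ^ (-(31 / 10) : ℝ) * (1 + r) ^ (18 / 5 : ℝ) * gaussSymbol τ ξ ^ 2
      = τ ^ (-(9 / 5) : ℝ) * (1 + r) ^ (-(31 / 10) : ℝ) *
        ((τ ^ (9 / 5 : ℝ) * (1 + r) ^ (18 / 5 : ℝ)) * gaussSymbol τ ξ ^ 2) := by
        linear_combination (-(1 + r) ^ (-(31 / 10) : ℝ) * (1 + r) ^ (18 / 5 : ℝ)
          * gaussSymbol τ ξ ^ 2) * e3
    _ ≤ τ ^ (-(9 / 5) : ℝ) * (1 + r) ^ (-(31 / 10) : ℝ) * 4 := by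
        rw [← e1]
        gcongr
        calc (τ * (1 + r) ^ 2) ^ (9 / 5 : ℝ) * gaussSymbol τ ξ ^ 2
            ≤ 4 * (1 + x) ^ 2 * gaussSymbol τ ξ ^ 2 := by gcongr
          _ = 4 * (gaussSymbol τ ξ ^ 2 * (1 + x) ^ 2) := by ring
          _ ≤ 4 := by linarith
    _ = _ := by ring

/-- Smoothing of the heat flow, measured with weights on the Fourier side. -/
theorem norm_multiplier_heat_le {τ : ℝ} (h0 : 0 < τ) (h1 : τ ≤ 1) {f : R3 → Mat3}
    (hf : Integrable f volume) {s K : ℝ} (hK : 0 ≤ K)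
    (hfK : ∀ ξ, (1 + ‖ξ‖) ^ s * ‖𝓕 (fun x => complexify (f x)) ξ‖ ≤ K) {m : R3 → ℝ}
    (hm : IsSymbol m) (hms : ∀ ξ, |m ξ| ≤ (1 + ‖ξ‖) ^ (s + 1 / 4)) :
    ‖multiplier m (heat τ f)‖ ≤ 2 * √weightConst * K * τ ^ (-(9 / 10) : ℝ) := by
  have hnn : 0 ≤ 2 * √weightConst * K * τ ^ (-(9 / 10) : ℝ) := by positivity
  have e9 : (τ ^ (-(9 / 10) : ℝ)) ^ 2 = τ ^ (-(9 / 5) : ℝ) := by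
    rw [← Real.rpow_natCast _ 2, ← Real.rpow_mul h0.le]
    norm_num
  have key : ‖multiplier m (heat τ f)‖ₑ ^ 2
      ≤ ENNReal.ofReal ((2 * √weightConst * K * τ ^ (-(9 / 10) : ℝ)) ^ 2) := by
    have e : (2 * √weightConst * K * τ ^ (-(9 / 10) : ℝ)) ^ 2
        = ∫ ξ : R3, K ^ 2 * 4 * τ ^ (-(9 / 5) : ℝ) * (1 + ‖ξ‖) ^ (-(31 / 10) : ℝ) := by
      rw [integral_const_mul, ← weightConst, mul_pow, mul_pow, mul_pow, e9,
        Real.sq_sqrt weightConst_nonneg]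
      ring
    rw [e, ofReal_integral_eq_lintegral_ofReal (integrable_weight.const_mul _)
      (Eventually.of_forall fun ξ => by positivity), enorm_multiplier_sq hm]
    refine lintegral_mono_ae ?_
    filter_upwards [fourierL2_heat h0 hf] with ξ hξ
    have hw : 0 < (1 + ‖ξ‖) := by positivity
    rw [hξ, ← ofReal_norm, ← ofReal_norm, ← ENNReal.ofReal_mul (norm_nonneg _),
      ← ENNReal.ofReal_pow (by positivity)]
    apply ENNReal.ofReal_le_ofReal
    rw [norm_smul, Complex.norm_real, Real.norm_eq_abs, Real.norm_eq_abs,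
      abs_of_pos (gaussSymbol_pos _ _)]
    have h2 : |m ξ| * (gaussSymbol τ ξ * ‖𝓕 (fun x => complexify (f x)) ξ‖)
        ≤ K * ((1 + ‖ξ‖) ^ (1 / 4 : ℝ) * gaussSymbol τ ξ) := by
      have hg := (gaussSymbol_pos τ ξ).le
      calc |m ξ| * (gaussSymbol τ ξ * ‖𝓕 (fun x => complexify (f x)) ξ‖)
          ≤ (1 + ‖ξ‖) ^ (s + 1 / 4) * (gaussSymbol τ ξ * ‖𝓕 (fun x => complexify (f x)) ξ‖) := by
            gcongr
            exact hms ξ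
        _ = ((1 + ‖ξ‖) ^ s * ‖𝓕 (fun x => complexify (f x)) ξ‖) *
            ((1 + ‖ξ‖) ^ (1 / 4 : ℝ) * gaussSymbol τ ξ) := by
            rw [Real.rpow_add hw]
            ring
        _ ≤ _ := by
            gcongr
            exact hfK ξ
    calc (|m ξ| * (gaussSymbol τ ξ * ‖𝓕 (fun x => complexify (f x)) ξ‖)) ^ 2
        ≤ (K * ((1 + ‖ξ‖) ^ (1 / 4 : ℝ) * gaussSymbol τ ξ)) ^ 2 := by
          exact pow_le_pow_left₀ (mul_nonneg (abs_nonneg _)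
            (mul_nonneg (gaussSymbol_pos _ _).le (norm_nonneg _))) h2 2
      _ = K ^ 2 * ((1 + ‖ξ‖) ^ (1 / 4 : ℝ) * gaussSymbol τ ξ) ^ 2 := by ring
      _ ≤ K ^ 2 * (4 * τ ^ (-(9 / 5) : ℝ) * (1 + ‖ξ‖) ^ (-(31 / 10) : ℝ)) := by
          gcongr
          exact gaussSymbol_weight_bound h0 h1 ξ
      _ = _ := by ring
  rw [← ofReal_norm, ← ENNReal.ofReal_pow (norm_nonneg _),
    ENNReal.ofReal_le_ofReal_iff (by positivity)] at key
  exact (sq_le_sq₀ (norm_nonneg _) hnn).1 key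

theorem matSq_apply (M : Mat3) (ij : Fin 3 × Fin 3) :
    matSq M ij = ∑ k, M (ij.1, k) * M (k, ij.2) := by
  simp [matSq, Mat3.toMatrix, Matrix.mul_apply]

theorem norm_matSq_sub_le (M N : Mat3) :
    ‖matSq M - matSq N‖ ≤ 9 * (‖M - N‖ * (‖M‖ + ‖N‖)) := by
  have hij : ∀ ij, ‖(matSq M - matSq N) ij‖ ≤ 3 * (‖M - N‖ * (‖M‖ + ‖N‖)) := by
    intro ij
    have h1 : (matSq M - matSq N) ij
        = ∑ k, ((M - N) (ij.1, k) * M (k, ij.2) + N (ij.1, k) * (M - N) (k, ij.2)) := by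
      rw [PiLp.sub_apply, matSq_apply, matSq_apply, ← Finset.sum_sub_distrib]
      refine Finset.sum_congr rfl fun k _ => ?_
      simp only [PiLp.sub_apply]
      ring
    rw [h1]
    refine (norm_sum_le _ _).trans ?_
    have : ∀ k ∈ (Finset.univ : Finset (Fin 3)),
        ‖(M - N) (ij.1, k) * M (k, ij.2) + N (ij.1, k) * (M - N) (k, ij.2)‖
          ≤ ‖M - N‖ * (‖M‖ + ‖N‖) := by
      intro k _
      refine (norm_add_le _ _).trans ?_
      rw [norm_mul, norm_mul, mul_add, mul_comm ‖M - N‖ ‖N‖]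
      gcongr <;> exact PiLp.norm_apply_le _ _
    refine (Finset.sum_le_sum this).trans ?_
    simp
  rw [EuclideanSpace.norm_eq]
  refine Real.sqrt_le_iff.2 ⟨by positivity, ?_⟩
  calc ∑ ij, ‖(matSq M - matSq N) ij‖ ^ 2
      ≤ ∑ _ij : Fin 3 × Fin 3, (3 * (‖M - N‖ * (‖M‖ + ‖N‖))) ^ 2 :=
        Finset.sum_le_sum fun ij _ => pow_le_pow_left₀ (norm_nonneg _) (hij ij) 2
    _ = (9 * (‖M - N‖ * (‖M‖ + ‖N‖))) ^ 2 := by simp; ring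

theorem matSq_zero : matSq 0 = 0 := by
  have := norm_matSq_le 0
  simpa using this

theorem integrable_matSq (S : L2Mat) : Integrable (fun x => matSq (S x)) volume :=
  memLp_one_iff_integrable.1 (memLp_matSq S)

theorem lintegral_enorm_mul_le (S T : L2Mat) : ∫⁻ x, ‖S x‖ₑ * ‖T x‖ₑ ≤ ‖S‖ₑ * ‖T‖ₑ := by
  have h := cauchy_schwarz (Lp.aestronglyMeasurable S).enorm (Lp.aestronglyMeasurable T).enorm
  rw [← enorm_sq_eq_lintegral, ← enorm_sq_eq_lintegral, ← mul_pow] at h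
  exact (ENNReal.pow_le_pow_left_iff two_ne_zero).1 h

theorem integral_norm_matSq_sub_le (S T : L2Mat) :
    ∫ x, ‖matSq (S x) - matSq (T x)‖ ≤ 9 * (‖S - T‖ * (‖S‖ + ‖T‖)) := by
  have hm := ((integrable_matSq S).sub (integrable_matSq T)).1
  have e : ∫ x, ‖matSq (S x) - matSq (T x)‖
      = (∫⁻ x, ‖matSq (S x) - matSq (T x)‖ₑ).toReal := integral_norm_eq_lintegral_enorm hm
  rw [e]
  refine ENNReal.toReal_le_of_le_ofReal (by positivity) ?_
  have h : ∫⁻ x, ‖matSq (S x) - matSq (T x)‖ₑ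
      ≤ ∫⁻ x, 9 * (‖(S - T : L2Mat) x‖ₑ * ‖S x‖ₑ + ‖(S - T : L2Mat) x‖ₑ * ‖T x‖ₑ) := by
    refine lintegral_mono_ae ?_
    filter_upwards [Lp.coeFn_sub S T] with x hx
    rw [hx, Pi.sub_apply, ← mul_add]
    simp only [← ofReal_norm]
    rw [← ENNReal.ofReal_add (norm_nonneg _) (norm_nonneg _), ← ENNReal.ofReal_mul (norm_nonneg _),
      show (9 : ℝ≥0∞) = ENNReal.ofReal 9 by simp, ← ENNReal.ofReal_mul (by norm_num)]
    exact ENNReal.ofReal_le_ofReal (norm_matSq_sub_le _ _)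
  refine h.trans ?_
  have hmS : AEMeasurable (fun x => ‖(S - T : L2Mat) x‖ₑ * ‖S x‖ₑ) (volume : Measure R3) :=
    (Lp.aestronglyMeasurable _).enorm.mul (Lp.aestronglyMeasurable _).enorm
  rw [lintegral_const_mul' _ _ (by simp), lintegral_add_left' hmS]
  refine (mul_le_mul_right (add_le_add (lintegral_enorm_mul_le _ _) (lintegral_enorm_mul_le _ _)) _).trans ?_
  rw [← mul_add]
  simp only [← ofReal_norm]
  rw [← ENNReal.ofReal_add (norm_nonneg _) (norm_nonneg _), ← ENNReal.ofReal_mul (norm_nonneg _),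
      show (9 : ℝ≥0∞) = ENNReal.ofReal 9 by simp, ← ENNReal.ofReal_mul (by norm_num)]

theorem isSymbol_one : IsSymbol fun _ => 1 :=
  ⟨measurable_const, fun _ => rfl, 1, fun _ => by simp⟩

/-- For τ ≤ 1 this is the smoothing estimate with weight exponent 0 and symbol 1. For τ > 1 the flow
is run to time 1 and then contracts. The exponent 9/10 is worse than the optimal 3/4 but still
integrable at 0. -/
theorem norm_heat_le {τ : ℝ} (h0 : 0 < τ) {f : R3 → Mat3} (hf : Integrable f volume) :
    ‖heat τ f‖ ≤ 2 * √weightConst * (1 + τ ^ (-(9 / 10) : ℝ)) * ∫ x, ‖f x‖ := by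
  have hK : 0 ≤ ∫ x, ‖f x‖ := integral_nonneg fun x => norm_nonneg _
  have hsmall : ∀ σ : ℝ, 0 < σ → σ ≤ 1 →
      ‖heat σ f‖ ≤ 2 * √weightConst * (∫ x, ‖f x‖) * σ ^ (-(9 / 10) : ℝ) := by
    intro σ hσ hσ1
    have h := norm_multiplier_heat_le (s := 0) hσ hσ1 hf hK (fun ξ => ?_) isSymbol_one
      (fun ξ => ?_)
    · rwa [multiplier_one] at h
    · rw [Real.rpow_zero, one_mul]
      refine (VectorFourier.norm_fourierIntegral_le_integral_norm _ _ _ _ _).trans ?_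
      simp
    · rw [abs_one]
      exact Real.one_le_rpow (by linarith [norm_nonneg ξ]) (by norm_num)
  rcases le_or_gt τ 1 with h1 | h1
  · refine (hsmall τ h0 h1).trans ?_
    have : 0 ≤ 2 * √weightConst * ∫ x, ‖f x‖ := by positivity
    linarith
  · have e : heat τ f = heatL2 (τ - 1) (heat 1 f) := by
      rw [heatL2_heat (by linarith) one_pos hf, sub_add_cancel]
    rw [e]
    refine (norm_heatL2_le (by linarith) _).trans ((hsmall 1 one_pos le_rfl).trans ?_)
    rw [Real.one_rpow]
    have h2 : 0 ≤ 2 * √weightConst * ∫ x, ‖f x‖ := by positivity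
    have h3 : 0 ≤ τ ^ (-(9 / 10) : ℝ) := by positivity
    nlinarith [mul_nonneg h2 h3]

/-! ### The nonlinear term of Duhamel's formula. -/

/-- The term `e^{τΔ} P_st(S²)` of Duhamel's formula. -/
def nonl (τ : ℝ) (S : L2Mat) : L2Mat := Pst (heat τ fun x => matSq (S x))

/-- The constant in the estimates of `nonl`. -/
def nonlConst : ℝ := 18 * √weightConst

theorem nonlConst_nonneg : 0 ≤ nonlConst := by
  unfold nonlConst
  positivity

/-- The singular kernel that bounds `nonl`. -/
def sKernel (τ : ℝ) : ℝ := 1 + τ ^ (-(9 / 10) : ℝ)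

theorem sKernel_nonneg {τ : ℝ} (h : 0 ≤ τ) : 0 ≤ sKernel τ := by
  unfold sKernel
  positivity

theorem norm_nonl_sub_le {τ : ℝ} (h0 : 0 < τ) (S T : L2Mat) :
    ‖nonl τ S - nonl τ T‖ ≤ nonlConst * sKernel τ * (‖S - T‖ * (‖S‖ + ‖T‖)) := by
  unfold nonl
  rw [← map_sub, heat_sub h0 (integrable_matSq S) (integrable_matSq T)]
  refine (norm_Pst_le _).trans ((norm_heat_le h0 ((integrable_matSq S).sub (integrable_matSq T))).trans ?_)
  have h := integral_norm_matSq_sub_le S T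
  have hs := sKernel_nonneg h0.le
  calc 2 * √weightConst * sKernel τ * ∫ x, ‖matSq (S x) - matSq (T x)‖
      ≤ 2 * √weightConst * sKernel τ * (9 * (‖S - T‖ * (‖S‖ + ‖T‖))) := by gcongr
    _ = _ := by unfold nonlConst; ring

theorem nonl_zero {τ : ℝ} : nonl τ 0 = 0 := by
  unfold nonl
  have h : (fun x => matSq ((0 : L2Mat) x)) =ᵐ[volume] fun _ => (0 : Mat3) := by
    filter_upwards [Lp.coeFn_zero Mat3 2 (volume : Measure R3)] with x hx
    rw [hx, Pi.zero_apply, matSq_zero]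
  have h0 : heat τ (fun _ => (0 : Mat3)) = 0 := by
    have e : heatConv τ (fun _ => (0 : Mat3)) = fun _ => 0 := by
      ext1 x
      simp [heatConv, convolution]
    unfold heat
    split_ifs with h
    · have : h.toLp = (MemLp.zero' (p := 2) (μ := (volume : Measure R3)) (ε := Mat3)).toLp :=
        MemLp.toLp_congr _ _ (by rw [e])
      rw [this]
      exact MemLp.toLp_zero _
    · rfl
  rw [heat_congr h, h0, map_zero]

theorem norm_nonl_le {τ : ℝ} (h0 : 0 < τ) (S : L2Mat) :
    ‖nonl τ S‖ ≤ nonlConst * sKernel τ * ‖S‖ ^ 2 := by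
  have := norm_nonl_sub_le h0 S 0
  simpa [nonl_zero, sq] using this

theorem heatL2_nonl {s τ : ℝ} (hs : 0 ≤ s) (hτ : 0 < τ) (S : L2Mat) :
    heatL2 s (nonl τ S) = nonl (s + τ) S := by
  unfold nonl
  rw [heatL2_Pst hs, heatL2_heat hs hτ (integrable_matSq S)]

/-- Squaring leaves L², so continuity is obtained in two stages: at the fixed time τ₀/2 the map
`nonl` is locally Lipschitz on L², and the heat flow over the remaining time is jointly continuous.
-/
theorem tendsto_nonl {ι : Type*} {l : Filter ι} {τ : ι → ℝ} {τ₀ : ℝ} {X : ι → L2Mat} {X₀ : L2Mat}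
    (hτ₀ : 0 < τ₀) (hτ : Tendsto τ l (𝓝 τ₀)) (hX : Tendsto X l (𝓝 X₀)) :
    Tendsto (fun i => nonl (τ i) (X i)) l (𝓝 (nonl τ₀ X₀)) := by
  have h2 : 0 < τ₀ / 2 := by positivity
  have hY : Tendsto (fun i => nonl (τ₀ / 2) (X i)) l (𝓝 (nonl (τ₀ / 2) X₀)) := by
    rw [tendsto_iff_norm_sub_tendsto_zero]
    have h3 : Tendsto (fun i => nonlConst * sKernel (τ₀ / 2) * (‖X i - X₀‖ * (‖X i‖ + ‖X₀‖))) l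
        (𝓝 (nonlConst * sKernel (τ₀ / 2) * (0 * (‖X₀‖ + ‖X₀‖)))) :=
      ((tendsto_iff_norm_sub_tendsto_zero.1 hX).mul (hX.norm.add_const _)).const_mul _
    rw [zero_mul, mul_zero] at h3
    exact squeeze_zero (fun _ => norm_nonneg _) (fun i => norm_nonl_sub_le h2 _ _) h3
  have hev : ∀ᶠ i in l, τ₀ / 2 < τ i := hτ.eventually (lt_mem_nhds (by linarith))
  have h4 : Tendsto (fun i => heatL2 (τ i - τ₀ / 2) (nonl (τ₀ / 2) (X i))) l
      (𝓝 (heatL2 (τ₀ - τ₀ / 2) (nonl (τ₀ / 2) X₀))) :=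
    tendsto_heatL2 (by linarith) (hev.mono fun i hi => by linarith) (hτ.sub_const _) hY
  rw [heatL2_nonl (by linarith) h2, sub_add_cancel] at h4
  refine h4.congr' (hev.mono fun i hi => ?_)
  rw [heatL2_nonl (by linarith) h2, sub_add_cancel]

theorem intervalIntegrable_sKernel (a b : ℝ) : IntervalIntegrable sKernel volume a b :=
  (intervalIntegrable_const).add (intervalIntegral.intervalIntegrable_rpow' (by norm_num))

theorem integral_sKernel (t : ℝ) :
    ∫ τ in (0 : ℝ)..t, sKernel τ = t + 10 * t ^ (1 / 10 : ℝ) := by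
  unfold sKernel
  rw [intervalIntegral.integral_add intervalIntegrable_const
    (intervalIntegral.intervalIntegrable_rpow' (by norm_num)), integral_rpow (Or.inl (by norm_num))]
  norm_num
  ring

theorem continuousOn_nonl_sub {S : ℝ → L2Mat} {t : ℝ} (hS : ContinuousOn S (Set.Icc 0 t)) :
    ContinuousOn (fun τ => nonl τ (S (t - τ))) (Set.Ioc 0 t) := by
  intro τ hτ
  refine tendsto_nonl hτ.1 (tendsto_id.mono_left nhdsWithin_le_nhds) ?_
  refine (hS (t - τ) ⟨by linarith [hτ.2], by linarith [hτ.1]⟩).tendsto.comp ?_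
  refine tendsto_nhdsWithin_iff.2 ⟨?_, ?_⟩
  · exact ((continuous_const.sub continuous_id).tendsto τ).mono_left nhdsWithin_le_nhds
  · filter_upwards [self_mem_nhdsWithin] with σ hσ
    exact ⟨by linarith [hσ.2], by linarith [hσ.1]⟩

theorem intervalIntegrable_nonl {S : ℝ → L2Mat} {t : ℝ} (ht : 0 ≤ t)
    (hS : ContinuousOn S (Set.Icc 0 t)) :
    IntervalIntegrable (fun τ => nonl τ (S (t - τ))) volume 0 t := by
  obtain ⟨M, hM⟩ := isCompact_Icc.exists_bound_of_continuousOn hS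
  refine (((intervalIntegrable_sKernel 0 t).const_mul (nonlConst * M ^ 2))).mono_fun ?_ ?_
  · rw [Set.uIoc_of_le ht]
    exact (continuousOn_nonl_sub hS).aestronglyMeasurable measurableSet_Ioc
  · rw [Set.uIoc_of_le ht]
    filter_upwards [ae_restrict_mem measurableSet_Ioc] with τ hτ
    refine (norm_nonl_le hτ.1 _).trans ?_
    have h1 := hM (t - τ) ⟨by linarith [hτ.2], by linarith [hτ.1]⟩
    have h2 := sKernel_nonneg hτ.1.le
    have h3 := nonlConst_nonneg
    rw [Real.norm_of_nonneg (by positivity)]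
    calc nonlConst * sKernel τ * ‖S (t - τ)‖ ^ 2 ≤ nonlConst * sKernel τ * M ^ 2 := by gcongr
      _ = _ := by ring

/-- The semigroup property adds `h` to the kernel time, and the shift τ ↦ τ + h turns the Duhamel
integral at time t - h into the part of the one at time `t` that sees only `S` on [0, t-h]. -/
theorem heatL2_integral_nonl {S : ℝ → L2Mat} {h t : ℝ} (h0 : 0 ≤ h) (ht : h ≤ t)
    (hS : ContinuousOn S (Set.Icc 0 (t - h))) :
    heatL2 h (∫ τ in (0 : ℝ)..(t - h), nonl τ (S (t - h - τ)))
      = ∫ τ in h..t, nonl τ (S (t - τ)) := by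
  rw [← ContinuousLinearMap.intervalIntegral_comp_comm _
    (intervalIntegrable_nonl (by linarith) hS)]
  have e : ∫ τ in h..t, nonl τ (S (t - τ))
      = ∫ τ in (0 : ℝ)..(t - h), nonl (τ + h) (S (t - (τ + h))) := by
    rw [intervalIntegral.integral_comp_add_right (fun τ => nonl τ (S (t - τ)))]
    simp
  rw [e]
  refine intervalIntegral.integral_congr_ae (Eventually.of_forall fun τ hτ => ?_)
  rw [Set.uIoc_of_le (by linarith)] at hτ
  rw [heatL2_nonl h0 hτ.1, add_comm h τ, sub_sub, add_comm h τ]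

/-! ### Restarting and continuing mild solutions. -/

theorem IsMildSolution.continuousOn_Icc {T : EReal} {S : ℝ → L2Mat} (h : IsMildSolution T S)
    {t : ℝ} (ht : (t : EReal) < T) : ContinuousOn S (Set.Icc 0 t) :=
  h.cont.mono fun _ hs => ⟨hs.1, lt_of_le_of_lt (EReal.coe_le_coe_iff.2 hs.2) ht⟩

theorem IsMildSolution.duhamel' {T : EReal} {S : ℝ → L2Mat} (h : IsMildSolution T S)
    {t : ℝ} (h0 : 0 ≤ t) (ht : (t : EReal) < T) :
    S t = heatL2 t (S 0) - (2 / 3 : ℝ) • ∫ τ in (0 : ℝ)..t, nonl τ (S (t - τ)) := by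
  rcases h0.eq_or_lt with rfl | h0
  · simp [heatL2_zero]
  · rw [h.duhamel t h0 ht, heat_eq_multiplier h0]
    rfl

/-- Duhamel's formula restarted at an intermediate time. -/
theorem IsMildSolution.restart {T : EReal} {S : ℝ → L2Mat} (h : IsMildSolution T S)
    {a t : ℝ} (ha : 0 ≤ a) (hat : a ≤ t) (ht : (t : EReal) < T) :
    S t = heatL2 (t - a) (S a) - (2 / 3 : ℝ) • ∫ τ in (0 : ℝ)..(t - a), nonl τ (S (t - τ)) := by
  have haT : (a : EReal) < T := lt_of_le_of_lt (EReal.coe_le_coe_iff.2 hat) ht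
  have hta : 0 ≤ t - a := by linarith
  have hc := h.continuousOn_Icc haT
  have e := heatL2_integral_nonl (h := t - a) (t := t) (S := S) hta (by linarith)
    (by rwa [sub_sub_cancel])
  rw [sub_sub_cancel] at e
  have hi := intervalIntegrable_nonl (ha.trans hat) (h.continuousOn_Icc ht)
  -- The integral over [t-a, t] involves `S` only up to time `a`. Together with the linear term it
  -- is the heat flow of `S a` over the time t - a.
  have hadj : (∫ τ in (0 : ℝ)..(t - a), nonl τ (S (t - τ))) + ∫ τ in (t - a)..t, nonl τ (S (t - τ))
      = ∫ τ in (0 : ℝ)..t, nonl τ (S (t - τ)) :=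
    intervalIntegral.integral_add_adjacent_intervals
      (hi.mono_set (by
        rw [Set.uIcc_of_le hta, Set.uIcc_of_le (ha.trans hat)]
        exact Set.Icc_subset_Icc le_rfl (by linarith)))
      (hi.mono_set (by
        rw [Set.uIcc_of_le (show t - a ≤ t by linarith), Set.uIcc_of_le (ha.trans hat)]
        exact Set.Icc_subset_Icc hta le_rfl))
  rw [h.duhamel' ha haT, h.duhamel' (ha.trans hat) ht, map_sub, map_smul, e,
    ← heatL2_add hta ha, sub_add_cancel, ← hadj, smul_add]
  abel

/-- A solution of the integral equation on a compact time interval `[0,δ]`. -/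
structure IsLocalSolution (δ : ℝ) (S : ℝ → L2Mat) : Prop where
  cont : ContinuousOn S (Set.Icc 0 δ)
  mem : ∀ t ∈ Set.Icc 0 δ, S t ∈ L2st
  duhamel : ∀ t ∈ Set.Icc 0 δ,
    S t = heatL2 t (S 0) - (2 / 3 : ℝ) • ∫ τ in (0 : ℝ)..t, nonl τ (S (t - τ))

/-- Continuing a mild solution from time `a` by a local solution. -/
theorem IsMildSolution.extend {T : EReal} {S R : ℝ → L2Mat} (h : IsMildSolution T S)
    {a δ : ℝ} (ha : 0 ≤ a) (haT : (a : EReal) < T) (hδ : 0 < δ) (hR : IsLocalSolution δ R)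
    (hRa : R 0 = S a) :
    IsMildSolution ((a + δ : ℝ) : EReal) (fun t => if t ≤ a then S t else R (t - a)) := by
  set S' : ℝ → L2Mat := fun t => if t ≤ a then S t else R (t - a) with hS'
  have hl : ∀ t, t ≤ a → S' t = S t := fun t ht => if_pos ht
  have hr : ∀ t, a ≤ t → S' t = R (t - a) := by
    intro t ht
    rcases ht.eq_or_lt with rfl | ht
    · rw [hl _ le_rfl, sub_self, hRa]
    · exact if_neg (not_le.2 ht)
  have hcont : ContinuousOn S' (Set.Icc 0 (a + δ)) := by
    have h1 : ContinuousOn S' (Set.Icc 0 a) :=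
      (h.continuousOn_Icc haT).congr fun t ht => hl t ht.2
    have h2 : ContinuousOn S' (Set.Icc a (a + δ)) := by
      have : ContinuousOn (fun t => R (t - a)) (Set.Icc a (a + δ)) :=
        hR.cont.comp (by fun_prop) fun t ht => ⟨by linarith [ht.1], by linarith [ht.2]⟩
      exact this.congr fun t ht => hr t ht.1
    have := h1.union_of_isClosed h2 isClosed_Icc isClosed_Icc
    rwa [Set.Icc_union_Icc_eq_Icc ha (by linarith)] at this
  have hS0 : S' 0 = S 0 := hl 0 ha
  refine ⟨by exact_mod_cast (by linarith : 0 < a + δ), ?_, ?_, ?_⟩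
  · intro t h0 ht
    have ht' : t < a + δ := by exact_mod_cast ht
    rcases le_total t a with hta | hta
    · rw [hl t hta]
      exact h.mem t h0 (lt_of_le_of_lt (EReal.coe_le_coe_iff.2 hta) haT)
    · rw [hr t hta]
      exact hR.mem _ ⟨by linarith, by linarith⟩
  · refine hcont.mono fun t ht => ⟨ht.1, ?_⟩
    have : t < a + δ := by exact_mod_cast ht.2
    exact this.le
  · intro t h0 ht
    have ht' : t < a + δ := by exact_mod_cast ht
    rw [heat_eq_multiplier h0, hS0]
    change S' t = heatL2 t (S 0) - (2 / 3 : ℝ) • ∫ τ in (0 : ℝ)..t, nonl τ (S' (t - τ))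
    rcases le_total t a with hta | hta
    · rw [hl t hta, h.duhamel' h0.le (lt_of_le_of_lt (EReal.coe_le_coe_iff.2 hta) haT)]
      congr 2
      refine intervalIntegral.integral_congr fun τ hτ => ?_
      rw [Set.uIcc_of_le h0.le] at hτ
      rw [hl _ (by linarith [hτ.1])]
    · have hta' : 0 ≤ t - a := by linarith
      have hi := intervalIntegrable_nonl h0.le (hcont.mono (Set.Icc_subset_Icc le_rfl ht'.le))
      have hadj : (∫ τ in (0 : ℝ)..(t - a), nonl τ (S' (t - τ)))
          + ∫ τ in (t - a)..t, nonl τ (S' (t - τ))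
          = ∫ τ in (0 : ℝ)..t, nonl τ (S' (t - τ)) :=
        intervalIntegral.integral_add_adjacent_intervals
          (hi.mono_set (by
            rw [Set.uIcc_of_le hta', Set.uIcc_of_le h0.le]
            exact Set.Icc_subset_Icc le_rfl (by linarith)))
          (hi.mono_set (by
            rw [Set.uIcc_of_le (show t - a ≤ t by linarith), Set.uIcc_of_le h0.le]
            exact Set.Icc_subset_Icc hta' le_rfl))
      -- The split at τ = t - a separates the times governed by `R` from those governed by `S`; both
      -- descriptions agree at the junction since `R 0 = S a`.
      have e1 : ∫ τ in (0 : ℝ)..(t - a), nonl τ (S' (t - τ))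
          = ∫ τ in (0 : ℝ)..(t - a), nonl τ (R (t - a - τ)) := by
        refine intervalIntegral.integral_congr fun τ hτ => ?_
        rw [Set.uIcc_of_le hta'] at hτ
        rw [hr _ (by linarith [hτ.2]), sub_right_comm]
      have e2 : ∫ τ in (t - a)..t, nonl τ (S' (t - τ))
          = ∫ τ in (t - a)..t, nonl τ (S (t - τ)) := by
        refine intervalIntegral.integral_congr fun τ hτ => ?_
        rw [Set.uIcc_of_le (by linarith)] at hτ
        rw [hl _ (by linarith [hτ.1])]
      have e := heatL2_integral_nonl (h := t - a) (t := t) (S := S) hta' (by linarith)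
        (by rw [sub_sub_cancel]; exact h.continuousOn_Icc haT)
      rw [sub_sub_cancel] at e
      rw [hr t hta, hR.duhamel (t - a) ⟨hta', by linarith⟩, hRa, h.duhamel' ha haT, map_sub,
        map_smul, e, ← heatL2_add hta' ha, sub_add_cancel, ← hadj, smul_add, e1, e2]
      abel

/-! ### Local existence by contraction, and the continuation criterion. -/

/-- The upper limit is moved into an indicator of τ < t on the fixed interval (0, δ]. Dominated
convergence applies with a multiple of `sKernel` as majorant, the integrand being continuous in t at
t₀ for every τ ≠ t₀. -/
theorem continuousOn_integral_nonl {g : ℝ → L2Mat} (hg : Continuous g) {R : ℝ}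
    (hR : ∀ t, ‖g t‖ ≤ R) (δ : ℝ) :
    ContinuousOn (fun t => ∫ τ in (0 : ℝ)..t, nonl τ (g (t - τ))) (Set.Icc 0 δ) := by
  intro t₀ ht₀
  set F : ℝ → ℝ → L2Mat := fun t => (Set.Iio t).indicator fun τ => nonl τ (g (t - τ)) with hF
  have hcont : ∀ t, ContinuousOn (fun τ => nonl τ (g (t - τ))) (Set.Ioc 0 δ) := by
    intro t τ hτ
    exact tendsto_nonl hτ.1 (tendsto_id.mono_left nhdsWithin_le_nhds)
      (((hg.comp (continuous_const.sub continuous_id)).tendsto τ).mono_left nhdsWithin_le_nhds)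
  have e : ∀ t ∈ Set.Icc 0 δ, ∫ τ in (0 : ℝ)..t, nonl τ (g (t - τ))
      = ∫ τ in Set.Ioc 0 δ, F t τ := by
    intro t ht
    rw [intervalIntegral.integral_of_le ht.1, hF, setIntegral_indicator measurableSet_Iio,
      integral_Ioc_eq_integral_Ioo]
    congr 2
    ext τ
    simp only [Set.mem_Ioo, Set.mem_inter_iff, Set.mem_Ioc, Set.mem_Iio]
    constructor
    · exact fun h => ⟨⟨h.1, h.2.le.trans ht.2⟩, h.2⟩
    · exact fun h => ⟨h.1.1, h.2⟩
  have key : ContinuousWithinAt (fun t => ∫ τ in Set.Ioc 0 δ, F t τ) (Set.Icc 0 δ) t₀ := by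
    have hb : Integrable (fun τ => nonlConst * sKernel τ * R ^ 2)
        (volume.restrict (Set.Ioc 0 δ)) :=
      ((intervalIntegrable_sKernel 0 δ).1.const_mul nonlConst).mul_const (R ^ 2)
    refine continuousWithinAt_of_dominated (bound := fun τ => nonlConst * sKernel τ * R ^ 2)
      (Eventually.of_forall fun t => ?_) (Eventually.of_forall fun t => ?_) hb ?_
    · exact ((hcont t).aestronglyMeasurable measurableSet_Ioc).indicator measurableSet_Iio
    · filter_upwards [ae_restrict_mem measurableSet_Ioc] with τ hτ
      have h3 := nonlConst_nonneg
      have h4 := sKernel_nonneg hτ.1.le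
      refine (norm_indicator_le_norm_self _ _).trans ((norm_nonl_le hτ.1 _).trans ?_)
      gcongr
      exact hR _
    · have hne : ∀ᵐ τ ∂(volume.restrict (Set.Ioc 0 δ)), τ ≠ t₀ :=
        ae_restrict_of_ae (by simp [ae_iff])
      filter_upwards [ae_restrict_mem measurableSet_Ioc, hne] with τ hτ hτt
      refine ContinuousAt.continuousWithinAt ?_
      rcases lt_or_gt_of_ne hτt with hlt | hgt
      · have hc : ContinuousAt (fun t => nonl τ (g (t - τ))) t₀ :=
          tendsto_nonl hτ.1 tendsto_const_nhds
            ((hg.comp (continuous_id.sub continuous_const)).tendsto t₀)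
        refine hc.congr ?_
        filter_upwards [lt_mem_nhds hlt] with t ht
        exact (Set.indicator_of_mem (show τ ∈ Set.Iio t from ht)
          fun τ => nonl τ (g (t - τ))).symm
      · refine (continuousAt_const (y := (0 : L2Mat))).congr ?_
        filter_upwards [gt_mem_nhds hgt] with t ht
        exact (Set.indicator_of_notMem (show τ ∉ Set.Iio t from not_lt.2 (le_of_lt ht))
          fun τ => nonl τ (g (t - τ))).symm
  exact key.congr (fun t ht => e t ht) (e t₀ ht₀)

theorem integral_nonl_mem_L2st {S : ℝ → L2Mat} {t : ℝ} (ht : 0 ≤ t)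
    (hS : ContinuousOn S (Set.Icc 0 t)) : ∫ τ in (0 : ℝ)..t, nonl τ (S (t - τ)) ∈ L2st := by
  have h := ContinuousLinearMap.intervalIntegral_comp_comm Pst (intervalIntegrable_nonl ht hS)
  have e : ∀ τ, Pst (nonl τ (S (t - τ))) = nonl τ (S (t - τ)) := fun τ => Pst_eq_self (Pst_mem _)
  simp only [e] at h
  rw [h]
  exact Pst_mem _

/-- The local existence time for data of size `R - 1`. -/
def lifespan (R : ℝ) : ℝ := (1 / (22 * nonlConst * R ^ 2 + 1)) ^ 10

theorem lifespan_pos (R : ℝ) : 0 < lifespan R := by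
  have := nonlConst_nonneg
  unfold lifespan
  positivity

theorem integral_sKernel_lifespan {R t : ℝ} (h0 : 0 ≤ t) (ht : t ≤ lifespan R) :
    nonlConst * (∫ τ in (0 : ℝ)..t, sKernel τ) * R ^ 2 ≤ 1 / 2 := by
  have hA := nonlConst_nonneg
  set c := 1 / (22 * nonlConst * R ^ 2 + 1) with hc
  have hc0 : 0 ≤ c := by positivity
  -- The integral is t + 10 t^{1/10}. The tenth power in `lifespan` gives t^{1/10} ≤ c, and t ≤ c
  -- since c ≤ 1. The 22 in c is twice this 11, which produces the final 1/2.
  have h1 : ∫ τ in (0 : ℝ)..t, sKernel τ ≤ 11 * c := by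
    rw [integral_sKernel]
    have h2 : t ^ (1 / 10 : ℝ) ≤ c := by
      calc t ^ (1 / 10 : ℝ) ≤ (lifespan R) ^ (1 / 10 : ℝ) := by gcongr
        _ = c := by
          unfold lifespan
          rw [← hc, ← Real.rpow_natCast, ← Real.rpow_mul hc0]
          norm_num
    have h3 : t ≤ c := by
      refine ht.trans ?_
      unfold lifespan
      rw [← hc]
      refine pow_le_of_le_one hc0 ?_ (by norm_num)
      rw [hc, div_le_one (by positivity)]
      have : 0 ≤ 22 * nonlConst * R ^ 2 := by positivity
      linarith
    linarith
  have h4 : c * (22 * nonlConst * R ^ 2 + 1) = 1 := by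
    rw [hc]
    field_simp
  calc nonlConst * (∫ τ in (0 : ℝ)..t, sKernel τ) * R ^ 2
      ≤ nonlConst * (11 * c) * R ^ 2 := by gcongr
    _ = (1 - c) / 2 := by linear_combination h4 / 2
    _ ≤ 1 / 2 := by linarith

/-- Local existence, on a time interval that depends only on the size of the data. -/
theorem exists_isLocalSolution {M : ℝ} {S₀ : L2Mat} (hS₀ : S₀ ∈ L2st) (hM : ‖S₀‖ ≤ M) :
    ∃ S : ℝ → L2Mat, S 0 = S₀ ∧ IsLocalSolution (lifespan (M + 1)) S := by
  have hM0 : 0 ≤ M := (norm_nonneg _).trans hM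
  -- On the ball of radius `R` the nonlinear term is at most 2/3, so the extra 1 suffices for
  -- invariance. That R ≥ 1 is used for the contraction.
  set R := M + 1 with hRdef
  set δ := lifespan R with hδdef
  have hδ : 0 < δ := lifespan_pos R
  have hA := nonlConst_nonneg
  let X := C(Set.Icc (0 : ℝ) δ, L2Mat)
  let ext : X → ℝ → L2Mat := fun f => Set.IccExtend hδ.le f
  have hext : ∀ f : X, Continuous (ext f) := fun f => f.continuous.Icc_extend'
  have hextn : ∀ (f : X) t, ‖ext f t‖ ≤ ‖f‖ := fun f t => f.norm_coe_le_norm _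
  let I : X → ℝ → L2Mat := fun f t => ∫ τ in (0 : ℝ)..t, nonl τ (ext f (t - τ))
  let Φ' : X → ℝ → L2Mat := fun f t => heatL2 t S₀ - (2 / 3 : ℝ) • I f t
  have hΦc : ∀ f, ContinuousOn (Φ' f) (Set.Icc 0 δ) := fun f => by
    have h1 : ContinuousOn (I f) (Set.Icc 0 δ) :=
      continuousOn_integral_nonl (hext f) (hextn f) δ
    have h2 : ContinuousOn (fun t => heatL2 t S₀) (Set.Icc 0 δ) :=
      (continuousOn_heatL2 S₀).mono fun t ht => ht.1
    exact h2.sub (h1.const_smul (2 / 3 : ℝ))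
  let Φ : X → X := fun f => ⟨(Set.Icc 0 δ).domRestrict (Φ' f), (hΦc f).domRestrict⟩
  have hint : ∀ (f : X) t, 0 ≤ t →
      IntervalIntegrable (fun τ => nonl τ (ext f (t - τ))) volume 0 t :=
    fun f t ht => intervalIntegrable_nonl ht (hext f).continuousOn
  have hdiff : ∀ f g : X, ‖f‖ ≤ R → ‖g‖ ≤ R → ∀ t ∈ Set.Icc 0 δ,
      ‖I f t - I g t‖ ≤ nonlConst * (∫ τ in (0 : ℝ)..t, sKernel τ) * (‖f - g‖ * (R + R)) := by
    intro f g hf hg t ht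
    have e : I f t - I g t
        = ∫ τ in (0 : ℝ)..t, (nonl τ (ext f (t - τ)) - nonl τ (ext g (t - τ))) :=
      (intervalIntegral.integral_sub (hint f t ht.1) (hint g t ht.1)).symm
    rw [e]
    have hle : ‖∫ τ in (0 : ℝ)..t, (nonl τ (ext f (t - τ)) - nonl τ (ext g (t - τ)))‖
        ≤ ∫ τ in (0 : ℝ)..t, nonlConst * sKernel τ * (‖f - g‖ * (R + R)) := by
      refine intervalIntegral.norm_integral_le_of_norm_le ht.1 ?_
        (((intervalIntegrable_sKernel 0 t).const_mul nonlConst).mul_const _)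
      refine Eventually.of_forall fun τ hτ => ?_
      refine (norm_nonl_sub_le hτ.1 _ _).trans ?_
      have h4 := sKernel_nonneg hτ.1.le
      have h5 : ‖ext f (t - τ) - ext g (t - τ)‖ ≤ ‖f - g‖ := (f - g).norm_coe_le_norm _
      gcongr
      · exact (hextn f _).trans hf
      · exact (hextn g _).trans hg
    rw [intervalIntegral.integral_mul_const, intervalIntegral.integral_const_mul] at hle
    exact hle
  have hI0 : ∀ t, I 0 t = 0 := by
    intro t
    have : ∀ τ, nonl τ (ext 0 (t - τ)) = 0 := fun τ => nonl_zero
    simp [I, this]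
  have hbd : ∀ f : X, ‖f‖ ≤ R → ∀ t ∈ Set.Icc 0 δ,
      ‖I f t‖ ≤ nonlConst * (∫ τ in (0 : ℝ)..t, sKernel τ) * (R * (R + R)) := by
    intro f hf t ht
    have h := hdiff f 0 hf (by simp; positivity) t ht
    rw [hI0, sub_zero, sub_zero] at h
    refine h.trans ?_
    have : 0 ≤ ∫ τ in (0 : ℝ)..t, sKernel τ :=
      intervalIntegral.integral_nonneg ht.1 fun τ hτ => sKernel_nonneg hτ.1
    gcongr
  have hmaps : Set.MapsTo Φ (Metric.closedBall 0 R) (Metric.closedBall 0 R) := by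
    intro f hf
    rw [mem_closedBall_zero_iff] at hf ⊢
    refine (ContinuousMap.norm_le _ (by positivity)).2 fun t => ?_
    change ‖heatL2 t S₀ - (2 / 3 : ℝ) • I f t‖ ≤ R
    have h1 := (norm_heatL2_le t.2.1 S₀).trans hM
    have h2 := hbd f hf t t.2
    have h3 := integral_sKernel_lifespan t.2.1 t.2.2
    calc _ ≤ ‖heatL2 t S₀‖ + ‖(2 / 3 : ℝ) • I f t‖ := norm_sub_le _ _
      _ ≤ M + 2 / 3 * ‖I f t‖ := by
        rw [norm_smul]
        norm_num
        exact h1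
      _ ≤ R := by nlinarith
  have hcontr : ContractingWith (2 / 3) (hmaps.restrict Φ _ _) := by
    refine ⟨by rw [← NNReal.coe_lt_coe]; norm_num, LipschitzWith.of_dist_le_mul fun f g => ?_⟩
    have hf := mem_closedBall_zero_iff.1 f.2
    have hg := mem_closedBall_zero_iff.1 g.2
    rw [Subtype.dist_eq, Subtype.dist_eq, dist_eq_norm, dist_eq_norm]
    refine (ContinuousMap.norm_le _ (by positivity)).2 fun t => ?_
    change ‖(heatL2 t S₀ - (2 / 3 : ℝ) • I f t) - (heatL2 t S₀ - (2 / 3 : ℝ) • I g t)‖ ≤ _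
    rw [sub_sub_sub_cancel_left, ← smul_sub, norm_smul, norm_sub_rev]
    have h1 := hdiff f g hf hg t t.2
    have h3 := integral_sKernel_lifespan t.2.1 t.2.2
    have hJ : 0 ≤ ∫ τ in (0 : ℝ)..(t : ℝ), sKernel τ :=
      intervalIntegral.integral_nonneg t.2.1 fun τ hτ => sKernel_nonneg hτ.1
    have h4 : nonlConst * (∫ τ in (0 : ℝ)..(t : ℝ), sKernel τ) * R ≤ 1 / 2 := by
      refine le_trans ?_ h3
      have h5 : R ≤ R ^ 2 := by nlinarith
      have h6 : 0 ≤ nonlConst * (∫ τ in (0 : ℝ)..(t : ℝ), sKernel τ) := by positivity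
      nlinarith
    have h7 : ‖(2 / 3 : ℝ)‖ = 2 / 3 := by norm_num
    rw [h7]
    have h8 : (((2 / 3 : NNReal)) : ℝ) = 2 / 3 := by norm_num
    rw [h8]
    have h9 : ‖I (f : X) t - I (g : X) t‖ ≤ ‖(f : X) - g‖ := by
      refine h1.trans ?_
      have h10 := norm_nonneg ((f : X) - g)
      nlinarith
    gcongr
  obtain ⟨f, -, hf, -⟩ := hcontr.exists_fixedPoint' Metric.isClosed_closedBall.isComplete hmaps
    (x := 0) (by simp; positivity) (edist_ne_top _ _)
  have hfix : ∀ t (ht : t ∈ Set.Icc 0 δ), ext f t = Φ' f t := by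
    intro t ht
    have h1 : ext f t = f ⟨t, ht⟩ := Set.IccExtend_of_mem _ _ ht
    rw [h1]
    exact (congrArg (fun g : X => g ⟨t, ht⟩) hf).symm
  have h0 : ext f 0 = S₀ := by
    rw [hfix 0 ⟨le_rfl, hδ.le⟩]
    simp [Φ', I, heatL2_zero]
  refine ⟨ext f, h0, (hext f).continuousOn, fun t ht => ?_, fun t ht => ?_⟩
  · rw [hfix t ht]
    exact L2st.sub_mem (heatL2_mem_L2st ht.1 hS₀)
      (L2st.smul_mem _ (integral_nonl_mem_L2st ht.1 (hext f).continuousOn))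
  · rw [hfix t ht, h0]

/-- A mild solution that stays bounded on a finite time interval is not maximal. -/
theorem IsMildSolution.not_isMaximalTime {T : EReal} {S : ℝ → L2Mat} (h : IsMildSolution T S)
    (hT : T < ⊤) {M : ℝ} (hM : ∀ t : ℝ, 0 ≤ t → (t : EReal) < T → ‖S t‖ ≤ M) :
    ¬ IsMaximalTime T S := by
  intro hmax
  have hbot : T ≠ ⊥ := (lt_of_le_of_lt bot_le h.pos).ne'
  lift T to ℝ using ⟨hT.ne, hbot⟩
  have hT0 : 0 < T := by exact_mod_cast h.pos
  have hδ := lifespan_pos (M + 1)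
  -- The restart time is within half a lifespan of `T`, so the continued solution reaches beyond
  -- `T`.
  set a := max 0 (T - lifespan (M + 1) / 2) with ha
  have haT : (a : EReal) < T := by
    rw [EReal.coe_lt_coe_iff]
    exact max_lt hT0 (by linarith)
  obtain ⟨R, hR0, hR⟩ := exists_isLocalSolution (h.mem a (le_max_left _ _) haT)
    (hM a (le_max_left _ _) haT)
  have hext := h.extend (le_max_left _ _) haT hδ hR hR0
  have hle := hmax _ _ hext (if_pos (le_max_left _ _))
  rw [EReal.coe_le_coe_iff] at hle
  have := le_max_right 0 (T - lifespan (M + 1) / 2)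
  linarith

/-! ### The Fourier transform of the matrix square. -/

/-- Translation `f ↦ f(· + ξ)` on `L²`. -/
def translateLp (ξ : R3) : Lp CMat3 2 (volume : Measure R3) →ₗᵢ[ℂ] Lp CMat3 2 (volume : Measure R3) :=
  Lp.compMeasurePreservingₗᵢ ℂ (fun η : R3 => η + ξ) (measurePreserving_add_right volume ξ)

theorem coeFn_translateLp (ξ : R3) (f : Lp CMat3 2 (volume : Measure R3)) :
    translateLp ξ f =ᵐ[volume] fun η => f (η + ξ) :=
  Lp.coeFn_compMeasurePreserving f (measurePreserving_add_right volume ξ)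

/-- The character `x ↦ exp(-2πi x·ξ)`. -/
def waveFun (ξ x : R3) : ℂ := (Real.fourierChar (-inner ℝ x ξ) : ℂ)

theorem continuous_waveFun (ξ : R3) : Continuous (waveFun ξ) :=
  continuous_subtype_val.comp (Real.continuous_fourierChar.comp (by fun_prop))

theorem norm_waveFun (ξ x : R3) : ‖waveFun ξ x‖ = 1 := Circle.norm_coe _

theorem waveFun_add (ξ η x : R3) : waveFun (ξ + η) x = waveFun ξ x * waveFun η x := by
  unfold waveFun
  rw [inner_add_right, neg_add, AddChar.map_add_eq_mul, Circle.coe_mul]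

/-- Modulation in space is translation in frequency. -/
theorem fourier_modulate (ξ : R3) (L : CMat3 →L[ℂ] CMat3) (f : Lp CMat3 2 (volume : Measure R3)) :
    𝓕 (multL2 (waveFun ξ) (L.compLp f)) = L.compLp (translateLp ξ (𝓕 f)) := by
  have hFc : Continuous fun f : Lp CMat3 2 (volume : Measure R3) => 𝓕 f :=
    FourierTransform.continuous_fourier
  have hcl : IsClosed {f : Lp CMat3 2 (volume : Measure R3) |
      𝓕 (multL2 (waveFun ξ) (L.compLp f)) = L.compLp (translateLp ξ (𝓕 f))} :=
    isClosed_eq (hFc.comp ((multL2 (waveFun ξ)).continuous.comp (L.compLpL 2 volume).continuous))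
      ((L.compLpL 2 volume).continuous.comp ((translateLp ξ).continuous.comp hFc))
  refine hcl.closure_subset_iff.2
    (?_ : {f : Lp CMat3 2 (volume : Measure R3) | Integrable f volume} ⊆ _) (dense_integrable_Lp f)
  intro g hg
  have hg' : Integrable g volume := hg
  have h1 := coeFn_multL2 (continuous_waveFun ξ).measurable (C := 1)
    (fun x => (norm_waveFun ξ x).le) (L.compLp g)
  have h2 := ContinuousLinearMap.coeFn_compLp L g
  have h3 : multL2 (waveFun ξ) (L.compLp g) =ᵐ[volume] fun x => waveFun ξ x • L (g x) := by
    filter_upwards [h1, h2] with x hx1 hx2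
    rw [hx1, hx2]
  have hLg : Integrable (fun x => L (g x)) volume := L.integrable_comp hg'
  have h4 : Integrable (multL2 (waveFun ξ) (L.compLp g)) volume := by
    refine Integrable.congr ?_ (EventuallyEq.symm h3)
    exact hLg.bdd_smul 1 (continuous_waveFun ξ).aestronglyMeasurable
      (Eventually.of_forall fun x => (norm_waveFun ξ x).le)
  change 𝓕 (multL2 (waveFun ξ) (L.compLp g)) = L.compLp (translateLp ξ (𝓕 g))
  ext1
  filter_upwards [fourier_Lp_ae_eq _ h4, ContinuousLinearMap.coeFn_compLp L (translateLp ξ (𝓕 g)),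
    coeFn_translateLp ξ (𝓕 g), (measurePreserving_add_right volume ξ).quasiMeasurePreserving.ae
      (fourier_Lp_ae_eq g hg')] with η e1 e2 e3 e4
  rw [e1, e2, e3, e4, Real.fourier_congr_ae h3, Real.fourier_eq, Real.fourier_eq,
    ← L.integral_comp_comm ((Real.fourierIntegral_convergent_iff _).2 hg')]
  refine integral_congr_ae (Eventually.of_forall fun x => ?_)
  have e5 := waveFun_add η ξ x
  unfold waveFun at e5 ⊢
  simp only [Circle.smul_def, map_smul, smul_smul]
  rw [e5]

/-- The linear map with `⟪M, rowMap i j M⟫ = (M²)_{ij}` for real `M`. -/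
def rowMap (i j : Fin 3) : CMat3 →L[ℂ] CMat3 :=
  LinearMap.toContinuousLinearMap
    { toFun := fun M => WithLp.toLp 2 fun ab => if ab.1 = i then M (ab.2, j) else 0
      map_add' := fun M N => by ext ab; simp only [PiLp.add_apply]; split_ifs <;> simp
      map_smul' := fun c M => by ext ab; simp }

theorem rowMap_apply (i j : Fin 3) (M : CMat3) (ab : Fin 3 × Fin 3) :
    rowMap i j M ab = if ab.1 = i then M (ab.2, j) else 0 := rfl

theorem inner_rowMap (i j : Fin 3) (M : Mat3) :
    inner ℂ (complexify M) (rowMap i j (complexify M)) = (matSq M (i, j) : ℂ) := by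
  rw [PiLp.inner_apply, matSq_apply, Fintype.sum_prod_type]
  simp [rowMap_apply, mul_comm]

theorem norm_rowMap_le (i j : Fin 3) (M : CMat3) : ‖rowMap i j M‖ ≤ ‖M‖ := by
  rw [EuclideanSpace.norm_eq, EuclideanSpace.norm_eq]
  refine Real.sqrt_le_sqrt ?_
  rw [Fintype.sum_prod_type, Finset.sum_eq_single i]
  · simp only [rowMap_apply, if_true]
    rw [Fintype.sum_prod_type]
    refine Finset.sum_le_sum fun k _ => ?_
    exact Finset.single_le_sum (f := fun l => ‖M (k, l)‖ ^ 2) (fun l _ => by positivity)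
      (Finset.mem_univ j)
  · intro a _ ha
    simp [rowMap_apply, ha]
  · simp

/-- This is the convolution theorem for two L² factors. The left side is the L² inner product of `S`
with a modulated copy of its image under `rowMap`; Plancherel turns the modulation into a
translation, and the formula holds at every frequency. -/
theorem fourier_matSq_apply (S : L2Mat) (ξ : R3) (i j : Fin 3) :
    𝓕 (fun x => complexify (matSq (S x))) ξ (i, j)
      = ∫ η, inner ℂ (fourierL2 S η) (rowMap i j (fourierL2 S (η + ξ))) := by
  set f : Lp CMat3 2 (volume : Measure R3) := complexify.compLp S with hf
  have hfae := ContinuousLinearMap.coeFn_compLp complexify S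
  have h1 : inner ℂ f (multL2 (waveFun ξ) ((rowMap i j).compLp f))
      = 𝓕 (fun x => complexify (matSq (S x))) ξ (i, j) := by
    have e1 : 𝓕 (fun x => complexify (matSq (S x))) ξ (i, j)
        = ∫ x, waveFun ξ x * (matSq (S x) (i, j) : ℂ) := by
      have hp := (EuclideanSpace.proj (i, j) : CMat3 →L[ℂ] ℂ).integral_comp_comm
        ((Real.fourierIntegral_convergent_iff ξ).2 (complexify.integrable_comp (integrable_matSq S)))
      rw [Real.fourier_eq]
      refine Eq.trans hp.symm ?_
      refine integral_congr_ae (Eventually.of_forall fun x => ?_)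
      simp [Circle.smul_def, waveFun]
    rw [e1, L2.inner_def]
    refine integral_congr_ae ?_
    filter_upwards [hfae, coeFn_multL2 (continuous_waveFun ξ).measurable (C := 1)
      (fun x => (norm_waveFun ξ x).le) ((rowMap i j).compLp f),
      ContinuousLinearMap.coeFn_compLp (rowMap i j) f] with x hx1 hx2 hx3
    rw [hx2, hx3, hf, hx1, inner_smul_right, inner_rowMap]
  rw [← h1, ← Lp.inner_fourier_eq, fourier_modulate, L2.inner_def]
  refine integral_congr_ae ?_
  filter_upwards [ContinuousLinearMap.coeFn_compLp (rowMap i j) (translateLp ξ (𝓕 f)),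
    coeFn_translateLp ξ (𝓕 f)] with η h3 h4
  rw [h3, h4]
  rfl

/-! ### Weighted norms and the regularity bootstrap. -/

/-- The weighted norm `‖(1+|ξ|)^s Ŝ‖²_{L²}`. -/
def wNormSq (s : ℝ) (S : L2Mat) : ℝ≥0∞ :=
  ∫⁻ ξ, (ENNReal.ofReal ((1 + ‖ξ‖) ^ s) * ‖fourierL2 S ξ‖ₑ) ^ 2

/-- Peetre's inequality, from 1+|ξ| ≤ (1+|η|)(1+|η+ξ|): it distributes the weight at ξ over the two
factors of the convolution. -/
theorem weight_peetre {s : ℝ} (hs : 0 ≤ s) (ξ η : R3) :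
    (1 + ‖ξ‖) ^ s ≤ (1 + ‖η‖) ^ s * (1 + ‖η + ξ‖) ^ s := by
  rw [← Real.mul_rpow (by positivity) (by positivity)]
  refine Real.rpow_le_rpow (by positivity) ?_ hs
  have h : ‖ξ‖ ≤ ‖η + ξ‖ + ‖η‖ := by
    have := norm_sub_le (η + ξ) η
    rwa [add_sub_cancel_left] at this
  nlinarith [mul_nonneg (norm_nonneg η) (norm_nonneg (η + ξ))]

theorem measurable_weight (s : ℝ) : Measurable fun ξ : R3 => ENNReal.ofReal ((1 + ‖ξ‖) ^ s) := by
  fun_prop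

/-- After the weight is split by `weight_peetre`, Cauchy–Schwarz in η and translation invariance
finish. Thus s derivatives of `S` in L² become pointwise decay of order s for the transform of S².
-/
theorem weight_mul_enorm_fourier_matSq_le {s : ℝ} (hs : 0 ≤ s) (S : L2Mat) (ξ : R3) (i j : Fin 3) :
    ENNReal.ofReal ((1 + ‖ξ‖) ^ s) * ‖𝓕 (fun x => complexify (matSq (S x))) ξ (i, j)‖ₑ
      ≤ wNormSq s S := by
  set a : R3 → ℝ≥0∞ := fun η => ENNReal.ofReal ((1 + ‖η‖) ^ s) * ‖fourierL2 S η‖ₑ with ha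
  have ham : AEMeasurable a volume :=
    (measurable_weight s).aemeasurable.mul (Lp.aestronglyMeasurable _).enorm
  have hmp := measurePreserving_add_right (volume : Measure R3) ξ
  have ham' : AEMeasurable (fun η => a (η + ξ)) volume :=
    ham.comp_quasiMeasurePreserving hmp.quasiMeasurePreserving
  have hW : wNormSq s S = ∫⁻ η, a η ^ 2 := rfl
  have h1 : ENNReal.ofReal ((1 + ‖ξ‖) ^ s) * ‖𝓕 (fun x => complexify (matSq (S x))) ξ (i, j)‖ₑ
      ≤ ∫⁻ η, a η * a (η + ξ) := by
    rw [fourier_matSq_apply]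
    refine (mul_le_mul_right (enorm_integral_le_lintegral_enorm _) _).trans ?_
    rw [← lintegral_const_mul' _ _ (by simp)]
    refine lintegral_mono fun η => ?_
    have h2 : ‖inner ℂ (fourierL2 S η) (rowMap i j (fourierL2 S (η + ξ)))‖ₑ
        ≤ ‖fourierL2 S η‖ₑ * ‖fourierL2 S (η + ξ)‖ₑ := by
      simp only [← ofReal_norm]
      rw [← ENNReal.ofReal_mul (norm_nonneg _)]
      refine ENNReal.ofReal_le_ofReal ((norm_inner_le_norm _ _).trans ?_)
      gcongr
      exact norm_rowMap_le _ _ _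
    calc _ ≤ ENNReal.ofReal ((1 + ‖η‖) ^ s * (1 + ‖η + ξ‖) ^ s)
          * (‖fourierL2 S η‖ₑ * ‖fourierL2 S (η + ξ)‖ₑ) := by
          gcongr
          exact weight_peetre hs ξ η
      _ = a η * a (η + ξ) := by
          rw [ENNReal.ofReal_mul (by positivity)]
          simp only [ha]
          ring
  refine h1.trans ?_
  have h2 := cauchy_schwarz ham ham'
  rw [lintegral_add_right_eq_self (fun η => a η ^ 2) ξ, ← sq] at h2
  exact (ENNReal.pow_le_pow_left_iff two_ne_zero).1 h2

theorem weight_mul_norm_fourier_matSq_le {s K : ℝ} (hs : 0 ≤ s) (hK : 0 ≤ K) {S : L2Mat}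
    (hS : wNormSq s S ≤ ENNReal.ofReal K) (ξ : R3) :
    (1 + ‖ξ‖) ^ s * ‖𝓕 (fun x => complexify (matSq (S x))) ξ‖ ≤ 3 * K := by
  set N := 𝓕 (fun x => complexify (matSq (S x))) ξ with hN
  have hw : 0 < (1 + ‖ξ‖) ^ s := by positivity
  have h1 : ∀ ij, (1 + ‖ξ‖) ^ s * ‖N ij‖ ≤ K := by
    rintro ⟨i, j⟩
    have h := (weight_mul_enorm_fourier_matSq_le hs S ξ i j).trans hS
    rw [← ofReal_norm, ← ENNReal.ofReal_mul hw.le] at h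
    exact (ENNReal.ofReal_le_ofReal_iff hK).1 h
  have h2 : ‖N‖ ≤ 3 * (K / (1 + ‖ξ‖) ^ s) := by
    rw [EuclideanSpace.norm_eq]
    refine Real.sqrt_le_iff.2 ⟨by positivity, ?_⟩
    calc ∑ ij, ‖N ij‖ ^ 2 ≤ ∑ _ij : Fin 3 × Fin 3, (K / (1 + ‖ξ‖) ^ s) ^ 2 := by
          refine Finset.sum_le_sum fun ij _ => pow_le_pow_left₀ (norm_nonneg _) ?_ 2
          rw [le_div_iff₀ hw, mul_comm]
          exact h1 ij
      _ = (3 * (K / (1 + ‖ξ‖) ^ s)) ^ 2 := by simp; ring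
  calc (1 + ‖ξ‖) ^ s * ‖N‖ ≤ (1 + ‖ξ‖) ^ s * (3 * (K / (1 + ‖ξ‖) ^ s)) := by gcongr
    _ = 3 * K := by field_simp

/-- The weight `(1+|ξ|)^s`, truncated at height `n`. -/
def truncWeight (s : ℝ) (n : ℕ) (ξ : R3) : ℝ := min ((1 + ‖ξ‖) ^ s) n

theorem truncWeight_nonneg (s : ℝ) (n : ℕ) (ξ : R3) : 0 ≤ truncWeight s n ξ :=
  le_min (by positivity) (by positivity)

theorem isSymbol_truncWeight (s : ℝ) (n : ℕ) : IsSymbol (truncWeight s n) := by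
  refine ⟨?_, fun ξ => by simp [truncWeight], n, fun ξ => ?_⟩
  · unfold truncWeight
    fun_prop
  · rw [abs_of_nonneg (truncWeight_nonneg _ _ _)]
    exact min_le_right _ _

/-- Symbols of `multiplier` must be bounded, so estimates are made for truncated weights, uniformly
in n; Fatou's lemma removes the truncation. -/
theorem wNormSq_le_of_truncWeight {s K : ℝ} {S : L2Mat}
    (h : ∀ n : ℕ, ‖multiplier (truncWeight s n) S‖ ≤ K) :
    wNormSq s S ≤ ENNReal.ofReal (K ^ 2) := by
  have h1 : ∀ n : ℕ, ∫⁻ ξ, (‖truncWeight s n ξ‖ₑ * ‖fourierL2 S ξ‖ₑ) ^ 2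
      ≤ ENNReal.ofReal (K ^ 2) := by
    intro n
    rw [← enorm_multiplier_sq (isSymbol_truncWeight s n), ← ofReal_norm,
      ← ENNReal.ofReal_pow (norm_nonneg _)]
    exact ENNReal.ofReal_le_ofReal (pow_le_pow_left₀ (norm_nonneg _) (h n) 2)
  have h2 : wNormSq s S
      ≤ ∫⁻ ξ, liminf (fun n : ℕ => (‖truncWeight s n ξ‖ₑ * ‖fourierL2 S ξ‖ₑ) ^ 2) atTop := by
    refine lintegral_mono fun ξ => ?_
    have hev : ∀ᶠ n : ℕ in atTop, (‖truncWeight s n ξ‖ₑ * ‖fourierL2 S ξ‖ₑ) ^ 2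
        = (ENNReal.ofReal ((1 + ‖ξ‖) ^ s) * ‖fourierL2 S ξ‖ₑ) ^ 2 := by
      filter_upwards [eventually_ge_atTop ⌈(1 + ‖ξ‖) ^ s⌉₊] with n hn
      have : truncWeight s n ξ = (1 + ‖ξ‖) ^ s := min_eq_left (Nat.ceil_le.1 hn)
      rw [this, ← ofReal_norm, Real.norm_of_nonneg (by positivity)]
    exact (Tendsto.liminf_eq (tendsto_const_nhds.congr' (hev.mono fun n hn => hn.symm))).ge
  refine h2.trans ((lintegral_liminf_le' fun n => ?_).trans ?_)
  · exact (((isSymbol_truncWeight s n).measurable.enorm.aemeasurable.mul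
      (Lp.aestronglyMeasurable _).enorm).pow_const 2)
  · exact liminf_le_of_le (by isBoundedDefault) fun b hb => by
      obtain ⟨n, hn⟩ := hb.exists
      exact hn.trans (h1 n)

theorem exists_weight_mul_gaussSymbol_le (s : ℝ) {t : ℝ} (ht : 0 < t) :
    ∃ C : ℝ, 0 ≤ C ∧ ∀ ξ : R3, (1 + ‖ξ‖) ^ s * gaussSymbol t ξ ≤ C := by
  set n := ⌈s⌉₊
  refine ⟨n.factorial * Real.exp (1 + 1 / (4 * t)), by positivity, fun ξ => ?_⟩
  set r := ‖ξ‖ with hr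
  have hr0 : 0 ≤ r := norm_nonneg _
  have h1 : (1 + r) ^ s ≤ n.factorial * Real.exp (1 + r) := by
    calc (1 + r) ^ s ≤ (1 + r) ^ (n : ℝ) :=
          Real.rpow_le_rpow_of_exponent_le (by linarith) (Nat.le_ceil s)
      _ = (1 + r) ^ n := Real.rpow_natCast _ _
      _ ≤ n.factorial * Real.exp (1 + r) := by
          have := Real.pow_div_factorial_le_exp (1 + r) (by linarith) n
          rw [div_le_iff₀ (by positivity)] at this
          linarith
  have h2 : r ≤ t * r ^ 2 + 1 / (4 * t) := by
    have : t * r ^ 2 + 1 / (4 * t) - r = (2 * t * r - 1) ^ 2 / (4 * t) := by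
      field_simp
      ring
    have h3 : 0 ≤ (2 * t * r - 1) ^ 2 / (4 * t) := by positivity
    linarith
  have h4 : gaussSymbol t ξ ≤ Real.exp (-(t * r ^ 2)) := by
    unfold gaussSymbol
    apply Real.exp_le_exp.2
    have hpi : 1 ≤ 4 * Real.pi ^ 2 := by nlinarith [Real.pi_gt_three]
    have h5 : 0 ≤ t * r ^ 2 := by positivity
    rw [← hr]
    nlinarith
  calc (1 + r) ^ s * gaussSymbol t ξ
      ≤ n.factorial * Real.exp (1 + r) * Real.exp (-(t * r ^ 2)) :=
        mul_le_mul h1 h4 (gaussSymbol_pos _ _).le (by positivity)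
    _ = n.factorial * Real.exp (1 + r - t * r ^ 2) := by
        rw [mul_assoc, ← Real.exp_add]
        ring_nf
    _ ≤ n.factorial * Real.exp (1 + 1 / (4 * t)) := by
        gcongr
        linarith

/-- One step of the regularity bootstrap: a gain of a quarter of a derivative. -/
theorem IsMildSolution.regularity_step {T : EReal} {S : ℝ → L2Mat} (h : IsMildSolution T S)
    {s a a' b K : ℝ} (hs : 0 ≤ s) (ha : 0 ≤ a) (haa : a < a') (hb : (b : EReal) < T) (hK : 0 ≤ K)
    (hreg : ∀ t ∈ Set.Icc a b, wNormSq s (S t) ≤ ENNReal.ofReal K) :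
    ∃ K', 0 ≤ K' ∧ ∀ t ∈ Set.Icc a' b, wNormSq (s + 1 / 4) (S t) ≤ ENNReal.ofReal K' := by
  -- Duhamel's formula is restarted at t - δ, which stays above `a` for t ≥ a'. The bound δ ≤ 1
  -- keeps the integral in the range of the smoothing estimate.
  set δ := min (a' - a) 1 with hδ
  have hδ0 : 0 < δ := lt_min (by linarith) one_pos
  have hδ1 : δ ≤ 1 := min_le_right _ _
  have hδa : δ ≤ a' - a := min_le_left _ _
  obtain ⟨M, hM⟩ := isCompact_Icc.exists_bound_of_continuousOn (h.continuousOn_Icc hb)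
  obtain ⟨C, hC0, hC⟩ := exists_weight_mul_gaussSymbol_le (s + 1 / 4) hδ0
  set I := ∫ τ in (0 : ℝ)..δ, 2 * √weightConst * (3 * K) * τ ^ (-(9 / 10) : ℝ) with hI
  refine ⟨(C * M + 2 / 3 * I) ^ 2, by positivity, fun t ht => ?_⟩
  refine wNormSq_le_of_truncWeight fun n => ?_
  have htT : (t : EReal) < T := lt_of_le_of_lt (EReal.coe_le_coe_iff.2 ht.2) hb
  have ht0 : 0 ≤ t - δ := by linarith [ht.1]
  have hsym := isSymbol_truncWeight (s + 1 / 4) n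
  have hle : ∀ ξ, |truncWeight (s + 1 / 4) n ξ| ≤ (1 + ‖ξ‖) ^ (s + 1 / 4) := fun ξ => by
    rw [abs_of_nonneg (truncWeight_nonneg _ _ _)]
    exact min_le_left _ _
  have hint : IntervalIntegrable (fun τ => nonl τ (S (t - τ))) volume 0 δ :=
    (intervalIntegrable_nonl (ha.trans (haa.le.trans ht.1)) (h.continuousOn_Icc htT)).mono_set (by
      rw [Set.uIcc_of_le hδ0.le, Set.uIcc_of_le (by linarith)]
      exact Set.Icc_subset_Icc le_rfl (by linarith))
  have hrest := h.restart ht0 (by linarith) htT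
  rw [sub_sub_cancel] at hrest
  rw [hrest, map_sub, map_smul, ← ContinuousLinearMap.intervalIntegral_comp_comm _ hint]
  have h1 : ‖multiplier (truncWeight (s + 1 / 4) n) (heatL2 δ (S (t - δ)))‖ ≤ C * M := by
    have hprod : IsSymbol fun ξ => truncWeight (s + 1 / 4) n ξ * gaussSymbol δ ξ := by
      refine ⟨hsym.measurable.mul (isSymbol_gaussSymbol hδ0.le).measurable, fun ξ => ?_, C, ?_⟩
      · rw [hsym.even, (isSymbol_gaussSymbol hδ0.le).even]
      · intro ξ
        rw [abs_mul, abs_of_pos (gaussSymbol_pos _ _)]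
        refine le_trans ?_ (hC ξ)
        have := (gaussSymbol_pos δ ξ).le
        gcongr
        exact hle ξ
    unfold heatL2
    rw [multiplier_comp hsym (isSymbol_gaussSymbol hδ0.le) hprod]
    refine (norm_multiplier_le hprod (C := C) (fun ξ => ?_) _).trans ?_
    · rw [abs_mul, abs_of_pos (gaussSymbol_pos _ _)]
      refine le_trans ?_ (hC ξ)
      have := (gaussSymbol_pos δ ξ).le
      gcongr
      exact hle ξ
    · gcongr
      exact hM _ ⟨ht0, by linarith [ht.2]⟩
  have h2 : ‖∫ τ in (0 : ℝ)..δ, multiplier (truncWeight (s + 1 / 4) n) (nonl τ (S (t - τ)))‖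
      ≤ I := by
    refine intervalIntegral.norm_integral_le_of_norm_le hδ0.le ?_
      ((intervalIntegral.intervalIntegrable_rpow' (by norm_num)).const_mul _)
    refine Eventually.of_forall fun τ hτ => ?_
    unfold nonl
    rw [multiplier_Pst hsym]
    refine (norm_Pst_le _).trans ?_
    refine norm_multiplier_heat_le hτ.1 (hτ.2.trans hδ1) (integrable_matSq _) (by positivity)
      (fun ξ => ?_) hsym hle
    refine weight_mul_norm_fourier_matSq_le hs hK (hreg _ ⟨?_, ?_⟩) ξ
    · linarith [hτ.2, ht.1]
    · linarith [hτ.1, ht.2]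
  refine (norm_sub_le _ _).trans (add_le_add h1 ?_)
  rw [norm_smul, Real.norm_of_nonneg (by norm_num)]
  gcongr

theorem wNormSq_zero (S : L2Mat) : wNormSq 0 S = ‖S‖ₑ ^ 2 := by
  rw [enorm_sq_fourierL2]
  simp [wNormSq]

/-- Mild solutions are in `H²`, uniformly on compact subintervals of `(0,T)`. -/
theorem IsMildSolution.regularity {T : EReal} {S : ℝ → L2Mat} (h : IsMildSolution T S)
    {b : ℝ} (hb : (b : EReal) < T) {a : ℝ} (ha : 0 < a) :
    ∃ K, 0 ≤ K ∧ ∀ t ∈ Set.Icc a b, wNormSq 2 (S t) ≤ ENNReal.ofReal K := by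
  have key : ∀ (n : ℕ) (a : ℝ), 0 < a →
      ∃ K, 0 ≤ K ∧ ∀ t ∈ Set.Icc a b, wNormSq (n / 4) (S t) ≤ ENNReal.ofReal K := by
    intro n
    induction n with
    | zero =>
      intro a ha
      obtain ⟨M, hM⟩ := isCompact_Icc.exists_bound_of_continuousOn (h.continuousOn_Icc hb)
      refine ⟨M ^ 2, by positivity, fun t ht => ?_⟩
      rw [Nat.cast_zero, zero_div, wNormSq_zero, ← ofReal_norm, ← ENNReal.ofReal_pow (norm_nonneg _)]
      exact ENNReal.ofReal_le_ofReal
        (pow_le_pow_left₀ (norm_nonneg _) (hM t ⟨ha.le.trans ht.1, ht.2⟩) 2)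
    | succ n ih =>
      intro a ha
      obtain ⟨K, hK, hreg⟩ := ih (a / 2) (by positivity)
      obtain ⟨K', hK', hreg'⟩ := h.regularity_step (a' := a) (by positivity) (by positivity)
        (by linarith) hb hK hreg
      refine ⟨K', hK', fun t ht => ?_⟩
      have e : ((n + 1 : ℕ) : ℝ) / 4 = (n : ℝ) / 4 + 1 / 4 := by
        push_cast
        ring
      rw [e]
      exact hreg' t ht
  -- Eight gains of 1/4 make two derivatives, more than the 3/2 needed for bounded functions on ℝ³.
  have := key 8 a ha
  rwa [show ((8 : ℕ) : ℝ) / 4 = 2 by norm_num] at this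

/-! ### Sup bounds and the Sobolev inequality. -/

/-- An `L²` function is bounded by the `L¹` norm of its Fourier transform. -/
theorem enorm_le_lintegral_fourierL2 (S : L2Mat) :
    ∀ᵐ x, ‖S x‖ₑ ≤ ∫⁻ ξ, ‖fourierL2 S ξ‖ₑ := by
  by_cases hfin : ∫⁻ ξ, ‖fourierL2 S ξ‖ₑ = ∞
  · simp [hfin]
  have hint : Integrable (fourierL2 S) volume :=
    ⟨Lp.aestronglyMeasurable _, lt_top_iff_ne_top.2 hfin⟩
  have e : 𝓕⁻ (fourierL2 S) = complexify.compLp S := FourierTransform.fourierInv_fourier_eq _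
  have h := fourierInv_Lp_ae_eq _ hint
  rw [e] at h
  filter_upwards [h, ContinuousLinearMap.coeFn_compLp complexify S] with x h1 h2
  have h3 : ‖S x‖ₑ = ‖complexify.compLp S x‖ₑ := by
    rw [h2, ← ofReal_norm, ← ofReal_norm, norm_complexify]
  rw [h3, h1, Real.fourierInv_eq]
  refine (enorm_integral_le_lintegral_enorm _).trans (lintegral_mono fun ξ => ?_)
  rw [← ofReal_norm, ← ofReal_norm, Circle.norm_smul]

/-- Cauchy–Schwarz with the weight (1+|ξ|)^{-2}, whose square is integrable on ℝ³. With the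
preceding bound it embeds H² into bounded functions. -/
theorem lintegral_fourierL2_sq_le_wNormSq (S : L2Mat) :
    (∫⁻ ξ, ‖fourierL2 S ξ‖ₑ) ^ 2
      ≤ ENNReal.ofReal (∫ ξ : R3, (1 + ‖ξ‖) ^ (-4 : ℝ)) * wNormSq 2 S := by
  have hint : Integrable fun ξ : R3 => (1 + ‖ξ‖) ^ (-4 : ℝ) := by
    apply integrable_one_add_norm
    simp
    norm_num
  have h := cauchy_schwarz (measurable_weight (-2)).aemeasurable
    ((measurable_weight 2).aemeasurable.mul (Lp.aestronglyMeasurable (fourierL2 S)).enorm)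
  have e1 : ∀ ξ : R3, ENNReal.ofReal ((1 + ‖ξ‖) ^ (-2 : ℝ)) * ENNReal.ofReal ((1 + ‖ξ‖) ^ (2 : ℝ))
      = 1 := fun ξ => by
    rw [← ENNReal.ofReal_mul (by positivity), ← Real.rpow_add (by positivity)]
    norm_num
  have e2 : ∀ ξ : R3, ENNReal.ofReal ((1 + ‖ξ‖) ^ (-2 : ℝ)) ^ 2
      = ENNReal.ofReal ((1 + ‖ξ‖) ^ (-4 : ℝ)) := fun ξ => by
    rw [← ENNReal.ofReal_pow (by positivity), ← Real.rpow_natCast _ 2,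
      ← Real.rpow_mul (by positivity)]
    norm_num
  simp only [Pi.mul_apply, ← mul_assoc, e1, one_mul, e2] at h
  rwa [← ofReal_integral_eq_lintegral_ofReal hint
    (Eventually.of_forall fun ξ => by positivity)] at h

/-- The homogeneous quantity `‖ |ξ| Ŝ ‖²_{L²}`. -/
def dirichlet (S : L2Mat) : ℝ≥0∞ := ∫⁻ ξ, (ENNReal.ofReal ‖ξ‖ * ‖fourierL2 S ξ‖ₑ) ^ 2

/-- The constant in `∫_{|ξ|<A} |ξ|⁻² dξ = lowConst * A`. -/
def lowConst : ℝ := 3 * (volume : Measure R3).real (Metric.ball 0 1)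

theorem lowConst_pos : 0 < lowConst := by
  have : 0 < (volume : Measure R3).real (Metric.ball 0 1) :=
    ENNReal.toReal_pos (Metric.measure_ball_pos _ _ one_pos).ne' measure_ball_lt_top.ne
  unfold lowConst
  positivity

/-- In polar coordinates the Jacobian r² cancels |ξ|⁻²; the area of the unit sphere is three times
the volume of the unit ball. -/
theorem lintegral_ball_inv_sq {A : ℝ} (hA : 0 < A) :
    ∫⁻ ξ in Metric.ball (0 : R3) A, ENNReal.ofReal (‖ξ‖⁻¹) ^ 2 = ENNReal.ofReal (lowConst * A) := by
  have e0 : ∀ ξ : R3, ENNReal.ofReal (‖ξ‖⁻¹) ^ 2 = ENNReal.ofReal ((fun r : ℝ => (r⁻¹) ^ 2) ‖ξ‖) :=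
    fun ξ => (ENNReal.ofReal_pow (by positivity) 2).symm
  have hone : ∀ y ∈ Set.Ioo (0 : ℝ) A, y ^ (Module.finrank ℝ R3 - 1) • (fun r : ℝ => (r⁻¹) ^ 2) y = 1 := by
    intro y hy
    have : y ≠ 0 := hy.1.ne'
    simp
    field_simp
  have hint : IntegrableOn (fun ξ : R3 => (fun r : ℝ => (r⁻¹) ^ 2) ‖ξ‖) (Metric.ball 0 A) volume := by
    rw [integrableOn_fun_norm_addHaar volume (f := fun r : ℝ => (r⁻¹) ^ 2)]
    rw [integrableOn_congr_fun hone measurableSet_Ioo]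
    exact integrableOn_const (by simp)
  simp only [e0]
  rw [← ofReal_integral_eq_lintegral_ofReal hint (Eventually.of_forall fun ξ => by positivity)]
  congr 1
  have e1 : ∫ ξ in Metric.ball (0 : R3) A, (fun r : ℝ => (r⁻¹) ^ 2) ‖ξ‖
      = ∫ ξ : R3, (Set.Iio A).indicator (fun r : ℝ => (r⁻¹) ^ 2) ‖ξ‖ := by
    rw [← integral_indicator measurableSet_ball]
    congr 1
    ext ξ
    simp [Set.indicator]
  rw [e1, integral_fun_norm_addHaar]
  have e2 : ∫ y in Set.Ioi (0 : ℝ), y ^ (Module.finrank ℝ R3 - 1)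
      • (Set.Iio A).indicator (fun r : ℝ => (r⁻¹) ^ 2) y
      = ∫ y in Set.Ioi (0 : ℝ), (Set.Iio A).indicator (fun _ => (1 : ℝ)) y := by
    refine setIntegral_congr_fun measurableSet_Ioi fun y hy => ?_
    by_cases h : y < A
    · simp only [Set.indicator_of_mem (show y ∈ Set.Iio A from h)]
      exact hone y ⟨hy, h⟩
    · simp only [Set.indicator_of_notMem (show y ∉ Set.Iio A from h), smul_zero]
  rw [e2, setIntegral_indicator measurableSet_Iio, Set.Ioi_inter_Iio]
  simp [lowConst, hA.le]
  ring

/-- The symbol of the projection onto frequencies `|ξ| < A`. -/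
def lowSymbol (A : ℝ) : R3 → ℝ := (Metric.ball (0 : R3) A).indicator fun _ => 1

theorem isSymbol_lowSymbol (A : ℝ) : IsSymbol (lowSymbol A) := by
  refine ⟨measurable_const.indicator measurableSet_ball, fun ξ => ?_, 1, fun ξ => ?_⟩
  · simp [lowSymbol, Set.indicator]
  · unfold lowSymbol Set.indicator
    split_ifs <;> simp

/-- Cauchy–Schwarz for the product of |ξ|⁻¹ and |ξ||Ŝ| over the ball of radius `A`. -/
theorem enorm_low_sq_le {A : ℝ} (hA : 0 < A) (S : L2Mat) :
    ∀ᵐ x, ‖multiplier (lowSymbol A) S x‖ₑ ^ 2 ≤ ENNReal.ofReal (lowConst * A) * dirichlet S := by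
  have h1 : (∫⁻ ξ, ‖fourierL2 (multiplier (lowSymbol A) S) ξ‖ₑ) ^ 2
      ≤ ENNReal.ofReal (lowConst * A) * dirichlet S := by
    have hm : AEMeasurable (fun ξ : R3 => (Metric.ball (0 : R3) A).indicator
        (fun ξ => ENNReal.ofReal (‖ξ‖⁻¹)) ξ) volume := by
      refine (Measurable.indicator ?_ measurableSet_ball).aemeasurable
      fun_prop
    have hm2 : AEMeasurable (fun ξ : R3 => ENNReal.ofReal ‖ξ‖ * ‖fourierL2 S ξ‖ₑ) volume :=
      (by fun_prop : Measurable fun ξ : R3 => ENNReal.ofReal ‖ξ‖).aemeasurable.mul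
        (Lp.aestronglyMeasurable _).enorm
    have h := cauchy_schwarz hm hm2
    have e1 : ∫⁻ ξ, ‖fourierL2 (multiplier (lowSymbol A) S) ξ‖ₑ
        = ∫⁻ ξ, (Metric.ball (0 : R3) A).indicator (fun ξ => ENNReal.ofReal (‖ξ‖⁻¹)) ξ
          * (ENNReal.ofReal ‖ξ‖ * ‖fourierL2 S ξ‖ₑ) := by
      refine lintegral_congr_ae ?_
      have hne : ∀ᵐ ξ : R3, ξ ≠ 0 := by simp [ae_iff]
      filter_upwards [fourierL2_multiplier (isSymbol_lowSymbol A) S, hne] with ξ h2 h3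
      rw [h2]
      by_cases h4 : ξ ∈ Metric.ball (0 : R3) A
      · simp only [lowSymbol, Set.indicator_of_mem h4]
        rw [← mul_assoc, ← ENNReal.ofReal_mul (by positivity),
          inv_mul_cancel₀ (norm_ne_zero_iff.2 h3)]
        simp
      · simp only [lowSymbol, Set.indicator_of_notMem h4]
        simp
    have e2 : ∫⁻ ξ, ((Metric.ball (0 : R3) A).indicator (fun ξ => ENNReal.ofReal (‖ξ‖⁻¹)) ξ) ^ 2
        = ENNReal.ofReal (lowConst * A) := by
      rw [← lintegral_ball_inv_sq hA, ← lintegral_indicator measurableSet_ball]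
      refine lintegral_congr fun ξ => ?_
      by_cases h4 : ξ ∈ Metric.ball (0 : R3) A
      · simp only [Set.indicator_of_mem h4]
      · simp only [Set.indicator_of_notMem h4]
        simp
    rw [e1]
    rw [e2] at h
    exact h
  filter_upwards [enorm_le_lintegral_fourierL2 (multiplier (lowSymbol A) S)] with x hx
  exact (pow_le_pow_left' hx 2).trans h1

theorem enorm_high_sq (A : ℝ) (S : L2Mat) :
    ‖S - multiplier (lowSymbol A) S‖ₑ ^ 2
      = ∫⁻ ξ, (Metric.ball (0 : R3) A)ᶜ.indicator (fun ξ => ‖fourierL2 S ξ‖ₑ ^ 2) ξ := by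
  rw [enorm_sq_fourierL2]
  have e : fourierL2 (S - multiplier (lowSymbol A) S)
      = fourierL2 S - fourierL2 (multiplier (lowSymbol A) S) := map_sub fourierL2L _ _
  rw [e]
  refine lintegral_congr_ae ?_
  filter_upwards [Lp.coeFn_sub (fourierL2 S) (fourierL2 (multiplier (lowSymbol A) S)),
    fourierL2_multiplier (isSymbol_lowSymbol A) S] with ξ h1 h2
  rw [h1, Pi.sub_apply, h2]
  by_cases h4 : ξ ∈ Metric.ball (0 : R3) A
  · rw [Set.indicator_of_notMem (by simpa using h4)]
    simp [lowSymbol, Set.indicator_of_mem h4]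
  · rw [Set.indicator_of_mem (by simpa using h4)]
    simp [lowSymbol, Set.indicator_of_notMem h4]

/-- The frequency cut-off depends on the level: it is chosen so that the low part is at most t/2 in
sup norm. Then |S| > t forces the high part to be at least t/2, and Chebyshev's inequality applies.
-/
theorem meas_norm_gt_le {S : L2Mat} {D : ℝ} (hD : 0 < D) (hS : dirichlet S ≤ ENNReal.ofReal D)
    {t : ℝ} (ht : 0 < t) :
    volume {x | t < ‖S x‖} ≤ ENNReal.ofReal (4 / t ^ 2) *
      ∫⁻ ξ, (Metric.ball (0 : R3) (t ^ 2 / (4 * lowConst * D)))ᶜ.indicator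
        (fun ξ => ‖fourierL2 S ξ‖ₑ ^ 2) ξ := by
  have hc := lowConst_pos
  set A := t ^ 2 / (4 * lowConst * D) with hA
  have hA0 : 0 < A := by positivity
  set H := S - multiplier (lowSymbol A) S with hH
  have h1 : volume {x | t < ‖S x‖} ≤ volume {x | ENNReal.ofReal (t ^ 2 / 4) ≤ ‖H x‖ₑ ^ 2} := by
    refine measure_mono_ae ?_
    filter_upwards [enorm_low_sq_le hA0 S, Lp.coeFn_sub S (multiplier (lowSymbol A) S)] with x h2 h3
    intro hx
    have hx : t < ‖S x‖ := hx
    change ENNReal.ofReal (t ^ 2 / 4) ≤ ‖H x‖ₑ ^ 2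
    have h4 : ‖multiplier (lowSymbol A) S x‖ ≤ t / 2 := by
      have h5 : ‖multiplier (lowSymbol A) S x‖ₑ ^ 2 ≤ ENNReal.ofReal ((t / 2) ^ 2) := by
        refine (h2.trans (mul_le_mul_right hS _)).trans ?_
        rw [← ENNReal.ofReal_mul (by positivity)]
        refine ENNReal.ofReal_le_ofReal (le_of_eq ?_)
        rw [hA]
        field_simp
        ring
      rw [← ofReal_norm, ← ENNReal.ofReal_pow (norm_nonneg _),
        ENNReal.ofReal_le_ofReal_iff (by positivity)] at h5
      exact (sq_le_sq₀ (norm_nonneg _) (by positivity)).1 h5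
    have h6 : t / 2 ≤ ‖H x‖ := by
      rw [hH, h3, Pi.sub_apply]
      have := norm_sub_norm_le (S x) (multiplier (lowSymbol A) S x)
      linarith
    rw [← ofReal_norm, ← ENNReal.ofReal_pow (norm_nonneg _)]
    refine ENNReal.ofReal_le_ofReal ?_
    nlinarith
  refine h1.trans ?_
  have h7 := meas_ge_le_lintegral_div (μ := (volume : Measure R3)) (f := fun x => ‖H x‖ₑ ^ 2)
    ((Lp.aestronglyMeasurable H).enorm.pow_const 2) (ε := ENNReal.ofReal (t ^ 2 / 4))
    (ENNReal.ofReal_pos.2 (by positivity)).ne' (by simp)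
  refine h7.trans (le_of_eq ?_)
  rw [← enorm_sq_eq_lintegral, hH, enorm_high_sq, ENNReal.div_eq_inv_mul,
    ← ENNReal.ofReal_inv_of_pos (by positivity), inv_div]

theorem eq_zero_of_dirichlet_eq_zero {S : L2Mat} (h : dirichlet S = 0) : S = 0 := by
  have hm2 : AEMeasurable (fun ξ : R3 => (ENNReal.ofReal ‖ξ‖ * ‖fourierL2 S ξ‖ₑ) ^ 2) volume :=
    ((by fun_prop : Measurable fun ξ : R3 => ENNReal.ofReal ‖ξ‖).aemeasurable.mul
      (Lp.aestronglyMeasurable _).enorm).pow_const 2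
  have h1 := (lintegral_eq_zero_iff' hm2).1 h
  have hne : ∀ᵐ ξ : R3, ξ ≠ 0 := by simp [ae_iff]
  have h2 : ‖S‖ₑ ^ 2 = 0 := by
    rw [enorm_sq_fourierL2]
    refine lintegral_eq_zero_of_ae_eq_zero ?_
    filter_upwards [h1, hne] with ξ h3 h4
    simpa [h4] using h3
  simpa using h2

/-- The Sobolev inequality `‖S‖_{L⁶} ≤ C ‖∇S‖_{L²}`. -/
theorem sobolev : ∃ C : ℝ, 0 < C ∧ ∀ S : L2Mat,
    ∫⁻ x, ‖S x‖ₑ ^ 6 ≤ ENNReal.ofReal C * dirichlet S ^ 3 := by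
  have hc := lowConst_pos
  refine ⟨24 * (4 * lowConst) ^ 2, by positivity, fun S => ?_⟩
  -- The cut-off frequency has the Dirichlet integral in its denominator, so the values 0 and ∞ are
  -- treated apart.
  rcases eq_or_ne (dirichlet S) 0 with h0 | h0
  · rw [eq_zero_of_dirichlet_eq_zero h0]
    have : ∫⁻ x, ‖(0 : L2Mat) x‖ₑ ^ 6 = 0 := by
      refine lintegral_eq_zero_of_ae_eq_zero ?_
      filter_upwards [Lp.coeFn_zero Mat3 2 (volume : Measure R3)] with x hx
      rw [hx]
      simp
    rw [this]
    exact zero_le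
  rcases eq_or_ne (dirichlet S) ∞ with htop | htop
  · rw [htop, ENNReal.top_pow (by norm_num), ENNReal.mul_top (by simp; positivity)]
    exact le_top
  set D := (dirichlet S).toReal with hD
  have hD0 : 0 < D := ENNReal.toReal_pos h0 htop
  have hSD : dirichlet S = ENNReal.ofReal D := (ENNReal.ofReal_toReal htop).symm
  set g : R3 → ℝ≥0∞ := fun ξ => ‖fourierL2 S ξ‖ₑ ^ 2 with hg
  have hgm : Measurable g := (Lp.stronglyMeasurable (fourierL2 S)).measurable.enorm.pow_const 2
  have hlayer := lintegral_rpow_eq_lintegral_meas_lt_mul (volume : Measure R3)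
    (f := fun x => ‖S x‖) (Eventually.of_forall fun x => norm_nonneg _)
    (Lp.aestronglyMeasurable S).norm.aemeasurable (p := 6) (by norm_num)
  have e6 : ∫⁻ x, ‖S x‖ₑ ^ 6 = ∫⁻ x, ENNReal.ofReal (‖S x‖ ^ (6 : ℝ)) := by
    refine lintegral_congr fun x => ?_
    rw [← ofReal_norm, ← ENNReal.ofReal_pow (norm_nonneg _), ← Real.rpow_natCast]
    norm_num
  rw [e6, hlayer]
  set κ := 4 * lowConst * D with hκ
  have hκ0 : 0 < κ := by positivity
  -- In the layer-cake integral a frequency ξ contributes only at levels t ≤ √(κ|ξ|). After the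
  -- integrals are exchanged, 4t³ over this range is bounded by its maximum times the length,
  -- 4κ²|ξ|², which reproduces the Dirichlet integral.
  set G : ℝ → R3 → ℝ≥0∞ := fun t ξ => (Set.Ioc 0 √(κ * ‖ξ‖)).indicator
    (fun t => ENNReal.ofReal (4 * t ^ 3)) t * g ξ with hG
  have hstep : ∀ t ∈ Set.Ioi (0 : ℝ), volume {x | t < ‖S x‖} * ENNReal.ofReal (t ^ ((6 : ℝ) - 1))
      ≤ ∫⁻ ξ, G t ξ := by
    intro t ht
    have ht0 : 0 < t := ht
    refine (mul_le_mul_left (meas_norm_gt_le hD0 hSD.le ht0) _).trans ?_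
    rw [mul_comm, ← mul_assoc, ← lintegral_const_mul' _ _ (ENNReal.mul_ne_top (by simp) (by simp))]
    refine lintegral_mono fun ξ => ?_
    by_cases h : ξ ∈ Metric.ball (0 : R3) (t ^ 2 / (4 * lowConst * D))
    · rw [Set.indicator_of_notMem (by simpa using h), mul_zero]
      exact zero_le
    · rw [Set.indicator_of_mem (by simpa using h)]
      have h2 : t ^ 2 / κ ≤ ‖ξ‖ := by simpa using h
      have h3 : t ≤ √(κ * ‖ξ‖) := by
        refine Real.le_sqrt_of_sq_le ?_
        rw [div_le_iff₀ hκ0] at h2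
        linarith
      simp only [hG, Set.indicator_of_mem (show t ∈ Set.Ioc 0 √(κ * ‖ξ‖) from ⟨ht0, h3⟩)]
      refine le_of_eq ?_
      rw [← ENNReal.ofReal_mul (by positivity)]
      congr 2
      rw [show (6 : ℝ) - 1 = ((5 : ℕ) : ℝ) by norm_num, Real.rpow_natCast]
      field_simp
  have hGm : AEMeasurable (Function.uncurry G) ((volume.restrict (Set.Ioi 0)).prod volume) := by
    have hset : MeasurableSet {p : ℝ × R3 | p.1 ∈ Set.Ioc 0 √(κ * ‖p.2‖)} := by
      have m1 : Measurable fun p : ℝ × R3 => p.1 := measurable_fst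
      have m2 : Measurable fun p : ℝ × R3 => √(κ * ‖p.2‖) := by fun_prop
      exact (measurableSet_lt measurable_const m1).inter (measurableSet_le m1 m2)
    have m3 : Measurable fun p : ℝ × R3 => ENNReal.ofReal (4 * p.1 ^ 3) := by fun_prop
    exact ((m3.indicator hset).mul (hgm.comp measurable_snd)).aemeasurable
  calc ENNReal.ofReal 6 * ∫⁻ t in Set.Ioi 0, volume {x | t < ‖S x‖} * ENNReal.ofReal (t ^ ((6 : ℝ) - 1))
      ≤ ENNReal.ofReal 6 * ∫⁻ t in Set.Ioi 0, ∫⁻ ξ, G t ξ := by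
        exact mul_le_mul_right (setLIntegral_mono' measurableSet_Ioi hstep) _
    _ = ENNReal.ofReal 6 * ∫⁻ ξ, ∫⁻ t in Set.Ioi 0, G t ξ := by
        rw [lintegral_lintegral_swap hGm]
    _ ≤ ENNReal.ofReal 6 * ∫⁻ ξ, ENNReal.ofReal (4 * κ ^ 2)
          * (ENNReal.ofReal ‖ξ‖ * ‖fourierL2 S ξ‖ₑ) ^ 2 := by
        gcongr with ξ
        have hsub : ∫⁻ t in Set.Ioi 0, G t ξ
            ≤ (∫⁻ t in Set.Ioc 0 √(κ * ‖ξ‖), ENNReal.ofReal (4 * √(κ * ‖ξ‖) ^ 3)) * g ξ := by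
          simp only [hG]
          rw [lintegral_mul_const' _ _ (by simp [hg])]
          refine mul_le_mul_left ?_ _
          refine (setLIntegral_le_lintegral _ _).trans ?_
          rw [lintegral_indicator measurableSet_Ioc]
          refine setLIntegral_mono' measurableSet_Ioc fun t ht => ?_
          refine ENNReal.ofReal_le_ofReal ?_
          have := ht.1.le
          have := ht.2
          gcongr
        refine hsub.trans (le_of_eq ?_)
        rw [setLIntegral_const, Real.volume_Ioc, sub_zero, ← ENNReal.ofReal_mul (by positivity),
          mul_pow (ENNReal.ofReal ‖ξ‖), ← mul_assoc, ← ENNReal.ofReal_pow (norm_nonneg _),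
          ← ENNReal.ofReal_mul (by positivity)]
        congr 2
        have h4 : √(κ * ‖ξ‖) ^ 4 = (κ * ‖ξ‖) ^ 2 := by
          rw [show (4 : ℕ) = 2 * 2 by norm_num, pow_mul, Real.sq_sqrt (by positivity)]
        linear_combination 4 * h4
    _ = ENNReal.ofReal 6 * (ENNReal.ofReal (4 * κ ^ 2) * dirichlet S) := by
        rw [lintegral_const_mul' _ _ ENNReal.ofReal_ne_top]
        rfl
    _ = ENNReal.ofReal (24 * (4 * lowConst) ^ 2) * dirichlet S ^ 3 := by
        rw [hSD, ← ENNReal.ofReal_mul (by positivity), ← ENNReal.ofReal_mul (by norm_num),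
          ← ENNReal.ofReal_pow hD0.le, ← ENNReal.ofReal_mul (by positivity)]
        congr 1
        rw [hκ]
        ring

/-! ### Pointwise algebra of strain matrices. -/

/-- A constant linear map of the values commutes with the Fourier transform; this is
`fourier_modulate` at frequency zero. -/
theorem ae_clm_complexify_eq_zero (L : CMat3 →L[ℂ] CMat3) {S : L2Mat}
    (h : ∀ᵐ ξ : R3, L (fourierL2 S ξ) = 0) : ∀ᵐ x : R3, L (complexify (S x)) = 0 := by
  have h1 := fourier_modulate 0 L (complexify.compLp S)
  have hw : waveFun 0 = fun _ => 1 := by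
    ext x
    simp [waveFun]
  have h2 : L.compLp (translateLp 0 (𝓕 (complexify.compLp S))) = 0 := by
    ext1
    filter_upwards [ContinuousLinearMap.coeFn_compLp L (translateLp 0 (fourierL2 S)),
      coeFn_translateLp 0 (fourierL2 S), h, Lp.coeFn_zero CMat3 2 (volume : Measure R3)]
      with ξ e1 e2 e3 e4
    rw [e4]
    refine e1.trans ?_
    rw [e2, add_zero, e3, Pi.zero_apply]
  rw [h2] at h1
  have h3 : multL2 (waveFun 0) (L.compLp (complexify.compLp S)) = 0 := by
    rw [← norm_eq_zero, ← Lp.norm_fourier_eq, h1, norm_zero]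
  have h4 := coeFn_multL2 (continuous_waveFun 0).measurable (C := 1)
    (fun x => (norm_waveFun 0 x).le) (L.compLp (complexify.compLp S))
  rw [h3] at h4
  filter_upwards [h4, ContinuousLinearMap.coeFn_compLp L (complexify.compLp S),
    ContinuousLinearMap.coeFn_compLp complexify S, Lp.coeFn_zero CMat3 2 (volume : Measure R3)]
    with x e1 e2 e3 e4
  rw [e4, hw, e2, e3] at e1
  simpa using e1.symm

/-- The antisymmetric part (times two) of a matrix. -/
def antisymMap : CMat3 →L[ℂ] CMat3 :=
  LinearMap.toContinuousLinearMap
    { toFun := fun M => WithLp.toLp 2 fun ab => M (ab.1, ab.2) - M (ab.2, ab.1)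
      map_add' := fun M N => by ext ab; simp; ring
      map_smul' := fun c M => by ext ab; simp; ring }

theorem antisymMap_apply (M : CMat3) (ab : Fin 3 × Fin 3) :
    antisymMap M ab = M (ab.1, ab.2) - M (ab.2, ab.1) := rfl

/-- The matrix all of whose entries are the trace. -/
def traceMap : CMat3 →L[ℂ] CMat3 :=
  LinearMap.toContinuousLinearMap
    { toFun := fun M => WithLp.toLp 2 fun _ => ∑ i, M (i, i)
      map_add' := fun M N => by ext ab; simp [Finset.sum_add_distrib]
      map_smul' := fun c M => by ext ab; simp [Finset.mul_sum] }

theorem traceMap_apply (M : CMat3) (ab : Fin 3 × Fin 3) : traceMap M ab = ∑ i, M (i, i) := rfl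

/-- Strain matrices are symmetric and trace free. -/
theorem ae_symm_trace_of_mem_L2st {S : L2Mat} (hS : S ∈ L2st) :
    ∀ᵐ x : R3, (∀ i j, S x (i, j) = S x (j, i)) ∧ ∑ i, S x (i, i) = 0 := by
  have hne : ∀ᵐ ξ : R3, ξ ≠ 0 := by simp [ae_iff]
  have hsymb := strainSymbol_of_mem hS
  have hn : ∀ ξ : R3, ξ ≠ 0 → (((‖ξ‖ ^ 2 : ℝ)) : ℂ) ≠ 0 := fun ξ h => by
    exact_mod_cast (pow_pos (norm_pos_iff.2 h) 2).ne'
  have h1 := ae_clm_complexify_eq_zero antisymMap (S := S) (by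
    filter_upwards [hsymb, hne] with ξ h h0
    ext ab
    rw [antisymMap_apply, PiLp.zero_apply, sub_eq_zero]
    refine mul_left_cancel₀ (hn ξ h0) ?_
    rw [h.2.2, h.2.2, add_comm])
  have h2 := ae_clm_complexify_eq_zero traceMap (S := S) (by
    filter_upwards [hsymb, hne] with ξ h h0
    ext ab
    rw [traceMap_apply, PiLp.zero_apply]
    -- The third equation of `StrainSymbol`, summed over the diagonal, gives |ξ|² tr Ŝ = 2 ξ·Ŝξ,
    -- which vanishes by the second.
    refine mul_left_cancel₀ (hn ξ h0) ?_
    rw [Finset.mul_sum, mul_zero]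
    simp only [h.2.2, Finset.sum_add_distrib, h.2.1, add_zero])
  filter_upwards [h1, h2] with x e1 e2
  refine ⟨fun i j => ?_, ?_⟩
  · have := congrArg (fun M : CMat3 => M (i, j)) e1
    simp only [antisymMap_apply, complexify_apply, PiLp.zero_apply, sub_eq_zero] at this
    exact_mod_cast this
  · have := congrArg (fun M : CMat3 => M (0, 0)) e2
    simp only [traceMap_apply, complexify_apply, PiLp.zero_apply] at this
    exact_mod_cast this

theorem abs_inner_matSq_le (M : Mat3) : |inner ℝ M (matSq M)| ≤ 9 * ‖M‖ ^ 3 := by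
  refine (abs_real_inner_le_norm _ _).trans ?_
  have := mul_le_mul_of_nonneg_left (norm_matSq_le M) (norm_nonneg M)
  linarith

open Classical in
/-- The invariants of a symmetric matrix in terms of its ordered eigenvalues. -/
theorem exists_eigenvalues {M : Mat3} (hsym : ∀ i j, M (i, j) = M (j, i))
    (htr : ∑ i, M (i, i) = 0) :
    ∃ a c : ℝ, midEigenvalue M ≤ a ∧ c ≤ midEigenvalue M ∧ a + midEigenvalue M + c = 0 ∧
      ‖M‖ ^ 2 = a ^ 2 + midEigenvalue M ^ 2 + c ^ 2 ∧
      inner ℝ M (matSq M) = a ^ 3 + midEigenvalue M ^ 3 + c ^ 3 := by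
  have hH : (Mat3.toMatrix M).IsHermitian := by
    ext i j
    simp [Mat3.toMatrix, hsym i j]
  set A := Mat3.toMatrix M with hA
  have hmid : midEigenvalue M = hH.eigenvalues₀ ⟨1, by simp⟩ := dif_pos hH
  have hsum : ∀ f : ℝ → ℝ, ∑ i, f (hH.eigenvalues i) = f (hH.eigenvalues₀ ⟨0, by simp⟩)
      + f (hH.eigenvalues₀ ⟨1, by simp⟩) + f (hH.eigenvalues₀ ⟨2, by simp⟩) := by
    intro f
    have e1 : ∑ i, f (hH.eigenvalues i) = ∑ k : Fin (Fintype.card (Fin 3)), f (hH.eigenvalues₀ k) :=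
      Fintype.sum_equiv (Fintype.equivOfCardEq (Fintype.card_fin _)).symm _ _ fun i => rfl
    have e2 : ∑ k : Fin (Fintype.card (Fin 3)), f (hH.eigenvalues₀ k)
        = ∑ k : Fin 3, f (hH.eigenvalues₀ (finCongr (Fintype.card_fin 3).symm k)) :=
      (Fintype.sum_equiv (finCongr (Fintype.card_fin 3).symm) _ _ fun i => rfl).symm
    rw [e1, e2, Fin.sum_univ_three]
    rfl
  -- All three invariants are traces of powers of `A`, which diagonalisation turns into power sums
  -- of eigenvalues.
  have hpow : ∀ n : ℕ, (A ^ n).trace = ∑ i, hH.eigenvalues i ^ n := by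
    intro n
    rw [congrArg (fun B => (B ^ n).trace) hH.spectral_theorem, ← map_pow, Matrix.diagonal_pow]
    simp [Unitary.conjStarAlgAut_apply, Matrix.trace_mul_cycle, Matrix.trace_diagonal]
  refine ⟨hH.eigenvalues₀ ⟨0, by simp⟩, hH.eigenvalues₀ ⟨2, by simp⟩, ?_, ?_, ?_, ?_, ?_⟩
  · rw [hmid]
    exact hH.eigenvalues₀_antitone (by simp)
  · rw [hmid]
    exact hH.eigenvalues₀_antitone (by simp [Fin.le_def])
  · have h1 := hpow 1
    rw [hsum fun x => x ^ 1] at h1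
    simp only [pow_one] at h1
    rw [hmid, ← h1, ← htr]
    rfl
  · rw [hmid, ← hsum fun x => x ^ 2, ← hpow 2, EuclideanSpace.real_norm_sq_eq,
      Fintype.sum_prod_type, sq A, Matrix.trace]
    refine Finset.sum_congr rfl fun i _ => ?_
    rw [Matrix.diag_apply, Matrix.mul_apply]
    refine Finset.sum_congr rfl fun j _ => ?_
    simp only [hA, Mat3.toMatrix, Matrix.of_apply]
    rw [hsym j i, sq]
  · rw [hmid, ← hsum fun x => x ^ 3, ← hpow 3, PiLp.inner_apply, Fintype.sum_prod_type, pow_succ' A,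
      Matrix.trace]
    refine Finset.sum_congr rfl fun i _ => ?_
    rw [Matrix.diag_apply, Matrix.mul_apply]
    refine Finset.sum_congr rfl fun j _ => ?_
    have e : matSq M (i, j) = (A ^ 2) j i := by
      rw [sq, matSq_apply, Matrix.mul_apply]
      refine Finset.sum_congr rfl fun k _ => ?_
      simp only [hA, Mat3.toMatrix, Matrix.of_apply]
      rw [hsym i k, hsym k j, mul_comm]
    rw [e]
    simp [hA, Mat3.toMatrix, mul_comm]

/-- For eigenvalues a ≥ b ≥ c with sum zero the left side is -4abc = 4ab(a+b). It is nonpositive if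
b ≤ 0; if b ≥ 0, the right side exceeds it by exactly 4b³. -/
theorem neg_inner_matSq_le {M : Mat3} (hsym : ∀ i j, M (i, j) = M (j, i))
    (htr : ∑ i, M (i, i) = 0) :
    -(4 / 3) * inner ℝ M (matSq M) ≤ 2 * midEigenvaluePos M * ‖M‖ ^ 2 := by
  obtain ⟨a, c, hba, hcb, h0, hn, hi⟩ := exists_eigenvalues hsym htr
  rw [hn, hi]
  unfold midEigenvaluePos
  set b := midEigenvalue M
  have hc : c = -(a + b) := by linarith
  subst hc
  rcases le_total b 0 with hb | hb
  · rw [max_eq_left hb]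
    have ha : 0 ≤ a := by linarith
    have hab : 0 ≤ a + b := by linarith
    have := mul_nonneg (mul_nonneg ha hab) (neg_nonneg.2 hb)
    nlinarith
  · rw [max_eq_right hb]
    have := pow_nonneg hb 3
    nlinarith

/-! ### The energy identity. -/

theorem dirichlet_le_wNormSq (S : L2Mat) : dirichlet S ≤ wNormSq 2 S := by
  refine lintegral_mono fun ξ => ?_
  have h : ‖ξ‖ ≤ (1 + ‖ξ‖) ^ (2 : ℝ) := by
    rw [show (2 : ℝ) = ((2 : ℕ) : ℝ) by norm_num, Real.rpow_natCast]
    nlinarith [norm_nonneg ξ]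
  dsimp only
  gcongr

theorem exists_ae_norm_le_of_wNormSq {K : ℝ} (hK : 0 ≤ K) :
    ∃ M : ℝ, 0 ≤ M ∧ ∀ S : L2Mat, wNormSq 2 S ≤ ENNReal.ofReal K → ∀ᵐ x, ‖S x‖ ≤ M := by
  refine ⟨√((∫ ξ : R3, (1 + ‖ξ‖) ^ (-4 : ℝ)) * K), by positivity, fun S hS => ?_⟩
  filter_upwards [enorm_le_lintegral_fourierL2 S] with x hx
  have hI : 0 ≤ ∫ ξ : R3, (1 + ‖ξ‖) ^ (-4 : ℝ) := integral_nonneg fun ξ => by positivity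
  have h1 : ‖S x‖ₑ ^ 2 ≤ ENNReal.ofReal ((∫ ξ : R3, (1 + ‖ξ‖) ^ (-4 : ℝ)) * K) := by
    refine (pow_le_pow_left' hx 2).trans ((lintegral_fourierL2_sq_le_wNormSq S).trans ?_)
    rw [ENNReal.ofReal_mul hI]
    gcongr
  refine Real.le_sqrt_of_sq_le ?_
  rw [← ofReal_norm, ← ENNReal.ofReal_pow (norm_nonneg _)] at h1
  exact (ENNReal.ofReal_le_ofReal_iff (mul_nonneg hI hK)).1 h1

open Classical in
/-- `S²` as an element of `L²`, for bounded `S`. -/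
def sqL2 (S : L2Mat) : L2Mat :=
  if h : MemLp (fun x => matSq (S x)) 2 volume then h.toLp _ else 0

theorem memLp_two_matSq {S : L2Mat} {M : ℝ} (hS : ∀ᵐ x, ‖S x‖ ≤ M) :
    MemLp (fun x => matSq (S x)) 2 volume := by
  refine MemLp.of_le_mul (c := 9 * M) (Lp.memLp S)
    (continuous_matSq.comp_aestronglyMeasurable (Lp.memLp S).1) ?_
  filter_upwards [hS] with x hx
  have := norm_matSq_le (S x)
  nlinarith [norm_nonneg (S x)]

theorem coeFn_sqL2 {S : L2Mat} {M : ℝ} (hS : ∀ᵐ x, ‖S x‖ ≤ M) :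
    sqL2 S =ᵐ[volume] fun x => matSq (S x) := by
  unfold sqL2
  rw [dif_pos (memLp_two_matSq hS)]
  exact MemLp.coeFn_toLp _

theorem norm_sqL2_sub_le {S U : L2Mat} {M : ℝ} (hS : ∀ᵐ x, ‖S x‖ ≤ M) (hU : ∀ᵐ x, ‖U x‖ ≤ M) :
    ‖sqL2 S - sqL2 U‖ ≤ 18 * M * ‖S - U‖ := by
  refine Lp.norm_le_mul_norm_of_ae_le_mul ?_
  filter_upwards [Lp.coeFn_sub (sqL2 S) (sqL2 U), Lp.coeFn_sub S U, coeFn_sqL2 hS, coeFn_sqL2 hU,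
    hS, hU] with x e1 e2 e3 e4 h1 h2
  rw [e1, e2, Pi.sub_apply, Pi.sub_apply, e3, e4]
  refine (norm_matSq_sub_le _ _).trans ?_
  nlinarith [norm_nonneg (S x - U x)]

/-- For bounded `S` the square is in L², so the term has no singularity as τ → 0 and the heat flow
acts last. -/
theorem nonl_eq_heatL2 {τ : ℝ} (hτ : 0 < τ) {S : L2Mat} {M : ℝ} (hS : ∀ᵐ x, ‖S x‖ ≤ M) :
    nonl τ S = heatL2 τ (Pst (sqL2 S)) := by
  unfold nonl
  rw [heatL2_Pst hτ.le, ← heat_congr (coeFn_sqL2 hS), heat_eq_multiplier hτ]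
  rfl

/-- The Duhamel integral over a short interval, to first order. -/
theorem IsMildSolution.tendsto_duhamel_slope {T : EReal} {S : ℝ → L2Mat} (h : IsMildSolution T S)
    {t b M : ℝ} (ht : 0 ≤ t) (htb : t < b) (hb : (b : EReal) < T)
    (hM : ∀ r ∈ Set.Icc t b, ∀ᵐ x, ‖S r x‖ ≤ M) :
    Tendsto (fun s => (s - t)⁻¹ • ∫ τ in (0 : ℝ)..(s - t), nonl τ (S (s - τ))) (𝓝[>] t)
      (𝓝 (Pst (sqL2 (S t)))) := by
  set P := Pst (sqL2 (S t)) with hP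
  have hcont := h.continuousOn_Icc hb
  rw [Metric.tendsto_nhds]
  intro ε hε
  have hS : Tendsto (fun r => 18 * M * ‖S r - S t‖) (𝓝[Set.Icc t b] t) (𝓝 0) := by
    have h1 : ContinuousWithinAt S (Set.Icc t b) t :=
      (hcont t ⟨ht, htb.le⟩).mono (Set.Icc_subset_Icc_left ht)
    simpa using (tendsto_iff_norm_sub_tendsto_zero.1 h1).const_mul (18 * M)
  have hH : Tendsto (fun τ => ‖heatL2 τ P - P‖) (𝓝[Set.Ici 0] 0) (𝓝 0) := by
    have h1 := continuousOn_heatL2 P 0 (Set.mem_Ici.2 le_rfl)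
    rw [ContinuousWithinAt, heatL2_zero] at h1
    exact tendsto_iff_norm_sub_tendsto_zero.1 h1
  have e1 := hS.eventually (gt_mem_nhds (show 0 < ε / 4 by positivity))
  have e2 := hH.eventually (gt_mem_nhds (show 0 < ε / 4 by positivity))
  obtain ⟨δ₁, hδ₁, k1⟩ := Metric.mem_nhdsWithin_iff.1 e1
  obtain ⟨δ₂, hδ₂, k2⟩ := Metric.mem_nhdsWithin_iff.1 e2
  have hδ : 0 < min (min δ₁ δ₂) (b - t) := lt_min (lt_min hδ₁ hδ₂) (by linarith)
  filter_upwards [Ioo_mem_nhdsGT (show t < t + min (min δ₁ δ₂) (b - t) by linarith)] with s hs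
  have hs1 : s - t < δ₁ := by
    have := min_le_left (min δ₁ δ₂) (b - t)
    have := min_le_left δ₁ δ₂
    linarith [hs.2]
  have hs2 : s - t < δ₂ := by
    have := min_le_left (min δ₁ δ₂) (b - t)
    have := min_le_right δ₁ δ₂
    linarith [hs.2]
  have hsb : s < b := by
    have := min_le_right (min δ₁ δ₂) (b - t)
    linarith [hs.2]
  have hst : 0 < s - t := by linarith [hs.1]
  have hint : IntervalIntegrable (fun τ => nonl τ (S (s - τ))) volume 0 (s - t) := by
    have := intervalIntegrable_nonl (S := fun r => S (t + r)) hst.le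
      ((hcont.comp (by fun_prop) fun r hr => ⟨by linarith [hr.1], by linarith [hr.2]⟩))
    simpa [← add_sub_assoc] using this
  have hbound : ∀ τ ∈ Set.uIoc 0 (s - t), ‖nonl τ (S (s - τ)) - P‖ ≤ ε / 2 := by
    intro τ hτ
    rw [Set.uIoc_of_le hst.le] at hτ
    have hr : s - τ ∈ Set.Icc t b := ⟨by linarith [hτ.2], by linarith [hτ.1]⟩
    have b1 : 18 * M * ‖S (s - τ) - S t‖ < ε / 4 := by
      refine k1 ⟨?_, hr⟩
      rw [Metric.mem_ball, Real.dist_eq, abs_lt]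
      constructor <;> linarith [hr.1, hτ.1]
    have b2 : ‖heatL2 τ P - P‖ < ε / 4 := by
      refine k2 ⟨?_, Set.mem_Ici.2 hτ.1.le⟩
      rw [Metric.mem_ball, Real.dist_eq, abs_lt]
      constructor <;> linarith [hτ.1, hτ.2]
    rw [nonl_eq_heatL2 hτ.1 (hM _ hr)]
    -- The error splits into the change of S² in time, controlled in L² through the sup bound, and
    -- the strong continuity of the heat flow at time 0.
    have e : heatL2 τ (Pst (sqL2 (S (s - τ)))) - P
        = heatL2 τ (Pst (sqL2 (S (s - τ)) - sqL2 (S t))) + (heatL2 τ P - P) := by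
      rw [map_sub, map_sub]
      abel
    rw [e]
    refine (norm_add_le _ _).trans ?_
    have b3 := (norm_heatL2_le hτ.1.le _).trans ((norm_Pst_le _).trans
      (norm_sqL2_sub_le (hM _ hr) (hM t ⟨le_rfl, htb.le⟩)))
    linarith
  have hc : ∫ _τ in (0 : ℝ)..(s - t), P = (s - t) • P := by simp
  have key := intervalIntegral.norm_integral_le_of_norm_le_const hbound
  rw [intervalIntegral.integral_sub hint intervalIntegrable_const, hc, sub_zero,
    abs_of_pos hst] at key
  rw [dist_eq_norm]
  have e3 : (s - t)⁻¹ • (∫ τ in (0 : ℝ)..(s - t), nonl τ (S (s - τ))) - P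
      = (s - t)⁻¹ • ((∫ τ in (0 : ℝ)..(s - t), nonl τ (S (s - τ))) - (s - t) • P) := by
    rw [smul_sub, smul_smul, inv_mul_cancel₀ hst.ne', one_smul]
  rw [e3, norm_smul, norm_inv, Real.norm_of_nonneg hst.le]
  calc (s - t)⁻¹ * _ ≤ (s - t)⁻¹ * (ε / 2 * (s - t)) := by gcongr
    _ = ε / 2 := by field_simp
    _ < ε := by linarith

theorem norm_sq_eq_integral_fourierL2 (S : L2Mat) : ‖S‖ ^ 2 = ∫ ξ, ‖fourierL2 S ξ‖ ^ 2 := by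
  rw [← real_inner_self_eq_norm_sq, inner_fourierL2, L2.inner_def]
  have : ∀ ξ, inner ℂ (fourierL2 S ξ) (fourierL2 S ξ) = ((‖fourierL2 S ξ‖ ^ 2 : ℝ) : ℂ) := fun ξ => by
    rw [inner_self_eq_norm_sq_to_K]
    simp
  simp only [this]
  rw [integral_complex_ofReal, Complex.ofReal_re]

theorem integrable_fourierL2_sq (S : L2Mat) : Integrable fun ξ => ‖fourierL2 S ξ‖ ^ 2 :=
  (memLp_two_iff_integrable_sq_norm (Lp.memLp _).1).1 (Lp.memLp _)

theorem integrable_dirichlet {S : L2Mat} (hS : dirichlet S ≠ ∞) :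
    Integrable (fun ξ : R3 => (‖ξ‖ * ‖fourierL2 S ξ‖) ^ 2) ∧
      ∫ ξ : R3, (‖ξ‖ * ‖fourierL2 S ξ‖) ^ 2 = (dirichlet S).toReal := by
  have hm : AEStronglyMeasurable (fun ξ : R3 => (‖ξ‖ * ‖fourierL2 S ξ‖) ^ 2) volume :=
    (continuous_norm.aestronglyMeasurable.mul (Lp.aestronglyMeasurable _).norm).pow 2
  have e : dirichlet S = ∫⁻ ξ : R3, ‖(‖ξ‖ * ‖fourierL2 S ξ‖) ^ 2‖ₑ := by
    refine lintegral_congr fun ξ => ?_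
    rw [enorm_pow, enorm_mul, enorm_norm, enorm_norm, ofReal_norm]
  refine ⟨⟨hm, ?_⟩, ?_⟩
  · rw [HasFiniteIntegral, ← e]
    exact hS.lt_top
  · rw [e, ← integral_norm_eq_lintegral_enorm hm]
    refine integral_congr_ae (Eventually.of_forall fun ξ => ?_)
    simp only [norm_pow, norm_mul, norm_norm]

/-- In frequency the quotient carries the factor (e^{-8π²|ξ|²h} - 1)/h, bounded by 8π²|ξ|². A finite
Dirichlet integral thus allows dominated convergence; the limit is -2‖∇S‖². -/
theorem tendsto_slope_norm_heatL2 {S : L2Mat} (hS : dirichlet S ≠ ∞) :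
    Tendsto (fun h : ℝ => h⁻¹ * (‖heatL2 h S‖ ^ 2 - ‖S‖ ^ 2)) (𝓝[>] 0)
      (𝓝 (-(8 * Real.pi ^ 2) * (dirichlet S).toReal)) := by
  obtain ⟨hi, hD⟩ := integrable_dirichlet hS
  have e : ∀ h : ℝ, 0 < h → h⁻¹ * (‖heatL2 h S‖ ^ 2 - ‖S‖ ^ 2)
      = ∫ ξ, h⁻¹ * (gaussSymbol h ξ ^ 2 - 1) * ‖fourierL2 S ξ‖ ^ 2 := by
    intro h hh
    have e1 : ∫ ξ, ‖fourierL2 (heatL2 h S) ξ‖ ^ 2 = ∫ ξ, gaussSymbol h ξ ^ 2 * ‖fourierL2 S ξ‖ ^ 2 := by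
      refine integral_congr_ae ?_
      filter_upwards [fourierL2_multiplier (isSymbol_gaussSymbol hh.le) S] with ξ h1
      unfold heatL2
      rw [h1, norm_smul, mul_pow, Complex.norm_real, Real.norm_eq_abs, sq_abs]
    have i1 : Integrable fun ξ => gaussSymbol h ξ ^ 2 * ‖fourierL2 S ξ‖ ^ 2 := by
      refine (integrable_fourierL2_sq (heatL2 h S)).congr ?_
      filter_upwards [fourierL2_multiplier (isSymbol_gaussSymbol hh.le) S] with ξ h1
      unfold heatL2
      rw [h1, norm_smul, mul_pow, Complex.norm_real, Real.norm_eq_abs, sq_abs]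
    rw [norm_sq_eq_integral_fourierL2, norm_sq_eq_integral_fourierL2 S, e1,
      ← integral_sub i1 (integrable_fourierL2_sq S), ← integral_const_mul]
    refine integral_congr_ae (Eventually.of_forall fun ξ => ?_)
    ring
  have hexp : ∀ h ξ, gaussSymbol h ξ ^ 2 = Real.exp (-(8 * Real.pi ^ 2 * ‖ξ‖ ^ 2) * h) := by
    intro h ξ
    unfold gaussSymbol
    rw [← Real.exp_nat_mul]
    congr 1
    push_cast
    ring
  have hlim : Tendsto (fun h : ℝ => ∫ ξ, h⁻¹ * (gaussSymbol h ξ ^ 2 - 1) * ‖fourierL2 S ξ‖ ^ 2) (𝓝[>] 0)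
      (𝓝 (∫ ξ, -(8 * Real.pi ^ 2) * (‖ξ‖ * ‖fourierL2 S ξ‖) ^ 2)) := by
    refine tendsto_integral_filter_of_dominated_convergence
      (fun ξ => 8 * Real.pi ^ 2 * (‖ξ‖ * ‖fourierL2 S ξ‖) ^ 2) ?_ ?_ (hi.const_mul _) ?_
    · filter_upwards [self_mem_nhdsWithin] with h hh
      have : Continuous fun ξ => h⁻¹ * (gaussSymbol h ξ ^ 2 - 1) := by
        unfold gaussSymbol
        fun_prop
      exact this.aestronglyMeasurable.mul ((Lp.aestronglyMeasurable _).norm.pow 2)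
    · filter_upwards [self_mem_nhdsWithin] with h hh
      have hh0 : 0 < h := hh
      refine Eventually.of_forall fun ξ => ?_
      rw [hexp, norm_mul, norm_pow, norm_norm, mul_pow, ← mul_assoc]
      refine mul_le_mul_of_nonneg_right ?_ (by positivity)
      have h1 := Real.add_one_le_exp (-(8 * Real.pi ^ 2 * ‖ξ‖ ^ 2) * h)
      have h2 : Real.exp (-(8 * Real.pi ^ 2 * ‖ξ‖ ^ 2) * h) ≤ 1 := by
        refine Real.exp_le_one_iff.2 ?_
        have : 0 ≤ 8 * Real.pi ^ 2 * ‖ξ‖ ^ 2 * h := by positivity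
        linarith
      rw [norm_mul, norm_inv, Real.norm_of_nonneg hh0.le, Real.norm_eq_abs,
        abs_of_nonpos (by linarith), inv_mul_le_iff₀ hh0]
      linarith
    · refine Eventually.of_forall fun ξ => ?_
      have hd : HasDerivAt (fun h : ℝ => Real.exp (-(8 * Real.pi ^ 2 * ‖ξ‖ ^ 2) * h))
          (Real.exp (-(8 * Real.pi ^ 2 * ‖ξ‖ ^ 2) * 0) * (-(8 * Real.pi ^ 2 * ‖ξ‖ ^ 2) * 1)) 0 :=
        ((hasDerivAt_id (0 : ℝ)).const_mul _).exp
      have h1 := (hasDerivAt_iff_tendsto_slope_zero.1 hd).mono_left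
        (nhdsWithin_mono 0 (fun h (hh : 0 < h) => hh.ne'))
      have h2 := h1.mul_const (‖fourierL2 S ξ‖ ^ 2)
      refine (h2.congr fun h => ?_).trans (le_of_eq ?_)
      · simp [hexp]
      · congr 1
        simp
        ring
  rw [integral_const_mul, hD] at hlim
  refine hlim.congr' ?_
  filter_upwards [self_mem_nhdsWithin] with h hh
  exact (e h hh).symm

/-- The energy identity. -/
theorem IsMildSolution.hasDerivWithinAt_energy {T : EReal} {S : ℝ → L2Mat}
    (h : IsMildSolution T S) {t : ℝ} (ht0 : 0 < t) (ht : (t : EReal) < T) :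
    dirichlet (S t) ≠ ∞ ∧ Integrable (fun x => inner ℝ (S t x) (matSq (S t x))) ∧
      HasDerivWithinAt (fun r => ‖S r‖ ^ 2) (-(8 * Real.pi ^ 2) * (dirichlet (S t)).toReal
        - 4 / 3 * ∫ x, inner ℝ (S t x) (matSq (S t x))) (Set.Ici t) t := by
  obtain ⟨b, htb, hb⟩ := EReal.lt_iff_exists_real_btwn.1 ht
  have htb' : t < b := EReal.coe_lt_coe_iff.1 htb
  obtain ⟨K, hK0, hK⟩ := h.regularity hb ht0
  obtain ⟨M, hM0, hM⟩ := exists_ae_norm_le_of_wNormSq hK0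
  have hMr : ∀ r ∈ Set.Icc t b, ∀ᵐ x, ‖S r x‖ ≤ M := fun r hr => hM _ (hK r hr)
  have htm : t ∈ Set.Icc t b := ⟨le_rfl, htb'.le⟩
  have hD : dirichlet (S t) ≠ ∞ := ((dirichlet_le_wNormSq _).trans_lt
    ((hK t htm).trans_lt ENNReal.ofReal_lt_top)).ne
  have hsq := coeFn_sqL2 (hMr t htm)
  have hcongr : (fun x => inner ℝ (S t x) (sqL2 (S t) x)) =ᵐ[volume]
      fun x => inner ℝ (S t x) (matSq (S t x)) := by
    filter_upwards [hsq] with x hx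
    rw [hx]
  refine ⟨hD, (L2.integrable_inner (𝕜 := ℝ) (S t) (sqL2 (S t))).congr hcongr, ?_⟩
  -- The projection is self-adjoint and fixes `S t`, so it disappears from the pairing.
  have hin : ∫ x, inner ℝ (S t x) (matSq (S t x)) = inner ℝ (S t) (Pst (sqL2 (S t))) := by
    rw [← inner_Pst, Pst_eq_self (h.mem t ht0.le ht), L2.inner_def]
    exact (integral_congr_ae hcongr).symm
  rw [hin, hasDerivWithinAt_iff_tendsto_slope, Set.Ici_sdiff_left]
  set P := Pst (sqL2 (S t))
  have hB := h.tendsto_duhamel_slope ht0.le htb' hb hMr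
  have hsub : Tendsto (fun s : ℝ => s - t) (𝓝[>] t) (𝓝[>] 0) := by
    refine tendsto_nhdsWithin_iff.2 ⟨?_, ?_⟩
    · have : Tendsto (fun s : ℝ => s - t) (𝓝 t) (𝓝 (t - t)) := tendsto_id.sub_const t
      rw [sub_self] at this
      exact this.mono_left nhdsWithin_le_nhds
    · filter_upwards [self_mem_nhdsWithin] with s hs
      exact sub_pos.2 (Set.mem_Ioi.1 hs)
  have hA := (tendsto_slope_norm_heatL2 hD).comp hsub
  have hA0 : Tendsto (fun s => heatL2 (s - t) (S t)) (𝓝[>] t) (𝓝 (S t)) := by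
    have := tendsto_heatL2 (t := fun s : ℝ => s - t) (X := fun _ => S t) le_rfl
      (by filter_upwards [self_mem_nhdsWithin] with s hs using (sub_pos.2 (Set.mem_Ioi.1 hs)).le)
      (hsub.mono_right nhdsWithin_le_nhds) tendsto_const_nhds
    rwa [heatL2_zero] at this
  -- The restarted formula reads S(s) = A - (2/3)B with B = (s-t)(P + o(1)). In the difference
  -- quotient of its squared norm, the term in A gives the dissipation, the cross term gives the
  -- cubic term, and the square of B vanishes in the limit.
  have hlim := (hA.sub ((hA0.inner (𝕜 := ℝ) hB).const_mul (4 / 3))).add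
    (((hsub.mono_right nhdsWithin_le_nhds).mul (hB.norm.pow 2)).const_mul (4 / 9))
  rw [zero_mul, mul_zero, add_zero] at hlim
  refine hlim.congr' ?_
  filter_upwards [Ioo_mem_nhdsGT htb'] with s hs
  have hst : 0 < s - t := by linarith [hs.1]
  have hr := h.restart ht0.le hs.1.le
    (lt_of_le_of_lt (EReal.coe_le_coe_iff.2 hs.2.le) hb)
  rw [slope_def_field, hr]
  set A := heatL2 (s - t) (S t)
  set B := ∫ τ in (0 : ℝ)..(s - t), nonl τ (S (s - τ))
  rw [norm_sub_sq_real, inner_smul_right, inner_smul_right, norm_smul, norm_smul, norm_inv,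
    Real.norm_of_nonneg hst.le, Function.comp_apply]
  norm_num
  field_simp
  ring

/-! ### The growth rate as a potential, and its control by the dissipation. -/

/-- The rate `max {0, -(4/3)⟪S, S²⟫} / |S|²`. -/
def strainRate (S : L2Mat) (x : R3) : ℝ :=
  max 0 (-(4 / 3) * inner ℝ (S x) (matSq (S x))) / ‖S x‖ ^ 2

theorem aestronglyMeasurable_strainRate (S : L2Mat) :
    AEStronglyMeasurable (strainRate S) volume := by
  have hS := Lp.aestronglyMeasurable S
  have h1 : AEMeasurable (fun x => inner ℝ (S x) (matSq (S x))) volume :=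
    (hS.inner (𝕜 := ℝ) (continuous_matSq.comp_aestronglyMeasurable hS)).aemeasurable
  exact ((aemeasurable_const.max (h1.const_mul _)).div
    (hS.norm.aemeasurable.pow_const 2)).aestronglyMeasurable

theorem strainRate_nonneg (S : L2Mat) (x : R3) : 0 ≤ strainRate S x := by
  unfold strainRate
  positivity

theorem strainRate_mul_norm_sq (S : L2Mat) (x : R3) :
    strainRate S x * ‖S x‖ ^ 2 = max 0 (-(4 / 3) * inner ℝ (S x) (matSq (S x))) := by
  unfold strainRate
  rcases eq_or_ne (S x) 0 with h | h
  · simp [h]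
  · rw [div_mul_cancel₀]
    exact pow_ne_zero 2 (norm_ne_zero_iff.2 h)

/-- The constant is (4/3)·9. The bound puts the rate in L² without any assumption on λ₂, which
serves the case of zero initial data. -/
theorem strainRate_le_norm (S : L2Mat) (x : R3) : strainRate S x ≤ 12 * ‖S x‖ := by
  unfold strainRate
  rcases eq_or_ne (S x) 0 with h | h
  · simp [h]
  · rw [div_le_iff₀ (by positivity)]
    have := abs_le.1 (abs_inner_matSq_le (S x))
    refine max_le (by positivity) ?_
    nlinarith [this.1]

/-- This lets `strainRate`, whose measurability is evident, stand in for λ₂⁺ in Hölder's inequality.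
-/
theorem ae_strainRate_le {S : L2Mat} (hS : S ∈ L2st) :
    ∀ᵐ x, strainRate S x ≤ 2 * midEigenvaluePos (S x) := by
  filter_upwards [ae_symm_trace_of_mem_L2st hS] with x hx
  have h0 : 0 ≤ midEigenvaluePos (S x) := le_max_left _ _
  unfold strainRate
  rcases eq_or_ne (S x) 0 with h | h
  · rw [h]
    simpa [h] using h0
  · rw [div_le_iff₀ (by positivity)]
    exact max_le (by positivity) (neg_inner_matSq_le hx.1 hx.2)

theorem eLpNorm_strainRate_le_lamNorm (q : ℝ≥0∞) {S : L2Mat} (hS : S ∈ L2st) :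
    eLpNorm (strainRate S) q volume ≤ 2 * lamNorm q S := by
  have h := eLpNorm_le_mul_eLpNorm_of_ae_le_mul (f := strainRate S)
    (g := fun x => midEigenvaluePos (S x)) (c := 2) (μ := volume) (by
      filter_upwards [ae_strainRate_le hS] with x hx
      have h0 : 0 ≤ midEigenvaluePos (S x) := le_max_left _ _
      rwa [Real.norm_of_nonneg (strainRate_nonneg S x), Real.norm_of_nonneg h0]) q
  simpa [lamNorm] using h

theorem eLpNorm_strainRate_two_le (S : L2Mat) :
    eLpNorm (strainRate S) 2 volume ≤ 12 * ‖S‖ₑ := by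
  have h := eLpNorm_le_mul_eLpNorm_of_ae_le_mul (f := strainRate S)
    (g := S) (c := 12) (μ := volume) (Eventually.of_forall fun x => by
      rw [Real.norm_of_nonneg (strainRate_nonneg S x)]
      exact strainRate_le_norm S x) 2
  rw [Lp.enorm_def]
  simpa using h

/-- The interpolation exponent `3/(2q)`. -/
def interpExp (q : ℝ≥0∞) : ℝ := 3 / (2 * q.toReal)

theorem interpExp_nonneg (q : ℝ≥0∞) : 0 ≤ interpExp q := by
  unfold interpExp
  positivity

theorem three_halves_lt_toReal {q : ℝ≥0∞} (hq : 3 / 2 < q) (h : q ≠ ∞) : 3 / 2 < q.toReal := by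
  have := (ENNReal.toReal_lt_toReal (by simp [ENNReal.div_eq_top]) h).2 hq
  simpa using this

theorem interpExp_lt_one {q : ℝ≥0∞} (hq : 3 / 2 < q) : interpExp q < 1 := by
  unfold interpExp
  rcases eq_or_ne q ∞ with rfl | h
  · simp
  · have := three_halves_lt_toReal hq h
    rw [div_lt_one (by linarith)]
    linarith

/-- With θ = 3/(2q) the relation says 2/p = 2 - 2θ. The case q = ∞ is included: `toReal` gives 0
there, division by zero gives θ = 0, and p = 1. -/
theorem toReal_eq_of_scaling {p q : ℝ≥0∞} (hq : 3 / 2 < q) (hpq : 2 / p + 3 / q = 2) :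
    p.toReal = (1 - interpExp q)⁻¹ := by
  have hq0 : q ≠ 0 := (zero_le.trans_lt hq).ne'
  have hp0 : p ≠ 0 := by
    rintro rfl
    simp [ENNReal.div_zero] at hpq
  have h3q : 3 / q ≠ ∞ := by simp [ENNReal.div_eq_top, hq0]
  have h2p : 2 / p ≠ ∞ := by simp [ENNReal.div_eq_top, hp0]
  have h := congrArg ENNReal.toReal hpq
  rw [ENNReal.toReal_add h2p h3q, ENNReal.toReal_div, ENNReal.toReal_div] at h
  simp only [ENNReal.toReal_ofNat] at h
  have e : 3 / q.toReal = 2 * interpExp q := by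
    unfold interpExp
    rw [← mul_div_assoc, mul_div_mul_left _ _ two_ne_zero]
  rw [e] at h
  have h1 := interpExp_lt_one hq
  have h2 : 1 / p.toReal = 1 - interpExp q := by
    have : 2 / p.toReal = 2 * (1 / p.toReal) := by ring
    linarith
  rw [← h2]
  simp

/-- For finite q this is Hölder for |V|^q, |S|² and |S|⁶ with exponents 1/q, 1-θ and θ/3. The choice
θ = 3/(2q) makes the exponents add up to 1, and the powers of |S| add up to 2. -/
theorem lintegral_mul_enorm_sq_le {q : ℝ≥0∞} (hq : 3 / 2 < q) {V : R3 → ℝ}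
    (hV : AEStronglyMeasurable V volume) (S : L2Mat) :
    ∫⁻ x, ‖V x‖ₑ * ‖S x‖ₑ ^ 2 ≤ eLpNorm V q volume * (‖S‖ₑ ^ 2) ^ (1 - interpExp q)
      * (∫⁻ x, ‖S x‖ₑ ^ 6) ^ (interpExp q / 3) := by
  have hS := (Lp.aestronglyMeasurable S).enorm
  rcases eq_or_ne q ∞ with rfl | hqt
  · have : interpExp ∞ = 0 := by simp [interpExp]
    rw [this, sub_zero, ENNReal.rpow_one, zero_div, ENNReal.rpow_zero, mul_one,
      enorm_sq_eq_lintegral, ← lintegral_const_mul'' _ (hS.pow_const 2)]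
    refine lintegral_mono_ae ?_
    filter_upwards [ae_le_eLpNormEssSup (f := V) (μ := volume)] with x hx
    rw [eLpNorm_exponent_top]
    gcongr
  · have hr := three_halves_lt_toReal hq hqt
    have hq0 : q ≠ 0 := (zero_le.trans_lt hq).ne'
    set r := q.toReal with hrdef
    have hr0 : 0 < r := by linarith
    have hθ : interpExp q = 3 / (2 * r) := rfl
    have hθ1 := interpExp_lt_one hq
    have hθ0 := interpExp_nonneg q
    have hprod := ENNReal.lintegral_prod_norm_pow_le (μ := (volume : Measure R3)) Finset.univ
      (f := ![fun x => ‖V x‖ₑ ^ r, fun x => ‖S x‖ₑ ^ 2, fun x => ‖S x‖ₑ ^ 6])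
      (p := ![1 / r, 1 - interpExp q, interpExp q / 3]) (by
        intro i _
        fin_cases i
        · exact hV.enorm.pow_const r
        · exact hS.pow_const 2
        · exact hS.pow_const 6) (by
        rw [Fin.sum_univ_three]
        simp [hθ]
        field_simp
        ring) (by
        intro i _
        fin_cases i
        · simp; positivity
        · simp; linarith
        · simp; positivity)
    simp only [Fin.prod_univ_three, Matrix.cons_val_zero, Matrix.cons_val_one,
      Matrix.cons_val] at hprod
    rw [eLpNorm_eq_lintegral_rpow_enorm_toReal hq0 hqt, enorm_sq_eq_lintegral]
    refine le_trans (le_of_eq (lintegral_congr fun x => ?_)) hprod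
    rw [← ENNReal.rpow_mul, mul_one_div_cancel hr0.ne', ENNReal.rpow_one, mul_assoc]
    congr 1
    rw [← ENNReal.rpow_natCast, ← ENNReal.rpow_natCast _ 6, ← ENNReal.rpow_mul, ← ENNReal.rpow_mul,
      ← ENNReal.rpow_add_of_nonneg _ _ (by push_cast; nlinarith) (by positivity)]
    congr 1
    push_cast
    ring

theorem rpow_mul_rpow_le_add {θ : ℝ} (h0 : 0 ≤ θ) (h1 : θ ≤ 1) (x y : ℝ≥0∞) :
    x ^ (1 - θ) * y ^ θ ≤ x + y := by
  have h2 : 0 ≤ 1 - θ := by linarith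
  calc x ^ (1 - θ) * y ^ θ ≤ max x y ^ (1 - θ) * max x y ^ θ :=
        mul_le_mul' (ENNReal.rpow_le_rpow (le_max_left _ _) h2)
          (ENNReal.rpow_le_rpow (le_max_right _ _) h0)
    _ = max x y := by
        rw [← ENNReal.rpow_add_of_nonneg _ _ h2 h0]
        simp
    _ ≤ x + y := max_le le_self_add le_add_self

/-- Hölder, Sobolev and Young: a potential in `L^q` is controlled by the dissipation. -/
theorem exists_potential_bound {q : ℝ≥0∞} (hq : 3 / 2 < q) :
    ∃ C : NNReal, ∀ (V : R3 → ℝ), AEStronglyMeasurable V volume → ∀ S : L2Mat,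
      ∫⁻ x, ‖V x‖ₑ * ‖S x‖ₑ ^ 2 ≤ C * eLpNorm V q volume ^ (1 - interpExp q)⁻¹ * ‖S‖ₑ ^ 2
        + ENNReal.ofReal (8 * Real.pi ^ 2) * dirichlet S := by
  obtain ⟨c, hc, hsob⟩ := sobolev
  set θ := interpExp q with hθ
  have hθ0 : 0 ≤ θ := interpExp_nonneg q
  have hθ1 : θ < 1 := interpExp_lt_one hq
  have h1θ : 0 < 1 - θ := by linarith
  set κ := 8 * Real.pi ^ 2 with hκ
  have hκ0 : 0 < κ := by positivity
  -- `B` solves B^{1-θ} κ^θ = c^{θ/3}, so that Young's inequality leaves the Dirichlet integral with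
  -- exactly the coefficient κ of the dissipation.
  set B := (c ^ (θ / 3) * κ ^ (-θ)) ^ (1 - θ)⁻¹ with hB
  have hB0 : 0 < B := by positivity
  refine ⟨B.toNNReal, fun V hV S => ?_⟩
  refine (lintegral_mul_enorm_sq_le hq hV S).trans ?_
  rw [← hθ]
  set N := eLpNorm V q volume
  set E := ‖S‖ₑ ^ 2
  set D := dirichlet S
  have hBc : (ENNReal.ofReal B) ^ (1 - θ) * ENNReal.ofReal κ ^ θ = ENNReal.ofReal c ^ (θ / 3) := by
    rw [ENNReal.ofReal_rpow_of_pos hB0, ENNReal.ofReal_rpow_of_pos hκ0,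
      ENNReal.ofReal_rpow_of_pos hc, ← ENNReal.ofReal_mul (by positivity), hB,
      Real.rpow_inv_rpow (by positivity) h1θ.ne', mul_assoc, ← Real.rpow_add hκ0]
    simp
  calc N * E ^ (1 - θ) * (∫⁻ x, ‖S x‖ₑ ^ 6) ^ (θ / 3)
      ≤ N * E ^ (1 - θ) * (ENNReal.ofReal c * D ^ 3) ^ (θ / 3) := by
        gcongr
        exact hsob S
    _ = (ENNReal.ofReal B * N ^ (1 - θ)⁻¹ * E) ^ (1 - θ) * (ENNReal.ofReal κ * D) ^ θ := by
        rw [ENNReal.mul_rpow_of_nonneg _ _ (by positivity), ENNReal.mul_rpow_of_nonneg _ _ h1θ.le,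
          ENNReal.mul_rpow_of_nonneg _ _ h1θ.le, ENNReal.mul_rpow_of_nonneg _ _ hθ0,
          ENNReal.rpow_inv_rpow h1θ.ne', ← ENNReal.rpow_natCast D, ← ENNReal.rpow_mul, ← hBc]
        rw [show ((3 : ℕ) : ℝ) * (θ / 3) = θ by push_cast; ring]
        ring
    _ ≤ _ := rpow_mul_rpow_le_add hθ0 hθ1.le _ _

/-- With V = `strainRate S` the integrand V|S|² is the positive part of -(4/3)⟪S, S²⟫, and the
Dirichlet term in `hC` cancels the dissipation. -/
theorem ofReal_energy_rate_le {q : ℝ≥0∞} {C : NNReal}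
    (hC : ∀ (V : R3 → ℝ), AEStronglyMeasurable V volume → ∀ S : L2Mat,
      ∫⁻ x, ‖V x‖ₑ * ‖S x‖ₑ ^ 2 ≤ C * eLpNorm V q volume ^ (1 - interpExp q)⁻¹ * ‖S‖ₑ ^ 2
        + ENNReal.ofReal (8 * Real.pi ^ 2) * dirichlet S)
    {S : L2Mat} (hD : dirichlet S ≠ ∞) (hi : Integrable fun x => inner ℝ (S x) (matSq (S x))) :
    ENNReal.ofReal (-(8 * Real.pi ^ 2) * (dirichlet S).toReal
        - 4 / 3 * ∫ x, inner ℝ (S x) (matSq (S x)))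
      ≤ C * eLpNorm (strainRate S) q volume ^ (1 - interpExp q)⁻¹ * ‖S‖ₑ ^ 2 := by
  set w : R3 → ℝ := fun x => max 0 (-(4 / 3) * inner ℝ (S x) (matSq (S x))) with hw
  have hwi : Integrable w := (integrable_zero R3 ℝ volume).sup (hi.const_mul _)
  have h1 : -(8 * Real.pi ^ 2) * (dirichlet S).toReal - 4 / 3 * ∫ x, inner ℝ (S x) (matSq (S x))
      ≤ (∫ x, w x) - 8 * Real.pi ^ 2 * (dirichlet S).toReal := by
    have := integral_mono (hi.const_mul (-(4 / 3))) hwi fun x => le_max_right 0 _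
    rw [integral_const_mul] at this
    linarith
  refine (ENNReal.ofReal_le_ofReal h1).trans ?_
  rw [ENNReal.ofReal_sub _ (by positivity), ENNReal.ofReal_mul (by positivity),
    ENNReal.ofReal_toReal hD, tsub_le_iff_right,
    ofReal_integral_eq_lintegral_ofReal hwi (Eventually.of_forall fun x => le_max_left _ _)]
  refine le_trans (le_of_eq (lintegral_congr fun x => ?_))
    (hC (strainRate S) (aestronglyMeasurable_strainRate S) S)
  simp only [hw]
  rw [← strainRate_mul_norm_sq, ENNReal.ofReal_mul (strainRate_nonneg S x),
    ENNReal.ofReal_pow (norm_nonneg _), ofReal_norm, Real.enorm_of_nonneg (strainRate_nonneg S x)]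

/-! ### Grönwall's inequality and the energy bound. -/

/-- Grönwall's inequality for right derivatives, with a rate that need not be measurable. -/
theorem le_mul_exp_of_hasDerivWithinAt {E E' : ℝ → ℝ} {β : ℝ → ℝ≥0∞} {t : ℝ} (ht : 0 < t)
    (hE0 : ∀ r, 0 ≤ E r) (hcont : ContinuousOn E (Set.Icc 0 t))
    (hderiv : ∀ r ∈ Set.Ioo 0 t, HasDerivWithinAt E (E' r) (Set.Ici r) r)
    (hle : ∀ r ∈ Set.Ioo 0 t, ENNReal.ofReal (E' r) ≤ β r * ENNReal.ofReal (E r))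
    (hβ : ∫⁻ r in Set.Ioc 0 t, β r ≠ ∞) :
    E t ≤ E 0 * Real.exp (∫⁻ r in Set.Ioc 0 t, β r).toReal := by
  set I := (∫⁻ r in Set.Ioc 0 t, β r).toReal with hI
  -- Adding δ keeps the logarithm finite where the energy vanishes; δ tends to 0 at the end.
  have key : ∀ δ : ℝ, 0 < δ → E t + δ ≤ (E 0 + δ) * Real.exp I := by
    intro δ hδ
    have hpos : ∀ r, 0 < E r + δ := fun r => by linarith [hE0 r]
    set f : ℝ → ℝ := fun r => Real.log (E r + δ) with hf
    have hfc : ContinuousOn f (Set.Icc 0 t) :=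
      (hcont.add continuousOn_const).log fun r _ => (hpos r).ne'
    have hfd : ∀ r ∈ Set.Ioo 0 t, HasDerivWithinAt f (E' r / (E r + δ)) (Set.Ici r) r := fun r hr =>
      ((hderiv r hr).add_const δ).log (hpos r).ne'
    -- A right derivative is always measurable, so its positive part can be integrated; `β` enters
    -- only as a pointwise majorant under the lower integral.
    set φ : ℝ → ℝ := fun r => max 0 (derivWithin f (Set.Ici r) r) with hφ
    have hφ0 : ∀ r, 0 ≤ φ r := fun r => le_max_left _ _
    have hφm : Measurable φ := measurable_const.max (measurable_derivWithin_Ici f)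
    have hφe : ∀ r ∈ Set.Ioo 0 t, φ r = max 0 (E' r / (E r + δ)) := fun r hr => by
      simp only [hφ, (hfd r hr).derivWithin (uniqueDiffWithinAt_Ici r)]
    have hφβ : ∀ r ∈ Set.Ioo 0 t, ENNReal.ofReal (φ r) ≤ β r := by
      intro r hr
      rw [hφe r hr, ENNReal.ofReal_max, ENNReal.ofReal_zero]
      refine max_le zero_le ?_
      rw [ENNReal.ofReal_div_of_pos (hpos r)]
      refine ENNReal.div_le_of_le_mul ((hle r hr).trans ?_)
      gcongr
      linarith
    have hφI : ∫⁻ r in Set.Ioc 0 t, ENNReal.ofReal (φ r) ≤ ∫⁻ r in Set.Ioc 0 t, β r := by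
      rw [← restrict_Ioo_eq_restrict_Ioc]
      exact setLIntegral_mono' measurableSet_Ioo hφβ
    have hφi : IntegrableOn φ (Set.Icc 0 t) := by
      rw [integrableOn_Icc_iff_integrableOn_Ioc]
      refine ⟨hφm.aestronglyMeasurable, ?_⟩
      rw [hasFiniteIntegral_iff_ofReal (Eventually.of_forall hφ0)]
      exact hφI.trans_lt hβ.lt_top
    have h1 := intervalIntegral.sub_le_integral_of_hasDeriv_right_of_le ht.le hfc
      (fun r hr => (hfd r hr).mono Set.Ioi_subset_Ici_self) hφi
      (fun r hr => (hφe r hr).symm ▸ le_max_right _ _)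
    have h2 : ∫ r in (0 : ℝ)..t, φ r ≤ I := by
      rw [intervalIntegral.integral_of_le ht.le, integral_eq_lintegral_of_nonneg_ae
        (Eventually.of_forall hφ0) hφm.aestronglyMeasurable]
      exact ENNReal.toReal_mono hβ hφI
    have h3 : Real.log (E t + δ) ≤ Real.log ((E 0 + δ) * Real.exp I) := by
      rw [Real.log_mul (hpos 0).ne' (Real.exp_pos _).ne', Real.log_exp]
      linarith
    exact (Real.log_le_log_iff (hpos t) (mul_pos (hpos 0) (Real.exp_pos _))).1 h3
  refine ge_of_tendsto (f := fun δ => (E 0 + δ) * Real.exp I - δ) (x := 𝓝[>] 0) ?_ ?_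
  · have : Tendsto (fun δ => (E 0 + δ) * Real.exp I - δ) (𝓝 0)
        (𝓝 ((E 0 + 0) * Real.exp I - 0)) := Continuous.tendsto (by fun_prop) 0
    rw [add_zero, sub_zero] at this
    exact this.mono_left nhdsWithin_le_nhds
  · filter_upwards [self_mem_nhdsWithin] with δ hδ
    linarith [key δ hδ]

/-- The majorant `β` is left free: it is a multiple of a power of `lamNorm` in the main estimate and
a constant for zero initial data. -/
theorem IsMildSolution.norm_sq_le {q : ℝ≥0∞} {C : NNReal}
    (hC : ∀ (V : R3 → ℝ), AEStronglyMeasurable V volume → ∀ S : L2Mat,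
      ∫⁻ x, ‖V x‖ₑ * ‖S x‖ₑ ^ 2 ≤ C * eLpNorm V q volume ^ (1 - interpExp q)⁻¹ * ‖S‖ₑ ^ 2
        + ENNReal.ofReal (8 * Real.pi ^ 2) * dirichlet S)
    {T : EReal} {S : ℝ → L2Mat} (h : IsMildSolution T S) {t : ℝ} (ht0 : 0 < t) (ht : (t : EReal) < T)
    {β : ℝ → ℝ≥0∞} (hβ : ∀ r ∈ Set.Ioo 0 t,
      C * eLpNorm (strainRate (S r)) q volume ^ (1 - interpExp q)⁻¹ ≤ β r)
    (hfin : ∫⁻ r in Set.Ioc 0 t, β r ≠ ∞) :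
    ‖S t‖ ^ 2 ≤ ‖S 0‖ ^ 2 * Real.exp (∫⁻ r in Set.Ioc 0 t, β r).toReal := by
  have hlt : ∀ r ∈ Set.Ioo 0 t, (r : EReal) < T := fun r hr =>
    (EReal.coe_lt_coe_iff.2 hr.2).trans ht
  refine le_mul_exp_of_hasDerivWithinAt (E := fun r => ‖S r‖ ^ 2) ht0 (fun r => by positivity)
    ((h.continuousOn_Icc ht).norm.pow 2)
    (fun r hr => (h.hasDerivWithinAt_energy hr.1 (hlt r hr)).2.2) (fun r hr => ?_) hfin
  obtain ⟨hD, hi, -⟩ := h.hasDerivWithinAt_energy hr.1 (hlt r hr)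
  refine (ofReal_energy_rate_le hC hD hi).trans ?_
  rw [ENNReal.ofReal_pow (norm_nonneg _), ofReal_norm]
  exact mul_le_mul_left (hβ r hr) _

/-- The zero solution is the only one with zero initial data. -/
theorem IsMildSolution.eq_zero {T : EReal} {S : ℝ → L2Mat} (h : IsMildSolution T S)
    (h0 : S 0 = 0) {t : ℝ} (ht0 : 0 < t) (ht : (t : EReal) < T) : S t = 0 := by
  -- The exponent q = 2 is admissible, and in L² the rate is bounded on [0,t] because the solution
  -- is, so a constant majorant works.
  have hq : (3 / 2 : ℝ≥0∞) < 2 := by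
    rw [ENNReal.div_lt_iff (by simp) (by simp)]
    norm_num
  obtain ⟨C, hC⟩ := exists_potential_bound hq
  obtain ⟨M, hM⟩ := isCompact_Icc.exists_bound_of_continuousOn (h.continuousOn_Icc ht)
  have hexp : 0 ≤ (1 - interpExp 2)⁻¹ := inv_nonneg.2 (by linarith [interpExp_lt_one hq])
  have h1 := h.norm_sq_le hC ht0 ht
    (β := fun _ => C * (12 * ENNReal.ofReal M) ^ (1 - interpExp 2)⁻¹) (fun r hr => by
      gcongr
      refine (eLpNorm_strainRate_two_le _).trans ?_
      rw [← ofReal_norm]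
      gcongr
      exact hM r (Set.Ioo_subset_Icc_self hr)) (by
      rw [setLIntegral_const]
      exact ENNReal.mul_ne_top (ENNReal.mul_ne_top ENNReal.coe_ne_top
        (ENNReal.rpow_ne_top_of_nonneg hexp (by finiteness))) (by simp))
  rw [h0, norm_zero] at h1
  have h2 : ‖S t‖ ^ 2 ≤ 0 := by simpa using h1
  exact norm_eq_zero.1 (by nlinarith [norm_nonneg (S t)])

/-- The energy inequality, when the integral of the middle eigenvalue is finite. -/
theorem exists_energy_bound {q : ℝ≥0∞} (hq : 3 / 2 < q) :
    ∃ C : NNReal, 0 < C ∧ ∀ p : ℝ≥0∞, 2 / p + 3 / q = 2 →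
      ∀ (T : EReal) (S : ℝ → L2Mat), IsMildSolution T S → ∀ t : ℝ, 0 < t → (t : EReal) < T →
        ∫⁻ τ in Set.Ioc 0 t, lamNorm q (S τ) ^ p.toReal ≠ ∞ →
        ‖S t‖ ^ 2 ≤ ‖S 0‖ ^ 2 *
          Real.exp (C * ∫⁻ τ in Set.Ioc 0 t, lamNorm q (S τ) ^ p.toReal).toReal := by
  obtain ⟨C, hC⟩ := exists_potential_bound hq
  have h0 : 0 ≤ (1 - interpExp q)⁻¹ := inv_nonneg.2 (by linarith [interpExp_lt_one hq])
  -- The power of 2 comes from the factor 2 in front of λ₂⁺; the summand 1 makes the constant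
  -- positive.
  refine ⟨C * 2 ^ (1 - interpExp q)⁻¹ + 1, by positivity, fun p hp T S h t ht0 ht hfin => ?_⟩
  rw [toReal_eq_of_scaling hq hp] at hfin ⊢
  rw [← lintegral_const_mul' _ _ ENNReal.coe_ne_top]
  refine h.norm_sq_le hC ht0 ht (fun r hr => ?_) ?_
  · have hr' : (r : EReal) < T := (EReal.coe_lt_coe_iff.2 hr.2).trans ht
    calc C * eLpNorm (strainRate (S r)) q volume ^ (1 - interpExp q)⁻¹
        ≤ C * (2 * lamNorm q (S r)) ^ (1 - interpExp q)⁻¹ := by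
          gcongr
          exact eLpNorm_strainRate_le_lamNorm q (h.mem r hr.1.le hr')
      _ = ((C * 2 ^ (1 - interpExp q)⁻¹ : NNReal) : ℝ≥0∞)
            * lamNorm q (S r) ^ (1 - interpExp q)⁻¹ := by
          rw [ENNReal.mul_rpow_of_nonneg _ _ h0, ENNReal.coe_mul,
            ENNReal.coe_rpow_of_nonneg _ h0, mul_assoc]
          rfl
      _ ≤ _ := by
          gcongr
          exact le_self_add
  · rw [lintegral_const_mul' _ _ ENNReal.coe_ne_top]
    exact ENNReal.mul_ne_top ENNReal.coe_ne_top hfin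

end

theorem mainTheorem8 (q : ℝ≥0∞) (hq : 3 / 2 < q) :
    ∃ C : NNReal, 0 < C ∧
      ∀ p : ℝ≥0∞, 2 / p + 3 / q = 2 →
      ∀ (T : EReal) (S : ℝ → L2Mat), IsMildSolution T S →
        (∀ t : ℝ, 0 < t → (t : EReal) < T →
          ‖S t‖ₑ ^ 2 ≤ ‖S 0‖ₑ ^ 2 *
            EReal.exp ((C * ∫⁻ τ in Set.Ioc 0 t, lamNorm q (S τ) ^ p.toReal : ℝ≥0∞) : EReal)) ∧
        (IsMaximalTime T S → T < ⊤ →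
          ∫⁻ τ in {τ : ℝ | 0 ≤ τ ∧ (τ : EReal) < T}, lamNorm q (S τ) ^ p.toReal = ∞) := by
  obtain ⟨C, hC0, hC⟩ := exists_energy_bound hq
  refine ⟨C, hC0, fun p hp T S h => ⟨fun t ht0 ht => ?_, fun hmax hT => ?_⟩⟩
  · set I := ∫⁻ τ in Set.Ioc 0 t, lamNorm q (S τ) ^ p.toReal with hI
    by_cases hfin : I = ∞
    -- If S⁰ = 0 the right side is 0·∞ = 0, so the solution itself has to vanish.
    · rcases eq_or_ne (S 0) 0 with h0 | h0
      · rw [h.eq_zero h0 ht0 ht]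
        simp
      · rw [hfin, ENNReal.mul_top (by exact_mod_cast hC0.ne'), EReal.coe_ennreal_top, EReal.exp_top,
          ENNReal.mul_top (by simpa using h0)]
        exact le_top
    · have h1 := hC p hp T S h t ht0 ht hfin
      have hCI : (C * I : ℝ≥0∞) ≠ ∞ := ENNReal.mul_ne_top ENNReal.coe_ne_top hfin
      rw [← EReal.coe_toReal (x := ((C * I : ℝ≥0∞) : EReal))
        (EReal.coe_ennreal_eq_top_iff.not.2 hCI) (EReal.coe_ennreal_ne_bot _),
        EReal.exp_coe, EReal.toReal_coe_ennreal, ← ofReal_norm, ← ofReal_norm,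
        ← ENNReal.ofReal_pow (norm_nonneg _), ← ENNReal.ofReal_pow (norm_nonneg _),
        ← ENNReal.ofReal_mul (by positivity)]
      exact ENNReal.ofReal_le_ofReal h1
  · by_contra hfin
    set J := ∫⁻ τ in {τ : ℝ | 0 ≤ τ ∧ (τ : EReal) < T}, lamNorm q (S τ) ^ p.toReal with hJ
    have hCJ : (C * J : ℝ≥0∞) ≠ ∞ := ENNReal.mul_ne_top ENNReal.coe_ne_top hfin
    -- If the integral over [0,T) were finite, the energy inequality would bound the solution
    -- uniformly on [0,T), against maximality.
    refine h.not_isMaximalTime (M := √(‖S 0‖ ^ 2 * Real.exp (C * J).toReal)) hT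
      (fun t ht0 ht => ?_) hmax
    refine Real.le_sqrt_of_sq_le ?_
    rcases ht0.eq_or_lt with rfl | ht0
    · exact le_mul_of_one_le_right (by positivity) (Real.one_le_exp ENNReal.toReal_nonneg)
    have hsub : ∫⁻ τ in Set.Ioc 0 t, lamNorm q (S τ) ^ p.toReal ≤ J :=
      lintegral_mono_set fun r hr =>
        ⟨hr.1.le, (EReal.coe_le_coe_iff.2 hr.2).trans_lt ht⟩
    refine (hC p hp T S h t ht0 ht (ne_top_of_le_ne_top hfin hsub)).trans ?_
    gcongr
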